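/- Let $(\Omega,\mathcal F)$ be a standard Borel space with a nonatomic probability measure $P$ (for example $(0,1)$ with Lebesgue measure), and let $G=\operatorname{Aut}(\Omega,P)$ be the group of measure preserving automorphisms of the measure algebra of $P$ (measurable sets modulo null sets, with the metric $P(A\bigtriangleup B)$), with the topology of pointwise convergence. A sub-$\sigma$-field is a $\sigma$-field $\mathcal E\subset\mathcal F$ containing all sets of $\mathcal F$ of measure zero. The set of all sub-$\sigma$-fields carries the Wijsman topology of the closed subspaces $L_2(\mathcal E)\subset L_2(\Omega,\mathcal F,P)$, that is, $\mathcal E_n\to\mathcal E$ if and only if $\operatorname{dist}(f,L_2(\mathcal E_n))\to\operatorname{dist}(f,L_2(\mathcal E))$ for every $f\in L_2(\Omega,\mathcal F,P)$. Let $X_1$ be the subspace of those $\mathcal E$ that are conditionally nonatomic, that is, almost all conditional measures of $P$ given $\mathcal E$ are nonatomic. Let $T$ be a compact subset of $[0,+\infty]$. Let $X_T$ be the set of all families $(\mathcal F_t)_{t\in T}$ in $X_1$ such that $\mathcal F_s\subset\mathcal F_t$ whenever $s\le t$, the map $T\ni t\mapsto\mathcal F_t\in X_1$ is continuous, and the sub-$\sigma$-field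 corresponding to the least element of $T$ is trivial (all its sets have probability $0$ or $1$); $X_T$ is a subspace of the space $C(T,X_1)$ with the topology of uniform convergence, and $G$ acts by $g\cdot(\mathcal F_t)_t=(g\cdot\mathcal F_t)_t$. A filtration $(\mathcal F_t)_{t\in T}\in X_T$ is called conditionally nonatomic if for all $s<t$ in $T$ there is a nonatomic sub-$\sigma$-field $\mathcal E$, independent of $\mathcal F_s$, such that $\mathcal F_t$ is generated by $\mathcal F_s$ and $\mathcal E$. Let $X^{\mathrm{cna}}_T\subset X_T$ be the set of all conditionally nonatomic filtrations. Then $X^{\mathrm{cna}}_T$ is a dense $G_\delta$ subset of $X_T$. Hence almost all filtrations are conditionally nonatomic, that is, $X^{\mathrm{cna}}_T$ is comeager in $X_T$; and $X^{\mathrm{cna}}_T$ is itself a Polish $G$-space: $G$ is a Polish group, $X^{\mathrm{cna}}_T$ is $G$-invariant and Polish in the subspace topology, and the action map $G\times X^{\mathrm{cna}}_T\to X^{\mathrm{cna}}_T$ is continuous. -/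

import Mathlib

open MeasureTheory ProbabilityTheory Set Topology
open scoped ENNReal symmDiff

namespace SigmaFields

variable {Ω : Type*} [mΩ : MeasurableSpace Ω]

/-! ### The measure algebra and its automorphism group -/

/-- The measure algebra of `P`: measurable sets modulo null sets, with the metric
`(A, B) ↦ P (A ∆ B)` (carried by `MeasuredSets P`). -/
abbrev MeasureAlgebra (P : Measure Ω) : Type _ := SeparationQuotient (MeasuredSets P)

namespace MeasureAlgebra

variable {P : Measure Ω}

/-- The class of a measurable set. -/
noncomputable def mk (P : Measure Ω) (s : Set Ω) (hs : MeasurableSet s) : MeasureAlgebra P :=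
  SeparationQuotient.mk (show MeasuredSets P from ⟨s, hs⟩)

theorem mk_eq_mk {s t : Set Ω} {hs : MeasurableSet s} {ht : MeasurableSet t} :
    mk P s hs = mk P t ht ↔ s =ᵐ[P] t := by
  refine SeparationQuotient.mk_eq_mk.trans (EMetric.inseparable_iff.trans ?_)
  rw [← measure_symmDiff_eq_zero_iff]
  rfl

theorem exists_rep (a : MeasureAlgebra P) : ∃ s, ∃ hs : MeasurableSet s, mk P s hs = a := by
  obtain ⟨s, rfl⟩ := SeparationQuotient.surjective_mk a
  exact ⟨s.1, s.2, rfl⟩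

/-- `[s] ≤ [t]` if and only if `P (s \ t) = 0`. -/
instance : LE (MeasureAlgebra P) where
  le a b := ∃ s t, ∃ (hs : MeasurableSet s) (ht : MeasurableSet t),
    mk P s hs = a ∧ mk P t ht = b ∧ s ≤ᵐ[P] t

theorem mk_le_mk {s t : Set Ω} {hs : MeasurableSet s} {ht : MeasurableSet t} :
    mk P s hs ≤ mk P t ht ↔ s ≤ᵐ[P] t := by
  constructor
  · rintro ⟨s', t', hs', ht', h1, h2, h⟩
    exact (mk_eq_mk.1 h1).symm.le.trans (h.trans (mk_eq_mk.1 h2).le)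
  · intro h
    exact ⟨s, t, hs, ht, rfl, rfl, h⟩

instance : PartialOrder (MeasureAlgebra P) where
  le_refl a := by
    obtain ⟨s, hs, rfl⟩ := exists_rep a
    exact mk_le_mk.2 (Filter.EventuallyLE.refl _ _)
  le_trans a b c := by
    obtain ⟨s, hs, rfl⟩ := exists_rep a
    obtain ⟨t, ht, rfl⟩ := exists_rep b
    obtain ⟨u, hu, rfl⟩ := exists_rep c
    simp only [mk_le_mk]
    exact fun h1 h2 => h1.trans h2
  le_antisymm a b := by
    obtain ⟨s, hs, rfl⟩ := exists_rep a
    obtain ⟨t, ht, rfl⟩ := exists_rep b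
    simp only [mk_le_mk, mk_eq_mk]
    exact fun h1 h2 => h1.antisymm h2

/-- The measure of an element of the measure algebra. -/
noncomputable def measure : MeasureAlgebra P → ℝ≥0∞ :=
  SeparationQuotient.lift (fun s : MeasuredSets P => P s) fun s t h =>
    measure_congr (mk_eq_mk.1 (SeparationQuotient.mk_eq_mk.2 h : mk P s.1 s.2 = mk P t.1 t.2))

theorem isBot_mk_empty : IsBot (mk P ∅ MeasurableSet.empty) := by
  intro a
  obtain ⟨s, hs, rfl⟩ := exists_rep a
  exact mk_le_mk.2 (LE.le.eventuallyLE (empty_subset s))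

theorem le_mk_compl_iff {s : Set Ω} (hs : MeasurableSet s) (a : MeasureAlgebra P) :
    a ≤ mk P sᶜ hs.compl ↔ ∀ d, d ≤ a → d ≤ mk P s hs → IsBot d := by
  obtain ⟨t, ht, rfl⟩ := exists_rep a
  constructor
  · intro h d hd1 hd2
    obtain ⟨u, hu, rfl⟩ := exists_rep d
    have h1 : u ≤ᵐ[P] sᶜ := (mk_le_mk.1 hd1).trans (mk_le_mk.1 h)
    have h2 : u ≤ᵐ[P] s := mk_le_mk.1 hd2
    have h3 : mk P u hu ≤ mk P ∅ MeasurableSet.empty := by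
      rw [mk_le_mk]
      filter_upwards [h1, h2] with x hx1 hx2 hx
      exact hx1 hx (hx2 hx)
    exact fun b => h3.trans (isBot_mk_empty b)
  · intro h
    have h1 := h (mk P (t ∩ s) (ht.inter hs))
      (mk_le_mk.2 (LE.le.eventuallyLE inter_subset_left))
      (mk_le_mk.2 (LE.le.eventuallyLE inter_subset_right))
      (mk P ∅ MeasurableSet.empty)
    rw [mk_le_mk] at h1 ⊢
    filter_upwards [h1] with x hx hxt hxs
    exact hx ⟨hxt, hxs⟩

theorem isLUB_mk_iUnion {f : ℕ → Set Ω} (hf : ∀ n, MeasurableSet (f n)) :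
    IsLUB (range fun n => mk P (f n) (hf n)) (mk P (⋃ n, f n) (MeasurableSet.iUnion hf)) := by
  constructor
  · rintro _ ⟨n, rfl⟩
    exact mk_le_mk.2 (LE.le.eventuallyLE (subset_iUnion f n))
  · intro b hb
    obtain ⟨t, ht, rfl⟩ := exists_rep b
    have h : ∀ᵐ x ∂P, ∀ n, x ∈ f n → x ∈ t :=
      ae_all_iff.2 fun n => mk_le_mk.1 (hb ⟨n, rfl⟩)
    rw [mk_le_mk]
    filter_upwards [h] with x hx hxU
    obtain ⟨n, hn⟩ := mem_iUnion.1 hxU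
    exact hx n hn

end MeasureAlgebra

/-- The group of measure preserving automorphisms of the measure algebra (an order automorphism
of a Boolean algebra preserves all Boolean operations). -/
noncomputable def autSubgroup (P : Measure Ω) : Subgroup (MeasureAlgebra P ≃o MeasureAlgebra P) where
  carrier := {g | ∀ a, (g a).measure = a.measure}
  mul_mem' {g h} hg hh a := by
    rw [RelIso.mul_apply, hg, hh]
  one_mem' a := rfl
  inv_mem' {g} hg a := by
    rw [← hg (g⁻¹ a), RelIso.apply_inv_self]

/-- `Aut P`, the group of measure preserving automorphisms modulo null sets. -/
abbrev Aut (P : Measure Ω) : Type _ := autSubgroup P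

/-- The topology of pointwise convergence in the metric of the measure algebra. -/
noncomputable instance (P : Measure Ω) : TopologicalSpace (Aut P) :=
  TopologicalSpace.induced
    (fun (g : Aut P) (a : MeasureAlgebra P) =>
      (g : MeasureAlgebra P ≃o MeasureAlgebra P) a) inferInstance

/-! ### The space of sub-σ-fields -/

/-- A sub-σ-field: a σ-field of measurable sets that contains all sets of measure zero. -/
structure SubSigmaField (P : Measure Ω) where
  /-- The underlying σ-field. -/
  toMS : MeasurableSpace Ω
  le : toMS ≤ mΩ
  null_mem : ∀ s, MeasurableSet[mΩ] s → P s = 0 → MeasurableSet[toMS] s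

namespace SubSigmaField

variable {P : Measure Ω}

theorem ext' {E F : SubSigmaField P} (h : E.toMS = F.toMS) : E = F := by
  cases E
  cases F
  cases h
  rfl

/-- Sub-σ-fields are ordered by inclusion. -/
instance : PartialOrder (SubSigmaField P) :=
  PartialOrder.lift SubSigmaField.toMS fun _ _ h => SubSigmaField.ext' h

/-- The Wijsman topology on sub-σ-fields, a sub-σ-field `E` being identified with the closed
subspace `L₂(E)` of `L₂(P)`: the coarsest topology for which the distance from every fixed
`f ∈ L₂(P)` to `L₂(E)` depends continuously on `E`. (For linear subspaces it makes no difference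
whether the distance is truncated at `1`.) -/
noncomputable instance : TopologicalSpace (SubSigmaField P) :=
  TopologicalSpace.induced
    (fun (E : SubSigmaField P) (f : Lp ℝ 2 P) =>
      Metric.infDist f (lpMeas ℝ ℝ E.toMS 2 P : Set (Lp ℝ 2 P))) inferInstance

/-- A measurable set almost equal to a set of the sub-σ-field belongs to the sub-σ-field. -/
theorem measurableSet_congr (E : SubSigmaField P) {s t : Set Ω} (hs : MeasurableSet[E.toMS] s)
    (ht : MeasurableSet t) (h : s =ᵐ[P] t) : MeasurableSet[E.toMS] t := by
  have h0 := measure_symmDiff_eq_zero_iff.2 h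
  have hs' := E.le s hs
  have h1 : MeasurableSet[E.toMS] (s \ t) :=
    E.null_mem _ (hs'.diff ht) (measure_mono_null subset_union_left h0)
  have h2 : MeasurableSet[E.toMS] (t \ s) :=
    E.null_mem _ (ht.diff hs') (measure_mono_null subset_union_right h0)
  have h3 : t = (s \ (s \ t)) ∪ (t \ s) := by
    ext x
    simp only [mem_union, Set.mem_sdiff]
    tauto
  rw [h3]
  exact (hs.diff h1).union h2

/-- Membership in the image of a sub-σ-field under an automorphism. -/
def MemImage (g : Aut P) (E : SubSigmaField P) (s : Set Ω) : Prop :=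
  ∃ hs : MeasurableSet[mΩ] s, ∃ t, ∃ ht : MeasurableSet[E.toMS] t,
    g.1 (MeasureAlgebra.mk P t (E.le t ht)) = MeasureAlgebra.mk P s hs

theorem memImage_empty (g : Aut P) (E : SubSigmaField P) : MemImage g E ∅ := by
  refine ⟨MeasurableSet.empty, ∅, @MeasurableSet.empty Ω E.toMS, ?_⟩
  refine le_antisymm ?_ (MeasureAlgebra.isBot_mk_empty _)
  have h := MeasureAlgebra.isBot_mk_empty (P := P)
    (g.1.symm (MeasureAlgebra.mk P ∅ MeasurableSet.empty))
  exact g.1.le_symm_apply.1 h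

theorem memImage_compl {g : Aut P} {E : SubSigmaField P} {s : Set Ω} (h : MemImage g E s) :
    MemImage g E sᶜ := by
  obtain ⟨hs, t, ht, e⟩ := h
  refine ⟨hs.compl, tᶜ, ht.compl, ?_⟩
  refine eq_of_forall_le_iff fun a => ?_
  obtain ⟨a, rfl⟩ := g.1.surjective a
  rw [g.1.le_iff_le, MeasureAlgebra.le_mk_compl_iff hs, ← e,
    MeasureAlgebra.le_mk_compl_iff (E.le t ht)]
  refine Iff.trans (forall_congr' fun d => ?_) g.1.surjective.forall.symm
  have : IsBot (g.1 d) ↔ IsBot d :=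
    g.1.surjective.forall.trans (forall_congr' fun x => g.1.le_iff_le)
  rw [g.1.le_iff_le, g.1.le_iff_le, this]

theorem memImage_iUnion {g : Aut P} {E : SubSigmaField P} {f : ℕ → Set Ω}
    (h : ∀ n, MemImage g E (f n)) : MemImage g E (⋃ n, f n) := by
  choose hs t ht e using h
  refine ⟨MeasurableSet.iUnion hs, ⋃ n, t n, MeasurableSet.iUnion ht, ?_⟩
  have h1 := (g.1.isLUB_image'.2 (MeasureAlgebra.isLUB_mk_iUnion (P := P) fun n => E.le _ (ht n)))
  rw [← range_comp] at h1
  have h2 := MeasureAlgebra.isLUB_mk_iUnion (P := P) hs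
  have h3 : (fun n => MeasureAlgebra.mk P (f n) (hs n)) =
      g.1 ∘ fun n => MeasureAlgebra.mk P (t n) (E.le _ (ht n)) := funext fun n => (e n).symm
  rw [h3] at h2
  exact h1.unique h2

/-- The image `g • E = {g A : A ∈ E}` of a sub-σ-field under an automorphism. -/
instance : SMul (Aut P) (SubSigmaField P) where
  smul g E :=
    { toMS :=
        { MeasurableSet' := MemImage g E
          measurableSet_empty := by
            exact memImage_empty g E
          measurableSet_compl := fun _ h => memImage_compl h
          measurableSet_iUnion := fun _ h => memImage_iUnion h }
      le := fun _ h => h.1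
      null_mem := fun s hs h0 => by
        obtain ⟨_, t, ht, e⟩ := memImage_empty g E
        exact ⟨hs, t, ht, e.trans (MeasureAlgebra.mk_eq_mk.2 (ae_eq_empty.2 h0).symm)⟩ }

theorem measurableSet_smul_iff {g : Aut P} {E : SubSigmaField P} {s : Set Ω} :
    MeasurableSet[(g • E).toMS] s ↔ MemImage g E s := Iff.rfl

/-- The natural action of `Aut P` on sub-σ-fields. -/
instance : MulAction (Aut P) (SubSigmaField P) where
  one_smul E := by
    refine SubSigmaField.ext' (MeasurableSpace.ext fun s => ?_)
    rw [measurableSet_smul_iff]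
    constructor
    · rintro ⟨hs, t, ht, e⟩
      exact E.measurableSet_congr ht hs (MeasureAlgebra.mk_eq_mk.1 e)
    · intro hs
      exact ⟨E.le s hs, s, hs, rfl⟩
  mul_smul g h E := by
    refine SubSigmaField.ext' (MeasurableSpace.ext fun s => ?_)
    rw [measurableSet_smul_iff, measurableSet_smul_iff]
    constructor
    · rintro ⟨hs, t, ht, e⟩
      obtain ⟨u, hu, e'⟩ := MeasureAlgebra.exists_rep (h.1 (MeasureAlgebra.mk P t (E.le t ht)))
      refine ⟨hs, u, ⟨hu, t, ht, e'.symm⟩, ?_⟩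
      rw [e', ← e]
      rfl
    · rintro ⟨hs, u, ⟨hu, t, ht, e'⟩, e⟩
      refine ⟨hs, t, ht, ?_⟩
      rw [← e, ← e']
      rfl

/-- The trivial sub-σ-field: all its sets have measure `0` or `1`. -/
def IsTrivial (E : SubSigmaField P) : Prop :=
  ∀ s, MeasurableSet[E.toMS] s → P s = 0 ∨ P s = 1

/-- A sub-σ-field is nonatomic if each of its sets of positive measure contains another one of
strictly smaller positive measure. -/
def IsNonatomic (E : SubSigmaField P) : Prop :=
  ∀ s, MeasurableSet[E.toMS] s → 0 < P s →
    ∃ t, t ⊆ s ∧ MeasurableSet[E.toMS] t ∧ 0 < P t ∧ P t < P s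

/-- `E₂ | E₁` is nonatomic: `E₂` is the product of `E₁` and some nonatomic sub-σ-field, that is,
`E₂` is generated by `E₁` and a nonatomic sub-σ-field independent of `E₁`. -/
def IsNonatomicOver (E₂ E₁ : SubSigmaField P) : Prop :=
  ∃ F : SubSigmaField P, F.IsNonatomic ∧ Indep E₁.toMS F.toMS P ∧ E₁.toMS ⊔ F.toMS = E₂.toMS

/-- The set of conditionally nonatomic sub-σ-fields `E`: almost all conditional measures of `P`
given `E` have no atoms. -/
def condNonatomic (P : Measure Ω) [StandardBorelSpace Ω] [IsFiniteMeasure P] :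
    Set (SubSigmaField P) :=
  {E | ∀ᵐ ω ∂P, NullSingletonClass (condExpKernel P E.toMS ω)}

end SubSigmaField

/-! ### Spaces of filtrations -/

open SubSigmaField

variable [StandardBorelSpace Ω]

/-- Continuous filtrations indexed by `T`: continuous nondecreasing maps from `T` to the space of
conditionally nonatomic sub-σ-fields, starting (at the least element of `T`) with the trivial
sub-σ-field. The space of continuous maps carries the topology of uniform convergence (which is
the compact-open topology, as `T` is compact). -/
def filtrationSpace (P : Measure Ω) [IsFiniteMeasure P] (T : Set ℝ≥0∞) :
    Set C(T, condNonatomic P) :=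
  {F | (∀ s t : T, s ≤ t → (F s : SubSigmaField P) ≤ F t) ∧
    ∀ t : T, IsLeast T (t : ℝ≥0∞) → (F t : SubSigmaField P).IsTrivial}

/-- Conditionally nonatomic filtrations. -/
def cnaFiltrations (P : Measure Ω) [IsFiniteMeasure P] (T : Set ℝ≥0∞) :
    Set (filtrationSpace P T) :=
  {F | ∀ s t : T, s < t → (F.1 t : SubSigmaField P).IsNonatomicOver (F.1 s)}

/-- `X` with the given action is a Polish `G`-space. -/
structure IsPolishGSpace (G X : Type*) [Group G] [TopologicalSpace G] [TopologicalSpace X]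
    [MulAction G X] : Prop where
  isTopologicalGroup : IsTopologicalGroup G
  polishSpace_group : PolishSpace G
  polishSpace : PolishSpace X
  continuous_smul : Continuous fun p : G × X => p.1 • p.2

end SigmaFields

/-!
A sub-σ-field `E` is determined by the conditional expectation given `E`, an orthogonal projection
of `L²(P)`, and the Wijsman topology is the strong operator topology on these projections; this
makes the space of sub-σ-fields Polish. By a theorem of Maharam, `F ⊇ E` is generated by `E` and an
independent nonatomic σ-field iff the conditional measures of `P` on `F` given `E` are nonatomic,
which holds iff there are finite `F`-measurable partitions `(A_i)` of arbitrarily small energy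
`∑ ‖P(A_i | E)‖²`. Small energy is an open condition on the pair `(E, F)`. By compactness of `T` it
stays open when imposed on all pairs `(F_s, F_t)` with `s ≤ q < q' ≤ t`, and countably many such
conditions express conditional nonatomicity.

For density, let `M` be the largest σ-field of a filtration `(F_t)`. Since `M` is conditionally
nonatomic, there are independent uniform variables `U_k`, jointly independent of `M`. With
`a : T → [0, 1)` continuous, strictly increasing and zero at the least element of `T`, the
filtration generated by `F_t` and all `U_k ⊓ a(t)`, `k ≥ n`, is conditionally nonatomic. It
converges to `(F_t)` as `n → ∞`, because the variables with `k ≥ n` are eventually independent of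
every event depending on finitely many `U_k`. The truncation leaves `U_k` above `a(t)` unrevealed,
which keeps the filtration in `X_1`.
-/

namespace SigmaFields

open Filter

/-! ### Polish spaces -/

theorem polishSpace_of_isGδ {X : Type*} [TopologicalSpace X] [PolishSpace X] {s : Set X}
    (hs : IsGδ s) : PolishSpace s := by
  obtain ⟨U, hU, rfl⟩ := isGδ_iff_eq_iInter_nat.1 hs
  have (n : ℕ) : PolishSpace (U n) := (hU n).polishSpace
  let diag : (⋂ n, U n : Set X) → X × (∀ n, U n) :=
    fun x => (x, fun n => ⟨x, mem_iInter.1 x.2 n⟩)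
  have hdiag : Continuous diag :=
    continuous_subtype_val.prodMk (continuous_pi fun n => continuous_subtype_val.subtype_mk _)
  have hrange : range diag = {p | ∀ n, (p.2 n : X) = p.1} := by
    refine Subset.antisymm (range_subset_iff.2 fun x n => rfl) fun p hp => ?_
    exact ⟨⟨p.1, mem_iInter.2 fun n => hp n ▸ (p.2 n).2⟩,
      Prod.ext rfl (funext fun n => Subtype.ext (hp n).symm)⟩
  have hclosed : IsClosed (range diag) := by
    rw [hrange, ofPred_forall]
    exact isClosed_iInter fun n => isClosed_eq (by fun_prop) continuous_fst
  have hinducing : IsInducing diag :=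
    IsInducing.of_comp hdiag continuous_fst IsInducing.subtypeVal
  have hinjective : Function.Injective diag := fun x y h => Subtype.ext (congrArg Prod.fst h)
  exact IsClosedEmbedding.polishSpace ⟨⟨hinducing, hinjective⟩, hclosed⟩

theorem isClosed_setOfPred_cauchySeq {A B : Type*} [TopologicalSpace A] [UniformSpace B]
    {F : ℕ → A → B} (hF : Equicontinuous F) : IsClosed {a | CauchySeq fun n => F n a} := by
  refine closure_subset_iff_isClosed.1 fun a ha => cauchySeq_iff.2 fun U hU => ?_
  obtain ⟨V, hV, hVsymm, hVU⟩ := comp_comp_symm_mem_uniformity_sets hU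
  obtain ⟨b, hclose, hb⟩ := mem_closure_iff_nhds.1 ha _ (hF a V hV)
  obtain ⟨N, hN⟩ := cauchySeq_iff.1 hb V hV
  exact ⟨N, fun k hk l hl => hVU ⟨F l b, ⟨F k b, hclose k, hN k hk l hl⟩, SetRel.symm V (hclose l)⟩⟩

/- By equicontinuity, pointwise convergence is determined by the values on a countable dense set. -/
theorem polishSpace_of_equicontinuous {X A B : Type*} [TopologicalSpace X] [TopologicalSpace A]
    [TopologicalSpace.SeparableSpace A] [UniformSpace B] [CompleteSpace B] [PolishSpace B]
    {ρ : X → A → B} (hinducing : IsInducing ρ) (hinjective : Function.Injective ρ)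
    (hequi : Equicontinuous ρ)
    (hlim : ∀ (u : ℕ → X) (p : A → B),
      (∀ a, Tendsto (fun n => ρ (u n) a) atTop (𝓝 (p a))) → ∃ x, ρ x = p) :
    PolishSpace X := by
  obtain ⟨D, hDcount, hD⟩ := TopologicalSpace.exists_countable_dense A
  have := hDcount.to_subtype
  let restrict : X → D → B := fun x a => ρ x a
  have hcont : Continuous restrict :=
    continuous_pi fun a => (continuous_apply (a : A)).comp hinducing.continuous
  have hind : IsInducing restrict := by
    refine isInducing_iff_nhds.2 fun x =>
      le_antisymm (map_le_iff_le_comap.1 hcont.continuousAt) ?_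
    rw [hinducing.nhds_eq_comap, ← map_le_iff_le_comap, ← Tendsto, tendsto_pi_nhds]
    refine fun a => isClosed_property hD.denseRange_val
      (hequi.isClosed_setOfPred_tendsto (hequi.continuous x)) (fun d => ?_) a
    exact ((continuous_apply d).tendsto (restrict x)).comp tendsto_comap
  have hinj : Function.Injective restrict := fun x y hxy =>
    hinjective (hD.denseRange_val.equalizer (hequi.continuous x) (hequi.continuous y) hxy)
  have hclosed : IsClosed (range restrict) := by
    refine IsSeqClosed.isClosed fun v b hv hb => ?_
    choose u hu using hv
    obtain rfl : (fun n => restrict (u n)) = v := funext hu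
    have hcauchy : ∀ a, CauchySeq fun n => ρ (u n) a :=
      isClosed_property hD.denseRange_val (isClosed_setOfPred_cauchySeq (hequi.comp u))
        fun d => (tendsto_pi_nhds.1 hb d).cauchySeq
    choose p hp using fun a => cauchySeq_tendsto_of_complete (hcauchy a)
    obtain ⟨x, hx⟩ := hlim u p hp
    refine ⟨x, funext fun d => ?_⟩
    exact (congrFun hx d).trans (tendsto_nhds_unique (hp d) (tendsto_pi_nhds.1 hb d))
  exact IsClosedEmbedding.polishSpace ⟨⟨hind, hinj⟩, hclosed⟩

theorem polishSpace_continuousMap {T X : Type*} [TopologicalSpace T] [CompactSpace T] [T2Space T]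
    [SecondCountableTopology T] [TopologicalSpace X] [PolishSpace X] : PolishSpace C(T, X) := by
  let := TopologicalSpace.upgradeIsCompletelyMetrizable X
  infer_instance

/-! ### Indicators in `L²` -/

theorem norm_sq_eq_integral {Ω : Type*} [MeasurableSpace Ω] {P : Measure Ω} (f : Lp ℝ 2 P) :
    ‖f‖ ^ 2 = ∫ x, (f x) ^ 2 ∂P := by
  rw [← real_inner_self_eq_norm_sq, L2.inner_def]
  exact integral_congr_ae (Eventually.of_forall fun x => (sq (f x)).symm)

section IndLp

variable {Ω : Type*} [MeasurableSpace Ω] {P : Measure Ω} [IsFiniteMeasure P]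

/-- The class in `L²(P)` of the indicator of a measurable set, extended by zero to sets that are
not measurable, so that the operations on indicators carry no proofs of measurability. -/
noncomputable def indLp (P : Measure Ω) [IsFiniteMeasure P] (s : Set Ω) : Lp ℝ 2 P :=
  open Classical in
  if h : MeasurableSet s then indicatorConstLp 2 h (measure_ne_top P s) 1 else 0

theorem indLp_of_measurableSet {s : Set Ω} (hs : MeasurableSet s) :
    indLp P s = indicatorConstLp 2 hs (measure_ne_top P s) 1 := dif_pos hs

theorem coeFn_indLp {s : Set Ω} (hs : MeasurableSet s) :
    indLp P s =ᵐ[P] s.indicator fun _ => (1 : ℝ) := by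
  rw [indLp_of_measurableSet hs]
  exact indicatorConstLp_coeFn

theorem indLp_congr {s t : Set Ω} (hs : MeasurableSet s) (ht : MeasurableSet t) (h : s =ᵐ[P] t) :
    indLp P s = indLp P t :=
  Lp.ext ((coeFn_indLp hs).trans ((indicator_ae_eq_of_ae_eq_set h).trans (coeFn_indLp ht).symm))

theorem smul_indLp {s : Set Ω} (hs : MeasurableSet s) (c : ℝ) :
    c • indLp P s = indicatorConstLp 2 hs (measure_ne_top P s) c := by
  refine Lp.ext ?_
  filter_upwards [coeFn_indLp (P := P) hs, Lp.coeFn_smul c (indLp P s),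
    indicatorConstLp_coeFn (hs := hs) (hμs := measure_ne_top P s) (c := c)] with x hind hsmul hconst
  rw [hsmul, hconst, Pi.smul_apply, hind, ← indicator_const_smul_apply, smul_eq_mul, mul_one]

theorem inner_indLp {s t : Set Ω} (hs : MeasurableSet s) (ht : MeasurableSet t) :
    inner ℝ (indLp P s) (indLp P t) = P.real (s ∩ t) := by
  rw [indLp_of_measurableSet hs, indLp_of_measurableSet ht,
    L2.real_inner_indicatorConstLp_one_indicatorConstLp_one]

theorem norm_indLp_sq {s : Set Ω} (hs : MeasurableSet s) : ‖indLp P s‖ ^ 2 = P.real s := by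
  rw [← real_inner_self_eq_norm_sq, inner_indLp hs hs, inter_self]

theorem norm_indLp_sub_sq {s t : Set Ω} (hs : MeasurableSet s) (ht : MeasurableSet t) :
    ‖indLp P s - indLp P t‖ ^ 2 = P.real (s ∆ t) := by
  rw [norm_sub_sq_real, norm_indLp_sq hs, norm_indLp_sq ht, inner_indLp hs ht,
    measureReal_symmDiff_eq hs ht,
    ← measureReal_inter_add_sdiff (s := s) ht, ← measureReal_inter_add_sdiff (s := t) hs,
    inter_comm t s]
  ring

theorem ae_eq_of_indLp_eq {s t : Set Ω} (hs : MeasurableSet s) (ht : MeasurableSet t)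
    (h : indLp P s = indLp P t) : s =ᵐ[P] t := by
  rw [← measure_symmDiff_eq_zero_iff, ← measureReal_eq_zero_iff, ← norm_indLp_sub_sq hs ht, h,
    sub_self, norm_zero, zero_pow two_ne_zero]

theorem indLp_empty : indLp P (∅ : Set Ω) = 0 := by
  rw [indLp_of_measurableSet MeasurableSet.empty]
  exact indicatorConstLp_empty

theorem indLp_union {s t : Set Ω} (hs : MeasurableSet s) (ht : MeasurableSet t)
    (h : Disjoint s t) : indLp P (s ∪ t) = indLp P s + indLp P t := by
  rw [indLp_of_measurableSet hs, indLp_of_measurableSet ht, indLp_of_measurableSet (hs.union ht)]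
  exact indicatorConstLp_disjoint_union hs ht _ _ h 1

theorem indLp_compl {s : Set Ω} (hs : MeasurableSet s) :
    indLp P sᶜ = indLp P univ - indLp P s := by
  rw [eq_sub_iff_add_eq', ← indLp_union hs hs.compl disjoint_compl_right, union_compl_self]

theorem tendsto_indLp_iUnion {s : ℕ → Set Ω} (hs : ∀ n, MeasurableSet (s n)) (hm : Monotone s) :
    Tendsto (fun n => indLp P (s n)) atTop (𝓝 (indLp P (⋃ n, s n))) := by
  rw [indLp_of_measurableSet (MeasurableSet.iUnion hs)]
  simp_rw [fun n => indLp_of_measurableSet (P := P) (hs n)]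
  refine tendsto_indicatorConstLp_set (by norm_num) ?_
  have hsdiff := tendsto_measure_iInter_atTop (μ := P) (s := fun n => (⋃ n, s n) \ s n)
    (fun n => ((MeasurableSet.iUnion hs).diff (hs n)).nullMeasurableSet)
    (fun a b h => sdiff_subset_sdiff_right (hm h)) ⟨0, measure_ne_top _ _⟩
  rw [← sdiff_iUnion, sdiff_self, measure_empty] at hsdiff
  refine hsdiff.congr fun n => ?_
  rw [Set.symmDiff_def, sdiff_eq_empty.2 (subset_iUnion s n), empty_union]
  rfl

end IndLp

section ClosedSubspace

variable {Ω : Type*} {m mΩ : MeasurableSpace Ω} {P : Measure Ω} [IsFiniteMeasure P]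
  {V : Submodule ℝ (Lp ℝ 2 P)}

theorem indLp_iUnion_mem (hV : IsClosed (V : Set (Lp ℝ 2 P))) {s : ℕ → Set Ω}
    (hs : ∀ n, MeasurableSet (s n)) (hd : Pairwise (Function.onFun Disjoint s))
    (hsV : ∀ n, indLp P (s n) ∈ V) : indLp P (⋃ n, s n) ∈ V := by
  have hacc (n : ℕ) : MeasurableSet (accumulate s n) :=
    MeasurableSet.biUnion (to_countable _) fun i _ => hs i
  have haccV (n : ℕ) : indLp P (accumulate s n) ∈ V := by
    induction n with
    | zero => simpa only [accumulate_zero_nat] using hsV 0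
    | succ n ih =>
      rw [accumulate_succ, indLp_union (hacc n) (hs _)
        (disjoint_accumulate hd (Nat.lt_succ_self n))]
      exact V.add_mem ih (hsV _)
  have hlim := tendsto_indLp_iUnion (P := P) hacc monotone_accumulate
  rw [iUnion_accumulate] at hlim
  exact hV.mem_of_tendsto hlim (Eventually.of_forall haccV)

theorem indLp_mem_of_isPiSystem (hV : IsClosed (V : Set (Lp ℝ 2 P))) (hm : m ≤ mΩ)
    {C : Set (Set Ω)} (hmC : m = MeasurableSpace.generateFrom C) (hC : IsPiSystem C)
    (huniv : indLp P univ ∈ V) (hCV : ∀ s ∈ C, indLp P s ∈ V) {s : Set Ω}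
    (hs : MeasurableSet[m] s) : indLp P s ∈ V := by
  refine MeasurableSpace.induction_on_inter (C := fun s _ => indLp P s ∈ V) hmC hC ?_ hCV
    (fun s hs h => ?_) (fun g hd hg h => ?_) s hs
  · rw [indLp_empty]
    exact V.zero_mem
  · rw [indLp_compl (hm s hs)]
    exact V.sub_mem huniv h
  · exact indLp_iUnion_mem hV (fun n => hm _ (hg n)) hd h

theorem mem_of_aestronglyMeasurable (hV : IsClosed (V : Set (Lp ℝ 2 P))) (hm : m ≤ mΩ)
    {C : Set (Set Ω)} (hmC : m = MeasurableSpace.generateFrom C) (hC : IsPiSystem C)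
    (huniv : indLp P univ ∈ V) (hCV : ∀ s ∈ C, indLp P s ∈ V)
    {f : Lp ℝ 2 P} (hf : AEStronglyMeasurable[m] f P) : f ∈ V := by
  refine Lp.induction_stronglyMeasurable hm (by norm_num) (fun f => f ∈ V) ?_
    (fun f g hf hg _ _ _ hfV hgV => V.add_mem hfV hgV) (hV.preimage continuous_subtype_val) f hf
  intro c s hs hμs
  rw [Lp.simpleFunc.coe_indicatorConst, ← smul_indLp (hm s hs)]
  exact V.smul_mem c (indLp_mem_of_isPiSystem hV hm hmC hC huniv hCV hs)

end ClosedSubspace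

/-! ### Sub-σ-fields as orthogonal projections -/

namespace SubSigmaField

variable {Ω : Type*} [mΩ : MeasurableSpace Ω] {P : Measure Ω}

section Proj

instance (E : SubSigmaField P) : CompleteSpace (lpMeas ℝ ℝ E.toMS 2 P) := by
  have : Fact (E.toMS ≤ mΩ) := ⟨E.le⟩
  infer_instance

/-- The orthogonal projection of `L²(P)` onto `L²(E)`, that is, the conditional expectation given
`E`, as an operator; it represents `E` in all limiting arguments. -/
noncomputable def proj (E : SubSigmaField P) : Lp ℝ 2 P →L[ℝ] Lp ℝ 2 P :=
  (lpMeas ℝ ℝ E.toMS 2 P).starProjection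

variable (E : SubSigmaField P)

theorem aestronglyMeasurable_proj (f : Lp ℝ 2 P) : AEStronglyMeasurable[E.toMS] (E.proj f) P :=
  mem_lpMeas_iff_aestronglyMeasurable.1
    (Submodule.starProjection_apply_mem (lpMeas ℝ ℝ E.toMS 2 P) f)

theorem proj_eq_self_iff {f : Lp ℝ 2 P} :
    E.proj f = f ↔ AEStronglyMeasurable[E.toMS] f P :=
  Submodule.starProjection_eq_self_iff.trans mem_lpMeas_iff_aestronglyMeasurable

theorem norm_proj_le (f : Lp ℝ 2 P) : ‖E.proj f‖ ≤ ‖f‖ :=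
  Submodule.norm_starProjection_apply_le _ f

theorem lipschitzWith_proj : LipschitzWith 1 E.proj :=
  E.proj.lipschitz.weaken (Submodule.starProjection_norm_le _)

theorem inner_proj_left (f g : Lp ℝ 2 P) : inner ℝ (E.proj f) g = inner ℝ f (E.proj g) :=
  Submodule.inner_starProjection_left_eq_right _ f g

theorem proj_proj (f : Lp ℝ 2 P) : E.proj (E.proj f) = E.proj f :=
  E.proj_eq_self_iff.2 (E.aestronglyMeasurable_proj f)

theorem inner_proj_proj (f g : Lp ℝ 2 P) :
    inner ℝ (E.proj f) (E.proj g) = inner ℝ (E.proj f) g := by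
  rw [← inner_proj_left, proj_proj]

theorem inner_proj_self (f : Lp ℝ 2 P) : inner ℝ (E.proj f) f = ‖E.proj f‖ ^ 2 := by
  rw [← inner_proj_proj, real_inner_self_eq_norm_sq]

theorem infDist_eq_norm_sub_proj (f : Lp ℝ 2 P) :
    Metric.infDist f (lpMeas ℝ ℝ E.toMS 2 P : Set (Lp ℝ 2 P)) = ‖f - E.proj f‖ := by
  rw [Metric.infDist_eq_iInf, proj, Submodule.starProjection_minimal]
  simp only [dist_eq_norm]
  rfl

theorem norm_sub_proj_le {f g : Lp ℝ 2 P} (hg : E.proj g = g) : ‖f - E.proj f‖ ≤ ‖f - g‖ := by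
  rw [← infDist_eq_norm_sub_proj, ← dist_eq_norm]
  exact Metric.infDist_le_dist_of_mem
    (mem_lpMeas_iff_aestronglyMeasurable.2 (E.proj_eq_self_iff.1 hg))

theorem norm_proj_sq (f : Lp ℝ 2 P) :
    ‖E.proj f‖ ^ 2 = ‖f‖ ^ 2 -
      Metric.infDist f (lpMeas ℝ ℝ E.toMS 2 P : Set (Lp ℝ 2 P)) ^ 2 := by
  rw [infDist_eq_norm_sub_proj, norm_sub_sq_real, real_inner_comm, inner_proj_self]
  ring

theorem proj_eq_of_inner_eq_zero {f g : Lp ℝ 2 P} (hg : AEStronglyMeasurable[E.toMS] g P)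
    (h : ∀ w : Lp ℝ 2 P, AEStronglyMeasurable[E.toMS] w P → inner ℝ (f - g) w = 0) :
    E.proj f = g :=
  Submodule.eq_starProjection_of_mem_of_inner_eq_zero (mem_lpMeas_iff_aestronglyMeasurable.2 hg)
    fun w hw => h w (mem_lpMeas_iff_aestronglyMeasurable.1 hw)

theorem proj_proj_of_le {E F : SubSigmaField P} (h : E ≤ F) (f : Lp ℝ 2 P) :
    E.proj (F.proj f) = E.proj f := by
  refine E.proj_eq_of_inner_eq_zero (E.aestronglyMeasurable_proj f) fun w hw => ?_
  rw [inner_sub_left, inner_proj_left, inner_proj_left, F.proj_eq_self_iff.2 (hw.mono h),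
    E.proj_eq_self_iff.2 hw, sub_self]

theorem measurable_of_ae_eq {f g : Ω → ℝ} (hf : Measurable f)
    (hg : Measurable[E.toMS] g) (h : f =ᵐ[P] g) : Measurable[E.toMS] f := by
  intro s hs
  refine E.measurableSet_congr (hg hs) (hf hs) ?_
  filter_upwards [h] with x hx
  exact propext (by simp only [mem_preimage, hx] : x ∈ g ⁻¹' s ↔ x ∈ f ⁻¹' s)

theorem measurable_of_aestronglyMeasurable {f : Ω → ℝ} (hf : Measurable f)
    (h : AEStronglyMeasurable[E.toMS] f P) : Measurable[E.toMS] f :=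
  E.measurable_of_ae_eq hf h.stronglyMeasurable_mk.measurable h.ae_eq_mk

end Proj

section ProjFinite

variable [IsFiniteMeasure P] (E : SubSigmaField P)

theorem proj_toLp_ae_eq {f : Ω → ℝ} (hf : MemLp f 2 P) :
    E.proj (hf.toLp f) =ᵐ[P] P[f | E.toMS] :=
  hf.condExpL2_ae_eq_condExp (𝕜 := ℝ) E.le

theorem proj_indLp_ae_eq {s : Set Ω} (hs : MeasurableSet s) :
    E.proj (indLp P s) =ᵐ[P] P⟦s | E.toMS⟧ := by
  rw [indLp_of_measurableSet hs]
  exact E.proj_toLp_ae_eq (memLp_indicator_const 2 hs (1 : ℝ) (Or.inr (measure_ne_top P s)))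

theorem aestronglyMeasurable_indLp {s : Set Ω} (hs : MeasurableSet[E.toMS] s) :
    AEStronglyMeasurable[E.toMS] (indLp P s) P :=
  ⟨s.indicator fun _ => 1, stronglyMeasurable_const.indicator hs, coeFn_indLp (E.le s hs)⟩

theorem proj_indLp_eq_self_iff {s : Set Ω} (hs : MeasurableSet s) :
    E.proj (indLp P s) = indLp P s ↔ MeasurableSet[E.toMS] s := by
  rw [proj_eq_self_iff]
  refine ⟨fun h => ?_, E.aestronglyMeasurable_indLp⟩
  have hind : Measurable[E.toMS] (s.indicator fun _ => (1 : ℝ)) :=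
    E.measurable_of_aestronglyMeasurable (measurable_const.indicator hs)
      (h.congr (coeFn_indLp hs))
  exact (measurable_indicator_const_iff (1 : ℝ)).1 hind

theorem le_of_proj_eq {E F : SubSigmaField P} (h : E.proj = F.proj) : E.toMS ≤ F.toMS := by
  intro s hs
  rw [← F.proj_indLp_eq_self_iff (E.le s hs), ← h]
  exact (E.proj_indLp_eq_self_iff (E.le s hs)).2 hs

theorem proj_injective : Function.Injective (proj : SubSigmaField P → _) :=
  fun _ _ h => ext' (le_antisymm (le_of_proj_eq h) (le_of_proj_eq h.symm))

end ProjFinite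

section Wijsman

theorem continuous_norm_proj_sq (f : Lp ℝ 2 P) :
    Continuous fun E : SubSigmaField P => ‖E.proj f‖ ^ 2 := by
  simp_rw [norm_proj_sq]
  have hdist : Continuous fun (E : SubSigmaField P) (f : Lp ℝ 2 P) =>
      Metric.infDist f (lpMeas ℝ ℝ E.toMS 2 P : Set (Lp ℝ 2 P)) := continuous_induced_dom
  exact continuous_const.sub (((continuous_apply f).comp hdist).pow 2)

theorem continuous_inner_proj (f g : Lp ℝ 2 P) :
    Continuous fun E : SubSigmaField P => inner ℝ (E.proj f) g := by
  have hpolarization (E : SubSigmaField P) :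
      inner ℝ (E.proj f) g = (‖E.proj (f + g)‖ ^ 2 - ‖E.proj (f - g)‖ ^ 2) / 4 := by
    rw [map_add, map_sub, norm_add_sq_real, norm_sub_sq_real, inner_proj_proj]
    ring
  simp_rw [hpolarization]
  exact ((continuous_norm_proj_sq _).sub (continuous_norm_proj_sq _)).div_const 4

/- Weak convergence and convergence of norms imply strong convergence. -/
theorem continuous_proj (f : Lp ℝ 2 P) : Continuous fun E : SubSigmaField P => E.proj f := by
  refine continuous_iff_continuousAt.2 fun E => tendsto_iff_norm_sub_tendsto_zero.2 ?_
  have hcont : Continuous fun F : SubSigmaField P => ‖F.proj f - E.proj f‖ ^ 2 := by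
    simp_rw [norm_sub_sq_real]
    exact ((continuous_norm_proj_sq f).sub (continuous_const.mul
      (continuous_inner_proj f (E.proj f)))).add continuous_const
  have hlim := (hcont.tendsto E).sqrt
  simpa only [sub_self, norm_zero, ne_eq, OfNat.ofNat_ne_zero, not_false_eq_true, zero_pow,
    Real.sqrt_zero, Real.sqrt_sq (norm_nonneg _)] using hlim

theorem isInducing_proj : IsInducing fun (E : SubSigmaField P) (f : Lp ℝ 2 P) => E.proj f := by
  refine IsInducing.of_comp (g := fun (p : Lp ℝ 2 P → Lp ℝ 2 P) f => ‖f - p f‖)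
    (continuous_pi continuous_proj)
    (continuous_pi fun f => (continuous_const.sub (continuous_apply f)).norm) ⟨?_⟩
  have hdist : ((fun (p : Lp ℝ 2 P → Lp ℝ 2 P) f => ‖f - p f‖) ∘
      fun (E : SubSigmaField P) (f : Lp ℝ 2 P) => E.proj f) =
      fun (E : SubSigmaField P) (f : Lp ℝ 2 P) =>
        Metric.infDist f (lpMeas ℝ ℝ E.toMS 2 P : Set (Lp ℝ 2 P)) :=
    funext₂ fun E f => (E.infDist_eq_norm_sub_proj f).symm
  rw [hdist]
  rfl

theorem tendsto_iff_proj {α : Type*} {l : Filter α} {u : α → SubSigmaField P}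
    {E : SubSigmaField P} :
    Tendsto u l (𝓝 E) ↔ ∀ f, Tendsto (fun a => (u a).proj f) l (𝓝 (E.proj f)) := by
  rw [isInducing_proj.tendsto_nhds_iff, tendsto_pi_nhds]
  rfl

theorem continuous_iff_proj {α : Type*} [TopologicalSpace α] {u : α → SubSigmaField P} :
    Continuous u ↔ ∀ f, Continuous fun a => (u a).proj f := by
  rw [isInducing_proj.continuous_iff, continuous_pi_iff]
  rfl

end Wijsman

end SubSigmaField

/-! ### The space of sub-σ-fields is Polish -/

/-- The vectors on which two families of operators are asymptotically equal along a filter; with a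
closed subspace of such vectors, convergence has to be checked on indicators only. -/
def asymptoticallyEqual {α H : Type*} [NormedAddCommGroup H] [NormedSpace ℝ H] (l : Filter α)
    (Q Q' : α → H →L[ℝ] H) : Submodule ℝ H where
  carrier := {f | Tendsto (fun a => Q a f - Q' a f) l (𝓝 0)}
  add_mem' {f g} hf hg := by
    simpa only [mem_ofPred_eq, map_add, add_sub_add_comm, add_zero] using hf.add hg
  zero_mem' := by
    simpa only [mem_ofPred_eq, map_zero, sub_self] using tendsto_const_nhds
  smul_mem' c f hf := by
    simpa only [mem_ofPred_eq, map_smul, ← smul_sub, smul_zero] using hf.const_smul c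

theorem isClosed_asymptoticallyEqual {α H : Type*} [NormedAddCommGroup H] [NormedSpace ℝ H]
    {l : Filter α} {Q Q' : α → H →L[ℝ] H} {C C' : NNReal} (hQ : ∀ a, LipschitzWith C (Q a))
    (hQ' : ∀ a, LipschitzWith C' (Q' a)) : IsClosed (asymptoticallyEqual l Q Q' : Set H) :=
  (LipschitzWith.uniformEquicontinuous (fun a f => Q a f - Q' a f) (C + C')
    fun a => (hQ a).sub (hQ' a)).equicontinuous.isClosed_setOfPred_tendsto continuous_const

section Sublattice

variable {Ω : Type*} [mΩ : MeasurableSpace Ω] {P : Measure Ω} [IsFiniteMeasure P]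

theorem indLp_inter {s t : Set Ω} (hs : MeasurableSet s) (ht : MeasurableSet t) :
    indLp P (s ∩ t) = indLp P s ⊓ indLp P t := by
  refine Lp.ext ?_
  filter_upwards [coeFn_indLp (P := P) hs, coeFn_indLp (P := P) ht,
    coeFn_indLp (P := P) (hs.inter ht), Lp.coeFn_inf (indLp P s) (indLp P t)]
    with x hxs hxt hxst hinf
  rw [hinf, Pi.inf_apply, hxs, hxt, hxst]
  by_cases s_mem : x ∈ s <;> by_cases t_mem : x ∈ t <;> simp [s_mem, t_mem]

theorem tendsto_Lp_of_ae_norm_le {f : ℕ → Lp ℝ 2 P} {g : Lp ℝ 2 P} (C : ℝ)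
    (hbound : ∀ n, ∀ᵐ x ∂P, ‖f n x‖ ≤ C)
    (hlim : ∀ᵐ x ∂P, Tendsto (fun n => f n x) atTop (𝓝 (g x))) : Tendsto f atTop (𝓝 g) := by
  have hsq : Tendsto (fun n => ‖f n - g‖ ^ 2) atTop (𝓝 (∫ _, (0 : ℝ) ∂P)) := by
    simp_rw [norm_sq_eq_integral]
    refine tendsto_integral_of_dominated_convergence (fun _ => (C + C) ^ 2)
      (fun n => (Lp.aestronglyMeasurable _).pow 2) (integrable_const _) (fun n => ?_) ?_
    · filter_upwards [ae_all_iff.2 hbound, hlim, Lp.coeFn_sub (f n) g] with x hx hxlim hsub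
      have hgx : ‖g x‖ ≤ C := le_of_tendsto hxlim.norm (Eventually.of_forall hx)
      rw [hsub, Pi.sub_apply, norm_pow]
      gcongr
      exact (norm_sub_le _ _).trans (add_le_add (hx n) hgx)
    · filter_upwards [hlim, ae_all_iff.2 fun n => Lp.coeFn_sub (f n) g] with x hx hsub
      simp_rw [hsub, Pi.sub_apply]
      simpa only [sub_self, ne_eq, OfNat.ofNat_ne_zero, not_false_eq_true, zero_pow] using
        (hx.sub_const (g x)).pow 2
  rw [integral_zero] at hsq
  refine tendsto_iff_norm_sub_tendsto_zero.2 ?_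
  simpa only [Real.sqrt_sq (norm_nonneg _), Real.sqrt_zero] using hsq.sqrt

theorem tendsto_min_one_natCast_mul_max (t : ℝ) :
    Tendsto (fun k : ℕ => min 1 (k * max t 0)) atTop (𝓝 ((Ioi 0).indicator 1 t)) := by
  rcases le_or_gt t 0 with ht | ht
  · simp [ht]
  · rw [indicator_of_mem (mem_Ioi.2 ht), Pi.one_apply, max_eq_left ht.le]
    have hlarge : ∀ᶠ k : ℕ in atTop, 1 ≤ k * t :=
      (tendsto_natCast_atTop_atTop.atTop_mul_const ht).eventually_ge_atTop 1
    exact tendsto_const_nhds.congr' (hlarge.mono fun k hk => (min_eq_left hk).symm)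

/-- A closed sublattice of `L²(P)` containing the constants; these are the subspaces of the form
`L²(E)`. -/
structure IsUnitalSublattice (V : Submodule ℝ (Lp ℝ 2 P)) : Prop where
  isClosed : IsClosed (V : Set (Lp ℝ 2 P))
  indLp_univ_mem : indLp P univ ∈ V
  abs_mem : ∀ f ∈ V, |f| ∈ V

namespace IsUnitalSublattice

variable {V : Submodule ℝ (Lp ℝ 2 P)} (hV : IsUnitalSublattice V)
include hV

theorem inf_mem {f g : Lp ℝ 2 P} (hf : f ∈ V) (hg : g ∈ V) : f ⊓ g ∈ V := by
  rw [inf_eq_half_smul_add_sub_abs_sub' ℝ]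
  exact V.smul_mem _ (V.sub_mem (V.add_mem hf hg) (hV.abs_mem _ (V.sub_mem hg hf)))

theorem sup_mem {f g : Lp ℝ 2 P} (hf : f ∈ V) (hg : g ∈ V) : f ⊔ g ∈ V := by
  rw [sup_eq_half_smul_add_add_abs_sub' ℝ]
  exact V.smul_mem _ (V.add_mem (V.add_mem hf hg) (hV.abs_mem _ (V.sub_mem hg hf)))

theorem indLp_compl_mem {s : Set Ω} (hs : MeasurableSet s) (hsV : indLp P s ∈ V) :
    indLp P sᶜ ∈ V := by
  rw [indLp_compl hs]
  exact V.sub_mem hV.indLp_univ_mem hsV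

theorem indLp_iUnion_mem {s : ℕ → Set Ω} (hs : ∀ n, MeasurableSet (s n))
    (hsV : ∀ n, indLp P (s n) ∈ V) : indLp P (⋃ n, s n) ∈ V := by
  rw [← iUnion_disjointed]
  refine SigmaFields.indLp_iUnion_mem hV.isClosed (fun n => .disjointed hs n)
    (disjoint_disjointed s) fun n => ?_
  refine disjointedRec (p := fun t => MeasurableSet t ∧ indLp P t ∈ V) (fun t i ht => ?_)
    ⟨hs n, hsV n⟩ |>.2
  rw [sdiff_eq]
  refine ⟨ht.1.inter (hs i).compl, ?_⟩
  rw [indLp_inter ht.1 (hs i).compl]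
  exact hV.inf_mem ht.2 (hV.indLp_compl_mem (hs i) (hsV i))

/- The indicator of `{c < f}` is the limit of `1 ⊓ k (f - c)⁺` as `k → ∞`. -/
theorem indLp_lt_mem {f : Lp ℝ 2 P} (hf : f ∈ V) (c : ℝ) : indLp P {x | c < f x} ∈ V := by
  let one := indLp P (univ : Set Ω)
  let ramp : ℕ → Lp ℝ 2 P := fun k => one ⊓ ((k : ℝ) • ((f - c • one) ⊔ 0))
  have hrampV (k : ℕ) : ramp k ∈ V :=
    hV.inf_mem hV.indLp_univ_mem (V.smul_mem _
      (hV.sup_mem (V.sub_mem hf (V.smul_mem _ hV.indLp_univ_mem)) V.zero_mem))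
  have hramp : ∀ᵐ x ∂P, ∀ k, ramp k x = min 1 (k * max (f x - c) 0) := by
    refine ae_all_iff.2 fun k => ?_
    filter_upwards [Lp.coeFn_inf one ((k : ℝ) • ((f - c • one) ⊔ 0)),
      Lp.coeFn_smul (k : ℝ) ((f - c • one) ⊔ 0), Lp.coeFn_sup (f - c • one) 0,
      Lp.coeFn_sub f (c • one), Lp.coeFn_smul c one, coeFn_indLp (P := P) MeasurableSet.univ,
      Lp.coeFn_zero ℝ 2 P] with x hinf hsmul hsup hsub hsmul' hone hzero
    rw [hinf, Pi.inf_apply, hsmul, Pi.smul_apply, hsup, Pi.sup_apply, hsub, Pi.sub_apply, hsmul',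
      Pi.smul_apply, hzero, hone, indicator_univ, smul_eq_mul, smul_eq_mul, mul_one]
    rfl
  have hlim : Tendsto ramp atTop (𝓝 (indLp P {x | c < f x})) := by
    refine tendsto_Lp_of_ae_norm_le 1 (fun k => ?_) ?_
    · filter_upwards [hramp] with x hx
      rw [hx, Real.norm_of_nonneg (by positivity)]
      exact min_le_left _ _
    · filter_upwards [hramp, coeFn_indLp (P := P)
        (measurableSet_lt measurable_const (Lp.stronglyMeasurable f).measurable)] with x hx hind
      rw [hind]
      simp_rw [hx]
      convert tendsto_min_one_natCast_mul_max (f x - c) using 2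
      simp only [indicator, mem_ofPred_eq, mem_Ioi, sub_pos, Pi.one_apply]
  exact hV.isClosed.mem_of_tendsto hlim (Eventually.of_forall hrampV)

/-- The sub-σ-field of the sets whose indicators belong to a given closed unital sublattice. -/
def subSigmaField : SubSigmaField P where
  toMS :=
    { MeasurableSet' := fun s => MeasurableSet s ∧ indLp P s ∈ V
      measurableSet_empty := ⟨MeasurableSet.empty, indLp_empty (P := P) ▸ V.zero_mem⟩
      measurableSet_compl := fun _ hs => ⟨hs.1.compl, hV.indLp_compl_mem hs.1 hs.2⟩
      measurableSet_iUnion := fun _ hs =>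
        ⟨MeasurableSet.iUnion fun n => (hs n).1,
          hV.indLp_iUnion_mem (fun n => (hs n).1) fun n => (hs n).2⟩ }
  le := fun _ hs => hs.1
  null_mem := fun _ hs hnull => ⟨hs, by
    rw [indLp_congr hs MeasurableSet.empty (ae_eq_empty.2 hnull), indLp_empty]
    exact V.zero_mem⟩

theorem mem_iff {f : Lp ℝ 2 P} :
    f ∈ V ↔ AEStronglyMeasurable[hV.subSigmaField.toMS] f P := by
  constructor
  · intro hf
    have hmeas : Measurable[hV.subSigmaField.toMS] f :=
      @measurable_of_Ioi _ _ _ _ _ hV.subSigmaField.toMS _ _ _ _ fun c =>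
        ⟨(Lp.stronglyMeasurable f).measurable measurableSet_Ioi, hV.indLp_lt_mem hf c⟩
    exact hmeas.stronglyMeasurable.aestronglyMeasurable
  · exact mem_of_aestronglyMeasurable hV.isClosed hV.subSigmaField.le
      (@MeasurableSpace.generateFrom_measurableSet _ hV.subSigmaField.toMS).symm
      (@MeasurableSpace.isPiSystem_measurableSet _ hV.subSigmaField.toMS)
      hV.indLp_univ_mem fun _ hs => hs.2

end IsUnitalSublattice

end Sublattice

namespace SubSigmaField

variable {Ω : Type*} [mΩ : MeasurableSpace Ω] {P : Measure Ω} {u : ℕ → SubSigmaField P}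

/-- The functions fixed by the pointwise limit of a sequence of conditional expectations; this is
`L²` of the limit of the sub-σ-fields, once the limit is known to exist. -/
noncomputable def limitFixed (u : ℕ → SubSigmaField P) : Submodule ℝ (Lp ℝ 2 P) :=
  asymptoticallyEqual atTop (fun n => (u n).proj) fun _ => ContinuousLinearMap.id ℝ _

theorem mem_limitFixed_iff {f : Lp ℝ 2 P} :
    f ∈ limitFixed u ↔ Tendsto (fun n => (u n).proj f) atTop (𝓝 f) :=
  tendsto_sub_nhds_zero_iff

theorem mem_limitFixed_of_tendsto {f : Lp ℝ 2 P} {v : ℕ → Lp ℝ 2 P}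
    (hv : ∀ n, (u n).proj (v n) = v n) (hvf : Tendsto v atTop (𝓝 f)) : f ∈ limitFixed u := by
  rw [mem_limitFixed_iff]
  rw [tendsto_iff_norm_sub_tendsto_zero] at hvf ⊢
  refine squeeze_zero (fun n => norm_nonneg _) (fun n => ?_) hvf
  rw [norm_sub_rev, norm_sub_rev (v n)]
  exact (u n).norm_sub_proj_le (hv n)

theorem isUnitalSublattice_limitFixed [IsFiniteMeasure P] :
    IsUnitalSublattice (limitFixed u) where
  isClosed := isClosed_asymptoticallyEqual (fun n => (u n).lipschitzWith_proj) fun _ =>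
    LipschitzWith.id
  indLp_univ_mem := mem_limitFixed_of_tendsto
    (fun n => ((u n).proj_indLp_eq_self_iff .univ).2 (@MeasurableSet.univ _ (u n).toMS))
    tendsto_const_nhds
  abs_mem f hf := by
    refine mem_limitFixed_of_tendsto (v := fun n => |(u n).proj f|) (fun n => ?_)
      ((mem_limitFixed_iff.1 hf).sup_nhds (mem_limitFixed_iff.1 hf).neg)
    rw [proj_eq_self_iff]
    exact (continuous_norm.comp_aestronglyMeasurable
      ((u n).aestronglyMeasurable_proj f)).congr (Lp.coeFn_abs _).symm

theorem exists_proj_eq_of_tendsto [IsFiniteMeasure P] (u : ℕ → SubSigmaField P)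
    (p : Lp ℝ 2 P → Lp ℝ 2 P) (h : ∀ f, Tendsto (fun n => (u n).proj f) atTop (𝓝 (p f))) :
    ∃ E : SubSigmaField P, (fun f => E.proj f) = p := by
  have hV := isUnitalSublattice_limitFixed (u := u)
  refine ⟨hV.subSigmaField, funext fun f => proj_eq_of_inner_eq_zero _ ?_ fun w hw => ?_⟩
  · exact hV.mem_iff.1 (mem_limitFixed_of_tendsto (fun n => (u n).proj_proj f) (h f))
  · have hw' := mem_limitFixed_iff.1 (hV.mem_iff.2 hw)
    have hlim : Tendsto (fun n => inner ℝ (f - (u n).proj f) ((u n).proj w)) atTop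
        (𝓝 (inner ℝ (f - p f) w)) := (tendsto_const_nhds.sub (h f)).inner hw'
    refine tendsto_nhds_unique hlim (tendsto_const_nhds.congr fun n => ?_)
    rw [inner_sub_left, ← inner_proj_left, ← inner_proj_left, proj_proj, sub_self]

instance [IsFiniteMeasure P] [MeasurableSpace.CountablyGenerated Ω] :
    PolishSpace (SubSigmaField P) := by
  have : Fact ((2 : ℝ≥0∞) ≠ ∞) := ⟨ENNReal.ofNat_ne_top⟩
  refine polishSpace_of_equicontinuous isInducing_proj
    (fun E F h => proj_injective (ContinuousLinearMap.ext fun f => congrFun h f))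
    (LipschitzWith.uniformEquicontinuous _ 1 lipschitzWith_proj).equicontinuous
    exists_proj_eq_of_tendsto

end SubSigmaField

/-! ### Koopman operators of automorphisms -/

theorem eq_of_indLp {Ω : Type*} [MeasurableSpace Ω] {P : Measure Ω} [IsFiniteMeasure P]
    {S T : Lp ℝ 2 P →L[ℝ] Lp ℝ 2 P}
    (h : ∀ s, MeasurableSet s → S (indLp P s) = T (indLp P s)) : S = T :=
  ContinuousLinearMap.ext fun f =>
    mem_of_aestronglyMeasurable (V := (S : Lp ℝ 2 P →ₗ[ℝ] Lp ℝ 2 P).eqLocus T)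
      (isClosed_eq S.continuous T.continuous) le_rfl
      MeasurableSpace.generateFrom_measurableSet.symm MeasurableSpace.isPiSystem_measurableSet
      (h _ MeasurableSet.univ) h (Lp.aestronglyMeasurable f)

namespace Aut

variable {Ω : Type*} [mΩ : MeasurableSpace Ω] {P : Measure Ω}

/-- `g` maps the class of `t` to the class of `s`. -/
def MapsSet (g : Aut P) (t s : Set Ω) : Prop :=
  ∃ (ht : MeasurableSet t) (hs : MeasurableSet s),
    g.1 (MeasureAlgebra.mk P t ht) = MeasureAlgebra.mk P s hs

theorem exists_mapsSet (g : Aut P) {t : Set Ω} (ht : MeasurableSet t) : ∃ s, MapsSet g t s := by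
  obtain ⟨s, hs, hgt⟩ := MeasureAlgebra.exists_rep (g.1 (MeasureAlgebra.mk P t ht))
  exact ⟨s, ht, hs, hgt.symm⟩

namespace MapsSet

theorem empty (g : Aut P) : MapsSet g ∅ ∅ :=
  ⟨.empty, .empty, le_antisymm
    (g.1.le_symm_apply.1 (MeasureAlgebra.isBot_mk_empty (g.1.symm (MeasureAlgebra.mk P ∅ .empty))))
    (MeasureAlgebra.isBot_mk_empty _)⟩

theorem compl {g : Aut P} {t s : Set Ω} (h : MapsSet g t s) : MapsSet g tᶜ sᶜ := by
  obtain ⟨ht, hs, hgt⟩ := h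
  refine ⟨ht.compl, hs.compl, eq_of_forall_le_iff fun a => ?_⟩
  obtain ⟨a, rfl⟩ := g.1.surjective a
  have hbot (d : MeasureAlgebra P) : IsBot (g.1 d) ↔ IsBot d :=
    g.1.surjective.forall.trans (forall_congr' fun _ => g.1.le_iff_le)
  rw [g.1.le_iff_le, MeasureAlgebra.le_mk_compl_iff hs, ← hgt, MeasureAlgebra.le_mk_compl_iff ht]
  refine Iff.trans (forall_congr' fun d => ?_) g.1.surjective.forall.symm
  rw [g.1.le_iff_le, g.1.le_iff_le, hbot]

theorem iUnion {g : Aut P} {t s : ℕ → Set Ω} (h : ∀ n, MapsSet g (t n) (s n)) :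
    MapsSet g (⋃ n, t n) (⋃ n, s n) := by
  choose ht hs hgt using h
  refine ⟨MeasurableSet.iUnion ht, MeasurableSet.iUnion hs, ?_⟩
  have hlub := g.1.isLUB_image'.2 (MeasureAlgebra.isLUB_mk_iUnion (P := P) ht)
  rw [← range_comp, show g.1 ∘ (fun n => MeasureAlgebra.mk P (t n) (ht n)) =
    fun n => MeasureAlgebra.mk P (s n) (hs n) from funext hgt] at hlub
  exact hlub.unique (MeasureAlgebra.isLUB_mk_iUnion hs)

theorem measure_eq {g : Aut P} {t s : Set Ω} (h : MapsSet g t s) : P s = P t := by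
  obtain ⟨ht, hs, hgt⟩ := h
  have hmeasure := g.2 (MeasureAlgebra.mk P t ht)
  rw [hgt] at hmeasure
  exact hmeasure

theorem congr {g : Aut P} {t s t' s' : Set Ω} (h : MapsSet g t s) (ht' : MeasurableSet t')
    (hs' : MeasurableSet s') (htt' : t =ᵐ[P] t') (hss' : s =ᵐ[P] s') : MapsSet g t' s' := by
  obtain ⟨ht, hs, hgt⟩ := h
  exact ⟨ht', hs', (congrArg g.1 (MeasureAlgebra.mk_eq_mk.2 htt'.symm)).trans
    (hgt.trans (MeasureAlgebra.mk_eq_mk.2 hss'))⟩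

end MapsSet

theorem exists_mapsSet_preimage (g : Aut P) {X : Ω → ℕ → Bool} (hX : Measurable X) :
    ∃ Y : Ω → ℕ → Bool, Measurable Y ∧
      ∀ C, MeasurableSet C → MapsSet g (X ⁻¹' C) (Y ⁻¹' C) := by
  classical
  have hcoord (n : ℕ) : MeasurableSet {ω | X ω n = true} :=
    (measurable_pi_apply n).comp hX (measurableSet_singleton true)
  choose B hB using fun n => exists_mapsSet g (hcoord n)
  let Y : Ω → ℕ → Bool := fun ω n => decide (ω ∈ B n)
  have hpreimage (n : ℕ) : (fun ω => Y ω n) ⁻¹' {true} = B n := by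
    ext ω
    simp only [Y, mem_preimage, mem_singleton_iff, decide_eq_true_eq]
  refine ⟨Y, measurable_pi_iff.2 fun n => measurable_to_bool ((hpreimage n).symm ▸ (hB n).2.1), ?_⟩
  let preimageField : MeasurableSpace (ℕ → Bool) :=
    { MeasurableSet' := fun C => MapsSet g (X ⁻¹' C) (Y ⁻¹' C)
      measurableSet_empty := MapsSet.empty g
      measurableSet_compl := fun _ h => h.compl
      measurableSet_iUnion := fun f h => by
        rw [preimage_iUnion, preimage_iUnion]
        exact MapsSet.iUnion h }
  suffices hle : MeasurableSpace.pi ≤ preimageField from hle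
  refine iSup_le fun n => Measurable.comap_le (@measurable_to_bool _ preimageField _ ?_)
  have hn := hB n
  rw [← hpreimage n] at hn
  exact hn

section StandardBorel

variable [StandardBorelSpace Ω] [IsFiniteMeasure P]

theorem exists_pointMap (g : Aut P) :
    ∃ φ : Ω → Ω, Measurable φ ∧ ∀ t, MeasurableSet t → MapsSet g t (φ ⁻¹' t) := by
  rcases isEmpty_or_nonempty Ω with hΩ | hΩ
  · exact ⟨id, measurable_id, fun t _ => t.eq_empty_of_isEmpty ▸ MapsSet.empty g⟩
  have hX : MeasurableEmbedding (MeasurableSpace.mapNatBool Ω) :=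
    (MeasurableSpace.measurable_mapNatBool Ω).measurableEmbedding
      (MeasurableSpace.injective_mapNatBool Ω)
  set X := MeasurableSpace.mapNatBool Ω
  obtain ⟨Y, hY, hXY⟩ := exists_mapsSet_preimage g hX.measurable
  have hrange : ∀ᵐ ω ∂P, Y ω ∈ range X := by
    have hmeasure := (hXY _ hX.measurableSet_range).measure_eq
    rw [preimage_range] at hmeasure
    exact (ae_iff_measure_eq (hY hX.measurableSet_range).nullMeasurableSet).2 hmeasure
  have hφ : Measurable (hX.invFun ∘ Y) := hX.measurable_invFun.comp hY
  refine ⟨hX.invFun ∘ Y, hφ, fun t ht =>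
    (hXY _ (hX.measurableSet_image.2 ht)).congr ht (hφ ht) ?_ ?_⟩
  · exact .of_eq (preimage_image_eq t hX.injective)
  · filter_upwards [hrange] with ω ⟨x, hx⟩
    refine propext ?_
    change Y ω ∈ X '' t ↔ hX.invFun (Y ω) ∈ t
    rw [← hx, hX.leftInverse_invFun x, hX.injective.mem_set_image]

/-- A measure preserving point map inducing an automorphism of the measure algebra by preimages;
it makes the Koopman operator available as a composition operator. -/
noncomputable def pointMap (g : Aut P) : Ω → Ω := (exists_pointMap g).choose

theorem mapsSet_pointMap (g : Aut P) {t : Set Ω} (ht : MeasurableSet t) :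
    MapsSet g t (g.pointMap ⁻¹' t) := (exists_pointMap g).choose_spec.2 t ht

theorem measurePreserving_pointMap (g : Aut P) : MeasurePreserving g.pointMap P P :=
  ⟨(exists_pointMap g).choose_spec.1, Measure.ext fun t ht => by
    rw [pointMap, Measure.map_apply (exists_pointMap g).choose_spec.1 ht]
    exact (g.mapsSet_pointMap ht).measure_eq⟩

/-- The Koopman operator of an automorphism: the isometry of `L²(P)` extending the action on
indicators. -/
noncomputable def koopman (g : Aut P) : Lp ℝ 2 P →ₗᵢ[ℝ] Lp ℝ 2 P :=
  Lp.compMeasurePreservingₗᵢ ℝ g.pointMap g.measurePreserving_pointMap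

theorem koopman_indLp (g : Aut P) {t s : Set Ω} (h : MapsSet g t s) :
    g.koopman (indLp P t) = indLp P s := by
  have hpreimage : g.koopman (indLp P t) = indLp P (g.pointMap ⁻¹' t) := by
    rw [indLp_of_measurableSet h.1,
      indLp_of_measurableSet (g.measurePreserving_pointMap.measurable h.1)]
    rfl
  obtain ⟨ht, hs, hgt⟩ := h
  obtain ⟨_, hφt, hgφt⟩ := g.mapsSet_pointMap ht
  rw [hpreimage]
  exact indLp_congr hφt hs (MeasureAlgebra.mk_eq_mk.1 (hgφt.symm.trans hgt))

theorem koopman_mul (g h : Aut P) (f : Lp ℝ 2 P) :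
    (g * h).koopman f = g.koopman (h.koopman f) := by
  refine DFunLike.congr_fun (eq_of_indLp (S := (g * h).koopman.toContinuousLinearMap)
    (T := g.koopman.toContinuousLinearMap.comp h.koopman.toContinuousLinearMap) fun s hs => ?_) f
  obtain ⟨t, hst⟩ := exists_mapsSet h hs
  obtain ⟨r, htr⟩ := exists_mapsSet g hst.2.1
  have hsr : MapsSet (g * h) s r := ⟨hs, htr.2.1, by
    rw [← htr.2.2, ← hst.2.2]
    rfl⟩
  change (g * h).koopman _ = g.koopman (h.koopman _)
  rw [koopman_indLp _ hsr, koopman_indLp _ hst, koopman_indLp _ htr]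

theorem koopman_one (f : Lp ℝ 2 P) : (1 : Aut P).koopman f = f :=
  DFunLike.congr_fun (eq_of_indLp (S := (1 : Aut P).koopman.toContinuousLinearMap)
    (T := ContinuousLinearMap.id ℝ _) fun _ hs => koopman_indLp 1 ⟨hs, hs, rfl⟩) f

theorem koopman_koopman_inv (g : Aut P) (f : Lp ℝ 2 P) : g.koopman (g⁻¹.koopman f) = f := by
  rw [← koopman_mul, mul_inv_cancel, koopman_one]

end StandardBorel

end Aut

namespace MeasureAlgebra

variable {Ω : Type*} [mΩ : MeasurableSpace Ω] {P : Measure Ω}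

theorem measure_ne_top [IsFiniteMeasure P] (a : MeasureAlgebra P) : a.measure ≠ ∞ := by
  obtain ⟨s, hs, rfl⟩ := exists_rep a
  exact MeasureTheory.measure_ne_top P s

section Ind

variable [IsFiniteMeasure P]

/-- The indicator of an element of the measure algebra, which embeds the measure algebra as a
closed subset of `L²(P)`. -/
noncomputable def ind (a : MeasureAlgebra P) : Lp ℝ 2 P :=
  indLp P a.exists_rep.choose

theorem ind_mk {s : Set Ω} (hs : MeasurableSet s) : ind (mk P s hs) = indLp P s := by
  obtain ⟨hs', h⟩ := (mk P s hs).exists_rep.choose_spec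
  exact indLp_congr hs' hs (mk_eq_mk.1 h)

theorem ind_injective : Function.Injective (ind : MeasureAlgebra P → _) := by
  intro a b h
  obtain ⟨s, hs, rfl⟩ := exists_rep a
  obtain ⟨t, ht, rfl⟩ := exists_rep b
  rw [ind_mk, ind_mk] at h
  exact mk_eq_mk.2 (ae_eq_of_indLp_eq hs ht h)

theorem norm_ind_sq (a : MeasureAlgebra P) : ‖a.ind‖ ^ 2 = a.measure.toReal := by
  obtain ⟨s, hs, rfl⟩ := exists_rep a
  rw [ind_mk, norm_indLp_sq hs]
  rfl

theorem ind_le_ind {a b : MeasureAlgebra P} : a.ind ≤ b.ind ↔ a ≤ b := by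
  obtain ⟨s, hs, rfl⟩ := exists_rep a
  obtain ⟨t, ht, rfl⟩ := exists_rep b
  rw [ind_mk, ind_mk, mk_le_mk, ← Lp.coeFn_le]
  refine eventually_congr ?_
  filter_upwards [coeFn_indLp (P := P) hs, coeFn_indLp (P := P) ht] with x hxs hxt
  rw [hxs, hxt]
  change _ ↔ (x ∈ s → x ∈ t)
  by_cases s_mem : x ∈ s <;> by_cases t_mem : x ∈ t <;> simp [s_mem, t_mem]

theorem edist_eq (a b : MeasureAlgebra P) : edist a b = ENNReal.ofReal (‖a.ind - b.ind‖ ^ 2) := by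
  obtain ⟨s, hs, rfl⟩ := exists_rep a
  obtain ⟨t, ht, rfl⟩ := exists_rep b
  rw [ind_mk, ind_mk, norm_indLp_sub_sq hs ht, ofReal_measureReal]
  rfl

theorem tendsto_iff_ind {α : Type*} {l : Filter α} {u : α → MeasureAlgebra P}
    {a : MeasureAlgebra P} :
    Tendsto u l (𝓝 a) ↔ Tendsto (fun x => (u x).ind) l (𝓝 a.ind) := by
  rw [tendsto_iff_edist_tendsto_0, tendsto_iff_norm_sub_tendsto_zero]
  simp_rw [edist_eq]
  constructor
  · intro h
    have hnorm := ((ENNReal.tendsto_toReal ENNReal.zero_ne_top).comp h).sqrt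
    simpa only [Function.comp_def, ENNReal.toReal_ofReal (sq_nonneg _), ENNReal.toReal_zero,
      Real.sqrt_sq (norm_nonneg _), Real.sqrt_zero] using hnorm
  · intro h
    have hsq := ENNReal.tendsto_ofReal (h.pow 2)
    rwa [zero_pow two_ne_zero, ENNReal.ofReal_zero] at hsq

theorem range_ind : range (ind : MeasureAlgebra P → _) =
    {f | |(2 : ℝ) • f - indLp P univ| = indLp P univ} := by
  have hone : ∀ᵐ x ∂P, indLp P univ x = 1 := by
    filter_upwards [coeFn_indLp (P := P) MeasurableSet.univ] with x hx
    rw [hx, indicator_univ]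
  have habs (f : Lp ℝ 2 P) : ∀ᵐ x ∂P, |(2 : ℝ) • f - indLp P univ| x = |2 * f x - 1| := by
    filter_upwards [Lp.coeFn_abs ((2 : ℝ) • f - indLp P univ), hone,
      Lp.coeFn_sub ((2 : ℝ) • f) (indLp P univ), Lp.coeFn_smul (2 : ℝ) f]
      with x hx hone hsub hsmul
    rw [hx, hsub, Pi.sub_apply, hsmul, Pi.smul_apply, hone, smul_eq_mul]
  ext f
  constructor
  · rintro ⟨a, rfl⟩
    obtain ⟨s, hs, rfl⟩ := exists_rep a
    rw [ind_mk]
    refine Lp.ext ?_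
    filter_upwards [habs (indLp P s), hone, coeFn_indLp (P := P) hs] with x hx hone hind
    rw [hx, hone, hind]
    by_cases hxs : x ∈ s <;> norm_num [hxs]
  · intro (hf : |(2 : ℝ) • f - indLp P univ| = indLp P univ)
    have hs : MeasurableSet {x | f x = 1} :=
      (Lp.stronglyMeasurable f).measurable (measurableSet_singleton 1)
    refine ⟨mk P _ hs, (ind_mk hs).trans (Lp.ext ?_)⟩
    filter_upwards [coeFn_indLp (P := P) hs, habs f, hone] with x hind hx hone
    rw [hf, hone] at hx
    rw [hind]
    rcases eq_or_eq_neg_of_abs_eq hx.symm with hfx | hfx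
    · have hfx : f x = 1 := by linarith
      rw [indicator_of_mem (show x ∈ {x | f x = 1} from hfx), hfx]
    · have hfx : f x = 0 := by linarith
      rw [indicator_of_notMem (by simp [hfx]), hfx]

theorem isClosed_range_ind : IsClosed (range (ind : MeasureAlgebra P → _)) := by
  have hcont : Continuous fun f : Lp ℝ 2 P => (2 : ℝ) • f - indLp P univ := by fun_prop
  rw [range_ind]
  exact isClosed_eq (hcont.sup hcont.neg) continuous_const

end Ind

end MeasureAlgebra

/-! ### The Polish group of automorphisms -/

namespace Aut

variable {Ω : Type*} [mΩ : MeasurableSpace Ω] {P : Measure Ω}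

theorem tendsto_iff {α : Type*} {l : Filter α} {u : α → Aut P} {g : Aut P} :
    Tendsto u l (𝓝 g) ↔ ∀ a, Tendsto (fun x => (u x).1 a) l (𝓝 (g.1 a)) := by
  have hinducing : IsInducing (fun (g : Aut P) (a : MeasureAlgebra P) =>
      (g : MeasureAlgebra P ≃o MeasureAlgebra P) a) := ⟨rfl⟩
  rw [hinducing.tendsto_nhds_iff, tendsto_pi_nhds]
  rfl

variable [StandardBorelSpace Ω] [IsFiniteMeasure P]

theorem koopman_ind (g : Aut P) (a : MeasureAlgebra P) : g.koopman a.ind = (g.1 a).ind := by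
  obtain ⟨s, hs, rfl⟩ := MeasureAlgebra.exists_rep a
  obtain ⟨t, ht, hgs⟩ := MeasureAlgebra.exists_rep (g.1 (MeasureAlgebra.mk P s hs))
  rw [← hgs, MeasureAlgebra.ind_mk, MeasureAlgebra.ind_mk]
  exact koopman_indLp g ⟨hs, ht, hgs.symm⟩

theorem continuous_koopman (f : Lp ℝ 2 P) : Continuous fun g : Aut P => g.koopman f := by
  refine continuous_iff_continuousAt.2 fun g => tendsto_sub_nhds_zero_iff.1 ?_
  let Q : Aut P → Lp ℝ 2 P →L[ℝ] Lp ℝ 2 P := fun g => g.koopman.toContinuousLinearMap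
  have hind (s : Set Ω) (hs : MeasurableSet s) :
      indLp P s ∈ asymptoticallyEqual (𝓝 g) Q fun _ => Q g := by
    refine tendsto_sub_nhds_zero_iff.2 ?_
    change Tendsto (fun h : Aut P => h.koopman (indLp P s)) _ (𝓝 (g.koopman (indLp P s)))
    rw [← MeasureAlgebra.ind_mk hs]
    simp_rw [koopman_ind]
    exact MeasureAlgebra.tendsto_iff_ind.1 (tendsto_iff.1 tendsto_id _)
  exact mem_of_aestronglyMeasurable (V := asymptoticallyEqual (𝓝 g) Q fun _ => Q g)
    (isClosed_asymptoticallyEqual (fun h => h.koopman.lipschitz) fun _ => g.koopman.lipschitz)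
    le_rfl MeasurableSpace.generateFrom_measurableSet.symm
    MeasurableSpace.isPiSystem_measurableSet (hind _ MeasurableSet.univ) hind
    (Lp.aestronglyMeasurable f)

theorem tendsto_iff_koopman {α : Type*} {l : Filter α} {u : α → Aut P} {g : Aut P} :
    Tendsto u l (𝓝 g) ↔ ∀ f, Tendsto (fun x => (u x).koopman f) l (𝓝 (g.koopman f)) := by
  refine ⟨fun h f => ((continuous_koopman f).tendsto g).comp h, fun h => tendsto_iff.2 fun a => ?_⟩
  rw [MeasureAlgebra.tendsto_iff_ind]
  simp_rw [← koopman_ind]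
  exact h _

theorem continuous_iff_koopman {α : Type*} [TopologicalSpace α] {u : α → Aut P} :
    Continuous u ↔ ∀ f, Continuous fun x => (u x).koopman f := by
  simp_rw [continuous_iff_continuousAt, ContinuousAt, tendsto_iff_koopman]
  exact forall_comm

theorem continuous_koopman_uncurry :
    Continuous fun p : Aut P × Lp ℝ 2 P => p.1.koopman p.2 :=
  continuous_prod_of_continuous_lipschitzWith' _ 1
    (fun g => g.koopman.lipschitz) continuous_koopman

theorem continuous_koopman_apply {α : Type*} [TopologicalSpace α] {u : α → Aut P}
    {v : α → Lp ℝ 2 P} (hu : Continuous u) (hv : Continuous v) :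
    Continuous fun x => (u x).koopman (v x) :=
  (Continuous.comp continuous_koopman_uncurry (hu.prodMk hv) :)

theorem tendsto_koopman_inv {α : Type*} {l : Filter α} {u : α → Aut P} {f v : Lp ℝ 2 P}
    (h : Tendsto (fun x => (u x).koopman f) l (𝓝 v)) :
    Tendsto (fun x => (u x)⁻¹.koopman v) l (𝓝 f) := by
  rw [tendsto_iff_norm_sub_tendsto_zero] at h ⊢
  refine h.congr fun x => ?_
  rw [← (u x).koopman.norm_map ((u x)⁻¹.koopman v - f), map_sub, koopman_koopman_inv,
    norm_sub_rev]

instance : IsTopologicalGroup (Aut P) where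
  continuous_mul := by
    simp_rw [continuous_iff_koopman, koopman_mul]
    exact fun f => continuous_koopman_apply continuous_fst
      (continuous_koopman_apply continuous_snd continuous_const)
  continuous_inv := by
    refine continuous_iff_koopman.2 fun f => continuous_iff_continuousAt.2 fun g => ?_
    have h := tendsto_koopman_inv ((continuous_koopman (g⁻¹.koopman f)).tendsto g)
    rwa [koopman_koopman_inv] at h

theorem koopman_injective {g h : Aut P} (H : ∀ f, g.koopman f = h.koopman f) : g = h := by
  refine Subtype.ext (RelIso.ext fun a => MeasureAlgebra.ind_injective ?_)
  rw [← koopman_ind, ← koopman_ind, H]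

section Limit

variable {u : ℕ → Aut P} {p : Lp ℝ 2 P → Lp ℝ 2 P}

theorem exists_ind_eq_of_tendsto (hp : ∀ f, Tendsto (fun n => (u n).koopman f) atTop (𝓝 (p f)))
    (a : MeasureAlgebra P) : ∃ b : MeasureAlgebra P, b.ind = p a.ind :=
  MeasureAlgebra.isClosed_range_ind.mem_of_tendsto (hp a.ind)
    (.of_forall fun n => ⟨(u n).1 a, (koopman_ind _ _).symm⟩)

theorem apply_ind_mono_of_tendsto
    (hp : ∀ f, Tendsto (fun n => (u n).koopman f) atTop (𝓝 (p f)))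
    {a b : MeasureAlgebra P} (hab : a ≤ b) : p a.ind ≤ p b.ind := by
  refine le_of_tendsto_of_tendsto (hp a.ind) (hp b.ind) (.of_forall fun n => ?_)
  change (u n).koopman a.ind ≤ (u n).koopman b.ind
  rw [koopman_ind, koopman_ind, MeasureAlgebra.ind_le_ind]
  exact (u n).1.monotone hab

theorem norm_apply_of_tendsto (hp : ∀ f, Tendsto (fun n => (u n).koopman f) atTop (𝓝 (p f)))
    (f : Lp ℝ 2 P) : ‖p f‖ = ‖f‖ :=
  tendsto_nhds_unique (hp f).norm (by simp_rw [LinearIsometry.norm_map]; exact tendsto_const_nhds)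

theorem exists_ind_apply_eq_of_tendsto {q : Lp ℝ 2 P → Lp ℝ 2 P}
    (hp : ∀ f, Tendsto (fun n => (u n).koopman f) atTop (𝓝 (p f)))
    (hq : ∀ f, Tendsto (fun n => (u n)⁻¹.koopman f) atTop (𝓝 (q f))) :
    ∃ g : Aut P, ∀ a : MeasureAlgebra P, (g.1 a).ind = p a.ind := by
  have hqp (f : Lp ℝ 2 P) : q (p f) = f := tendsto_nhds_unique (hq _) (tendsto_koopman_inv (hp f))
  have hpq (f : Lp ℝ 2 P) : p (q f) = f := by
    have h := tendsto_koopman_inv (hq f)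
    simp only [inv_inv] at h
    exact tendsto_nhds_unique (hp _) h
  choose G hG using exists_ind_eq_of_tendsto hp
  choose G' hG' using exists_ind_eq_of_tendsto hq
  have hleft (a : MeasureAlgebra P) : G' (G a) = a :=
    MeasureAlgebra.ind_injective (by rw [hG', hG, hqp])
  have hright (a : MeasureAlgebra P) : G (G' a) = a :=
    MeasureAlgebra.ind_injective (by rw [hG, hG', hpq])
  have hle (a b : MeasureAlgebra P) : G a ≤ G b ↔ a ≤ b := by
    rw [← MeasureAlgebra.ind_le_ind, ← MeasureAlgebra.ind_le_ind, hG, hG]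
    refine ⟨fun h => ?_, fun h => apply_ind_mono_of_tendsto hp (MeasureAlgebra.ind_le_ind.1 h)⟩
    rw [← hG, ← hG, MeasureAlgebra.ind_le_ind] at h
    simpa only [hG, hqp] using apply_ind_mono_of_tendsto hq h
  have hmeasure (a : MeasureAlgebra P) : (G a).measure = a.measure := by
    rw [← ENNReal.toReal_eq_toReal_iff' (MeasureAlgebra.measure_ne_top _)
      (MeasureAlgebra.measure_ne_top _), ← MeasureAlgebra.norm_ind_sq,
      ← MeasureAlgebra.norm_ind_sq, hG, norm_apply_of_tendsto hp]
  exact ⟨⟨⟨⟨G, G', hleft, hright⟩, hle _ _⟩, hmeasure⟩, hG⟩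

theorem exists_koopman_eq_of_tendsto {q : Lp ℝ 2 P → Lp ℝ 2 P}
    (hp : ∀ f, Tendsto (fun n => (u n).koopman f) atTop (𝓝 (p f)))
    (hq : ∀ f, Tendsto (fun n => (u n)⁻¹.koopman f) atTop (𝓝 (q f))) :
    ∃ g : Aut P, (∀ f, g.koopman f = p f) ∧ ∀ f, g⁻¹.koopman f = q f := by
  obtain ⟨g, hg⟩ := exists_ind_apply_eq_of_tendsto hp hq
  have hug : Tendsto u atTop (𝓝 g) := by
    refine tendsto_iff.2 fun a => MeasureAlgebra.tendsto_iff_ind.2 ?_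
    rw [hg]
    simp_rw [← koopman_ind]
    exact hp _
  exact ⟨g, fun f => tendsto_nhds_unique (tendsto_iff_koopman.1 hug f) (hp f),
    fun f => tendsto_nhds_unique (tendsto_iff_koopman.1 hug.inv f) (hq f)⟩

end Limit

theorem isInducing_koopman_inv : IsInducing fun (g : Aut P) (f : Lp ℝ 2 P × Lp ℝ 2 P) =>
    (g.koopman f.1, g⁻¹.koopman f.2) := by
  let ρ (g : Aut P) (f : Lp ℝ 2 P × Lp ℝ 2 P) := (g.koopman f.1, g⁻¹.koopman f.2)
  refine isInducing_iff_nhds.2 fun g => le_antisymm (map_le_iff_le_comap.1 ?_)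
    (tendsto_id'.1 (tendsto_iff_koopman.2 fun f => ?_))
  · exact tendsto_pi_nhds.2 fun f => ((continuous_koopman f.1).tendsto g).prodMk_nhds
      (((continuous_koopman f.2).comp continuous_inv).tendsto g)
  · have hcomap : Tendsto ρ (comap ρ (𝓝 (ρ g))) (𝓝 (ρ g)) := tendsto_comap
    exact (tendsto_pi_nhds.1 hcomap (f, 0)).fst_nhds

instance : PolishSpace (Aut P) := by
  have : Fact ((1 : ℝ≥0∞) ≤ 2) := ⟨by norm_num⟩
  have : Fact ((2 : ℝ≥0∞) ≠ ∞) := ⟨by norm_num⟩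
  refine polishSpace_of_equicontinuous isInducing_koopman_inv
    (fun g h H => koopman_injective fun f => congrArg Prod.fst (congrFun H (f, 0)))
    (LipschitzWith.uniformEquicontinuous _ 1 fun g =>
      (g.koopman.isometry.prodMap g⁻¹.koopman.isometry).lipschitz).equicontinuous
    fun u r hr => ?_
  obtain ⟨g, hg, hg'⟩ := exists_koopman_eq_of_tendsto (u := u) (fun f => (hr (f, 0)).fst_nhds)
    fun f => (hr (0, f)).snd_nhds
  exact ⟨g, funext fun f => Prod.ext
    ((hg f.1).trans (tendsto_nhds_unique (hr (f.1, 0)).fst_nhds (hr f).fst_nhds))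
    ((hg' f.2).trans (tendsto_nhds_unique (hr (0, f.2)).snd_nhds (hr f).snd_nhds))⟩

end Aut

/-! ### The action on sub-σ-fields -/

namespace SubSigmaField

variable {Ω : Type*} [mΩ : MeasurableSpace Ω] {P : Measure Ω}

theorem continuous_proj_uncurry :
    Continuous fun p : SubSigmaField P × Lp ℝ 2 P => p.1.proj p.2 :=
  continuous_prod_of_continuous_lipschitzWith' _ 1 lipschitzWith_proj continuous_proj

theorem smul_mono (g : Aut P) {E F : SubSigmaField P} (h : E ≤ F) : g • E ≤ g • F := by
  rintro s ⟨hs, t, ht, hgt⟩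
  exact ⟨hs, t, h t ht, hgt⟩

theorem IsTrivial.smul (g : Aut P) {E : SubSigmaField P} (h : E.IsTrivial) :
    (g • E).IsTrivial := by
  rintro s ⟨hs, t, ht, hgt⟩
  have hmeasure : P s = P t := Aut.MapsSet.measure_eq ⟨E.le t ht, hs, hgt⟩
  exact hmeasure ▸ h t ht

variable [StandardBorelSpace Ω] [IsFiniteMeasure P]

theorem measurable_pointMap_smul (g : Aut P) (E : SubSigmaField P) :
    Measurable[(g • E).toMS, E.toMS] g.pointMap := by
  intro s hs
  obtain ⟨_, hpreimage, hgs⟩ := g.mapsSet_pointMap (E.le s hs)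
  exact ⟨hpreimage, s, hs, hgs⟩

theorem aestronglyMeasurable_koopman (g : Aut P) (E : SubSigmaField P) {f : Lp ℝ 2 P}
    (hf : AEStronglyMeasurable[E.toMS] f P) :
    AEStronglyMeasurable[(g • E).toMS] (g.koopman f) P := by
  obtain ⟨f', hf', h⟩ := hf
  refine ⟨f' ∘ g.pointMap, hf'.comp_measurable (measurable_pointMap_smul g E), ?_⟩
  exact (Lp.coeFn_compMeasurePreserving f g.measurePreserving_pointMap).trans
    (g.measurePreserving_pointMap.quasiMeasurePreserving.ae_eq_comp h)

theorem proj_smul_koopman (g : Aut P) (E : SubSigmaField P) (f : Lp ℝ 2 P) :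
    (g • E).proj (g.koopman f) = g.koopman (E.proj f) := by
  refine proj_eq_of_inner_eq_zero _
    (aestronglyMeasurable_koopman g E (E.aestronglyMeasurable_proj f)) fun w hw => ?_
  have hinv := aestronglyMeasurable_koopman g⁻¹ _ hw
  rw [inv_smul_smul] at hinv
  rw [← map_sub, ← g.koopman_koopman_inv w, LinearIsometry.inner_map_map, inner_sub_left,
    inner_proj_left, E.proj_eq_self_iff.2 hinv, sub_self]

theorem proj_smul (g : Aut P) (E : SubSigmaField P) (f : Lp ℝ 2 P) :
    (g • E).proj f = g.koopman (E.proj (g⁻¹.koopman f)) := by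
  rw [← proj_smul_koopman, Aut.koopman_koopman_inv]

instance : ContinuousSMul (Aut P) (SubSigmaField P) where
  continuous_smul := by
    simp_rw [continuous_iff_proj, proj_smul]
    intro f
    have hinv : Continuous fun p : Aut P × SubSigmaField P => p.1⁻¹.koopman f :=
      Aut.continuous_koopman_apply continuous_fst.inv continuous_const
    exact Aut.continuous_koopman_apply continuous_fst
      (Continuous.comp continuous_proj_uncurry (continuous_snd.prodMk hinv) :)

end SubSigmaField

/-! ### Relative nonatomicity -/

theorem measurable_decide_mem {Ω ι : Type*} {m : MeasurableSpace Ω} {A : ι → Set Ω}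
    [∀ i ω, Decidable (ω ∈ A i)] (hA : ∀ i, MeasurableSet (A i)) :
    Measurable fun ω i => decide (ω ∈ A i) := by
  refine measurable_pi_lambda _ fun i => measurable_to_bool ?_
  simpa only [preimage, mem_singleton_iff, decide_eq_true_eq, ofPred_mem_eq] using hA i

theorem measurableSet_apply_eq_true {Ω ι : Type*} {_ : MeasurableSpace Ω} {φ : Ω → ι → Bool}
    (hφ : Measurable φ) (i : ι) : MeasurableSet {ω | φ ω i = true} :=
  ((measurable_pi_apply i).comp hφ) (measurableSet_singleton true)

theorem exists_measurableSet_ae_eq {Ω : Type*} {m mΩ : MeasurableSpace Ω} {P : Measure Ω}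
    [IsFiniteMeasure P] {A : Set Ω} (hA : MeasurableSet A)
    (hm : AEStronglyMeasurable[m] (indLp P A) P) : ∃ B, MeasurableSet[m] B ∧ A =ᵐ[P] B := by
  obtain ⟨g, hg, hAg⟩ := hm
  refine ⟨g ⁻¹' {1}, hg.measurable (measurableSet_singleton 1), ?_⟩
  filter_upwards [hAg, coeFn_indLp (P := P) hA] with ω hAg hind
  refine propext ?_
  change ω ∈ A ↔ g ω = 1
  rw [← hAg, hind]
  by_cases hω : ω ∈ A <;> simp [hω]

section

variable {Ω : Type*} [mΩ : MeasurableSpace Ω] {P : Measure Ω}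

theorem sq_mul_measureReal_le_norm_sq (f : Lp ℝ 2 P) {c : ℝ} (hc : 0 ≤ c) :
    c ^ 2 * P.real {ω | c ≤ |f ω|} ≤ ‖f‖ ^ 2 := by
  have hset : {ω | c ≤ |f ω|} = {ω | c ^ 2 ≤ f ω ^ 2} := by
    ext ω
    rw [mem_ofPred_eq, mem_ofPred_eq, sq_le_sq, abs_of_nonneg hc]
  rw [hset, norm_sq_eq_integral]
  exact mul_meas_ge_le_integral_of_nonneg (.of_forall fun ω => sq_nonneg (f ω))
    (Lp.memLp f).integrable_sq _

variable [IsFiniteMeasure P]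

theorem sum_measureReal_preimage_inter {ι : Type*} [Fintype ι] [MeasurableSpace ι]
    [MeasurableSingletonClass ι] {φ : Ω → ι} (hφ : Measurable φ) (D : Set Ω) :
    ∑ b, P.real (φ ⁻¹' {b} ∩ D) = P.real D := by
  have hsum := sum_measureReal_preimage_singleton (μ := P.restrict D) (f := φ) Finset.univ
    fun b _ => hφ (measurableSet_singleton b)
  simpa [measureReal_restrict_apply, hφ (measurableSet_singleton _)] using hsum

theorem sum_measureReal_symmDiff_preimage_le {ι : Type*} [Fintype ι] [MeasurableSpace ι]
    [MeasurableSingletonClass ι] {φ ψ : Ω → ι} (hφ : Measurable φ) (hψ : Measurable ψ) :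
    ∑ b, P.real ((ψ ⁻¹' {b}) ∆ (φ ⁻¹' {b})) ≤ 2 * P.real {ω | φ ω ≠ ψ ω} := by
  set D : Set Ω := {ω | φ ω ≠ ψ ω}
  calc ∑ b, P.real ((ψ ⁻¹' {b}) ∆ (φ ⁻¹' {b}))
      ≤ ∑ b, (P.real (ψ ⁻¹' {b} ∩ D) + P.real (φ ⁻¹' {b} ∩ D)) := by
        refine Finset.sum_le_sum fun b _ =>
          (measureReal_mono ?_).trans (measureReal_union_le _ _)
        rintro ω (⟨hψb, hφb⟩ | ⟨hφb, hψb⟩)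
        · exact .inl ⟨hψb, fun h => hφb (h.trans hψb)⟩
        · exact .inr ⟨hφb, fun h => hψb (h.symm.trans hφb)⟩
    _ = 2 * P.real D := by
        rw [Finset.sum_add_distrib, sum_measureReal_preimage_inter hφ,
          sum_measureReal_preimage_inter hψ, two_mul]

open scoped Classical in
theorem measureReal_ne_decide_le {ι : Type*} [Fintype ι] {φ : Ω → ι → Bool} (hφ : Measurable φ)
    (f : ι → Lp ℝ 2 P) :
    P.real {ω | φ ω ≠ fun i => decide (ω ∈ f i ⁻¹' Ioi (1 / 2))} ≤
      4 * ∑ i, ‖indLp P {ω | φ ω i = true} - f i‖ ^ 2 := by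
  have hdiff : ∀ᵐ ω ∂P, ∀ i, (indLp P {ω | φ ω i = true} - f i : Lp ℝ 2 P) ω =
      ({ω | φ ω i = true}.indicator (fun _ => (1 : ℝ)) ω) - f i ω := by
    refine ae_all_iff.2 fun i => ?_
    filter_upwards [Lp.coeFn_sub (indLp P {ω | φ ω i = true}) (f i),
      coeFn_indLp (P := P) (measurableSet_apply_eq_true hφ i)] with ω hsub hind
    rw [hsub, Pi.sub_apply, hind]
  have hsubset : ({ω | φ ω ≠ fun i => decide (ω ∈ f i ⁻¹' Ioi (1 / 2))} : Set Ω) ≤ᵐ[P]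
      (⋃ i, {ω | 1 / 2 ≤ |(indLp P {ω | φ ω i = true} - f i : Lp ℝ 2 P) ω|} : Set Ω) := by
    filter_upwards [hdiff] with ω hω hne
    obtain ⟨i, hi⟩ := Function.ne_iff.1 (show φ ω ≠ _ from hne)
    refine mem_iUnion.2 ⟨i, ?_⟩
    rw [mem_ofPred_eq, hω i, le_abs]
    by_cases hφi : φ ω i = true
    · rw [hφi, ne_comm, Ne, decide_eq_true_eq, mem_preimage, mem_Ioi, not_lt] at hi
      rw [indicator_of_mem (by exact hφi)]
      left
      linarith
    · rw [Bool.eq_false_of_not_eq_true hφi, ne_comm, Ne, decide_eq_false_iff_not, not_not,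
        mem_preimage, mem_Ioi] at hi
      rw [indicator_of_notMem (by exact hφi)]
      right
      linarith
  rw [Finset.mul_sum]
  calc P.real {ω | φ ω ≠ fun i => decide (ω ∈ f i ⁻¹' Ioi (1 / 2))}
      ≤ P.real (⋃ i, {ω | 1 / 2 ≤ |(indLp P {ω | φ ω i = true} - f i : Lp ℝ 2 P) ω|}) :=
        ENNReal.toReal_mono (measure_ne_top _ _) (measure_mono_ae hsubset)
    _ ≤ _ := measureReal_iUnion_fintype_le _
    _ ≤ _ := Finset.sum_le_sum fun i _ => by
        linarith [sq_mul_measureReal_le_norm_sq (indLp P {ω | φ ω i = true} - f i) one_half_pos.le]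

end

namespace SubSigmaField

variable {Ω : Type*} [mΩ : MeasurableSpace Ω] {P : Measure Ω}

theorem norm_proj_sq_le_add (E : SubSigmaField P) (f g : Lp ℝ 2 P) :
    ‖E.proj g‖ ^ 2 ≤ 2 * ‖E.proj f‖ ^ 2 + 2 * ‖g - f‖ ^ 2 := by
  have htriangle : ‖E.proj g‖ ≤ ‖E.proj f‖ + ‖g - f‖ := by
    calc ‖E.proj g‖ = ‖E.proj f + E.proj (g - f)‖ := by rw [← map_add, add_sub_cancel]
      _ ≤ ‖E.proj f‖ + ‖g - f‖ := (norm_add_le _ _).trans (by gcongr; exact E.norm_proj_le _)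
  nlinarith [sq_nonneg (‖E.proj f‖ - ‖g - f‖), norm_nonneg (E.proj g)]

variable [IsFiniteMeasure P]

/-- The energy of the finite partition into the level sets of `φ`, relative to `E`: the integral
of `∑ b, P (φ = b | E) ^ 2`. It measures how large the conditional probabilities of the cells
are. -/
noncomputable def energy (E : SubSigmaField P) {ι : Type*} [Fintype ι] (φ : Ω → ι) : ℝ :=
  ∑ b, ‖E.proj (indLp P (φ ⁻¹' {b}))‖ ^ 2

theorem energy_mono {E E' : SubSigmaField P} (h : E' ≤ E) {ι : Type*} [Fintype ι] (φ : Ω → ι) :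
    E'.energy φ ≤ E.energy φ := by
  refine Finset.sum_le_sum fun b _ => ?_
  rw [← proj_proj_of_le h]
  gcongr
  exact E'.norm_proj_le _

theorem energy_le_add (E : SubSigmaField P) {ι : Type*} [Fintype ι] [MeasurableSpace ι]
    [MeasurableSingletonClass ι] {φ ψ : Ω → ι} (hφ : Measurable φ) (hψ : Measurable ψ) :
    E.energy ψ ≤ 2 * E.energy φ + 4 * P.real {ω | φ ω ≠ ψ ω} := by
  calc E.energy ψ
      ≤ ∑ b, (2 * ‖E.proj (indLp P (φ ⁻¹' {b}))‖ ^ 2 +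
          2 * P.real ((ψ ⁻¹' {b}) ∆ (φ ⁻¹' {b}))) := Finset.sum_le_sum fun b _ => by
        rw [← norm_indLp_sub_sq (hψ (measurableSet_singleton b)) (hφ (measurableSet_singleton b))]
        exact E.norm_proj_sq_le_add _ _
    _ = 2 * E.energy φ + 2 * ∑ b, P.real ((ψ ⁻¹' {b}) ∆ (φ ⁻¹' {b})) := by
        rw [Finset.sum_add_distrib, ← Finset.mul_sum, ← Finset.mul_sum, energy]
    _ ≤ 2 * E.energy φ + 4 * P.real {ω | φ ω ≠ ψ ω} := by
        linarith [sum_measureReal_symmDiff_preimage_le (P := P) hφ hψ]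

/-- `F` is nonatomic relative to `E`: there are finite `F`-measurable partitions of arbitrarily
small energy relative to `E`. -/
def RelNonatomic (E F : SubSigmaField P) : Prop :=
  ∀ ε > 0, ∃ (N : ℕ) (φ : Ω → Fin N → Bool), Measurable[F.toMS] φ ∧ E.energy φ < ε

theorem RelNonatomic.mono {E E' F F' : SubSigmaField P} (h : RelNonatomic E F) (hE : E' ≤ E)
    (hF : F ≤ F') : RelNonatomic E' F' := by
  intro ε hε
  obtain ⟨N, φ, hφ, henergy⟩ := h ε hε
  exact ⟨N, φ, hφ.mono hF le_rfl, (energy_mono hE φ).trans_lt henergy⟩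

/-- An open relaxation of relative nonatomicity: the partition only has to be nearly measurable
with respect to the second sub-σ-field, in the sense of distances in `L²(P)`. -/
def nearlyRelNonatomic (P : Measure Ω) [IsFiniteMeasure P] (ε : ℝ) :
    Set (SubSigmaField P × SubSigmaField P) :=
  {p | ∃ (N : ℕ) (φ : Ω → Fin N → Bool), Measurable φ ∧ p.1.energy φ +
    ∑ i, ‖indLp P {ω | φ ω i = true} - p.2.proj (indLp P {ω | φ ω i = true})‖ ^ 2 < ε}

theorem isOpen_nearlyRelNonatomic (ε : ℝ) : IsOpen (nearlyRelNonatomic P ε) := by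
  have hunion : nearlyRelNonatomic P ε = ⋃ (N : ℕ) (φ : Ω → Fin N → Bool) (_ : Measurable φ),
      {p | p.1.energy φ +
        ∑ i, ‖indLp P {ω | φ ω i = true} - p.2.proj (indLp P {ω | φ ω i = true})‖ ^ 2 < ε} := by
    ext p
    simp [nearlyRelNonatomic]
  rw [hunion]
  refine isOpen_iUnion fun N => isOpen_iUnion fun φ => isOpen_iUnion fun _ =>
    isOpen_lt (.add ?_ ?_) continuous_const
  · exact continuous_finsetSum _ fun b _ =>
      (((continuous_proj _).comp continuous_fst).norm.pow 2)
  · exact continuous_finsetSum _ fun b _ =>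
      ((continuous_const.sub ((continuous_proj _).comp continuous_snd)).norm.pow 2)

theorem mem_nearlyRelNonatomic_of_relNonatomic {E F : SubSigmaField P} (h : RelNonatomic E F)
    {ε : ℝ} (hε : 0 < ε) : (E, F) ∈ nearlyRelNonatomic P ε := by
  obtain ⟨N, φ, hφ, henergy⟩ := h ε hε
  have hproj (i : Fin N) : F.proj (indLp P {ω | φ ω i = true}) = indLp P {ω | φ ω i = true} :=
    (F.proj_indLp_eq_self_iff (F.le _ (measurableSet_apply_eq_true hφ i))).2
      (measurableSet_apply_eq_true hφ i)
  exact ⟨N, φ, hφ.mono F.le le_rfl, by simpa [hproj] using henergy⟩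

/- A nearly `F`-measurable partition becomes `F`-measurable when the indicators of its coordinates
are replaced by the events that their projections exceed `1 / 2`. -/
theorem relNonatomic_iff {E F : SubSigmaField P} :
    RelNonatomic E F ↔ ∀ n : ℕ, (E, F) ∈ nearlyRelNonatomic P (1 / (n + 1)) := by
  refine ⟨fun h n => mem_nearlyRelNonatomic_of_relNonatomic h (by positivity), fun h ε hε => ?_⟩
  obtain ⟨n, hn⟩ := exists_nat_one_div_lt (show 0 < ε / 16 by positivity)
  obtain ⟨N, φ, hφ, hnear⟩ := h n
  classical
  let f (i : Fin N) : Lp ℝ 2 P := F.proj (indLp P {ω | φ ω i = true})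
  let ψ (ω : Ω) (i : Fin N) : Bool := decide (ω ∈ f i ⁻¹' Ioi (1 / 2))
  have hψ : Measurable[F.toMS] ψ := measurable_decide_mem fun i =>
    F.measurable_of_aestronglyMeasurable (Lp.stronglyMeasurable _).measurable
      (F.aestronglyMeasurable_proj _) measurableSet_Ioi
  refine ⟨N, ψ, hψ, ?_⟩
  have hne := measureReal_ne_decide_le hφ f
  have hnonneg : 0 ≤ E.energy φ := Finset.sum_nonneg fun _ _ => sq_nonneg _
  calc E.energy ψ ≤ 2 * E.energy φ + 4 * P.real {ω | φ ω ≠ ψ ω} :=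
        E.energy_le_add hφ (hψ.mono F.le le_rfl)
    _ ≤ 16 * (E.energy φ + ∑ i, ‖indLp P {ω | φ ω i = true} - f i‖ ^ 2) := by linarith
    _ < ε := by linarith

/-! ### Generators -/

/-- `Y` is measurable with respect to `F` and generates `F` modulo null sets. -/
structure IsGenerator (F : SubSigmaField P) {Z : Type*} [MeasurableSpace Z] (Y : Ω → Z) :
    Prop where
  measurable : Measurable[F.toMS] Y
  exists_ae_eq_preimage : ∀ A, MeasurableSet[F.toMS] A → ∃ B, MeasurableSet B ∧ A =ᵐ[P] Y ⁻¹' B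

theorem exists_isGenerator [MeasurableSpace.CountablyGenerated Ω] (F : SubSigmaField P) :
    ∃ Y : Ω → ℕ → Bool, F.IsGenerator Y := by
  have : Fact ((1 : ℝ≥0∞) ≤ 2) := ⟨by norm_num⟩
  have : Fact ((2 : ℝ≥0∞) ≠ ∞) := ⟨by norm_num⟩
  let R : Set (Lp ℝ 2 P) := indLp P '' {A | MeasurableSet[F.toMS] A}
  have : Nonempty R := ⟨⟨_, univ, MeasurableSet.univ, rfl⟩⟩
  choose A hA hAR using fun n => (TopologicalSpace.denseSeq R n).2
  classical
  let Y (ω : Ω) (n : ℕ) : Bool := decide (ω ∈ A n)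
  have hY : Measurable[F.toMS] Y := measurable_decide_mem hA
  have hle : MeasurableSpace.comap Y inferInstance ≤ mΩ := (hY.mono F.le le_rfl).comap_le
  have hAm (n : ℕ) : MeasurableSet[.comap Y inferInstance] (A n) := by
    refine ⟨(fun y => y n) ⁻¹' {true}, measurable_pi_apply n (measurableSet_singleton true), ?_⟩
    ext ω
    simp [Y]
  have hRm (f : R) : AEStronglyMeasurable[.comap Y inferInstance] (f : Lp ℝ 2 P) P := by
    refine (TopologicalSpace.denseRange_denseSeq R).induction_on f
      ((isClosed_aestronglyMeasurable hle).preimage continuous_subtype_val) fun n => ?_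
    rw [← hAR n]
    exact ⟨_, stronglyMeasurable_const.indicator (hAm n), coeFn_indLp (F.le _ (hA n))⟩
  refine ⟨Y, hY, fun B hB => ?_⟩
  obtain ⟨_, ⟨C, hC, rfl⟩, hBC⟩ := exists_measurableSet_ae_eq (F.le _ hB) (hRm ⟨_, B, hB, rfl⟩)
  exact ⟨C, hC, hBC⟩

end SubSigmaField

/-! ### Relative nonatomicity and conditional measures -/

/-- The code of the cylinder of depth `N` that contains a binary sequence. -/
def take (N : ℕ) (y : ℕ → Bool) : Fin N → Bool := fun i => y i

theorem measurable_take (N : ℕ) : Measurable (take N) :=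
  measurable_pi_lambda _ fun _ => measurable_pi_apply _

section

variable {α : Type*} [MeasurableSpace α]

theorem prod_setOf_eq (ν : Measure α) [SFinite ν] {ι : Type*} [Fintype ι] [MeasurableSpace ι]
    [MeasurableSingletonClass ι] {f : α → ι} (hf : Measurable f) :
    ν.prod ν {p | f p.1 = f p.2} = ∑ b, ν (f ⁻¹' {b}) ^ 2 := by
  have hunion : {p : α × α | f p.1 = f p.2} = ⋃ b, (f ⁻¹' {b}) ×ˢ (f ⁻¹' {b}) := by
    ext p
    simp [eq_comm]
  have hb (b : ι) : MeasurableSet (f ⁻¹' {b}) := hf (measurableSet_singleton b)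
  rw [hunion, measure_iUnion, tsum_fintype]
  · exact Finset.sum_congr rfl fun b _ => by rw [Measure.prod_prod, sq]
  · exact fun b c hbc => disjoint_left.2 fun p hp hq => hbc (hp.1.symm.trans hq.1)
  · exact fun b => (hb b).prod (hb b)

/- Both sides are values of the product measure: the cells of depth `N` form a decreasing
sequence of neighbourhoods of the diagonal. -/
theorem tendsto_sum_take_sq (ν : Measure α) [IsFiniteMeasure ν] {Y : α → ℕ → Bool}
    (hY : Measurable Y) (hν : ∀ y, ν (Y ⁻¹' {y}) = 0) :
    Tendsto (fun N => ∑ b, ν ((take N ∘ Y) ⁻¹' {b}) ^ 2) atTop (𝓝 0) := by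
  let S (N : ℕ) : Set (α × α) := {p | take N (Y p.1) = take N (Y p.2)}
  have hS (N : ℕ) : MeasurableSet (S N) :=
    measurableSet_eq_fun (((measurable_take N).comp hY).comp measurable_fst)
      (((measurable_take N).comp hY).comp measurable_snd)
  have hanti : Antitone S := fun N M hNM p hp =>
    funext fun i => congrFun hp ⟨i, i.2.trans_le hNM⟩
  have hinter : ⋂ N, S N = {p | Y p.1 = Y p.2} := by
    refine Subset.antisymm (fun p hp => ?_) (subset_iInter fun N p hp => congrArg (take N) hp)
    exact funext fun n => congrFun (mem_iInter.1 hp (n + 1)) ⟨n, Nat.lt_succ_self n⟩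
  have hdiag : ν.prod ν {p | Y p.1 = Y p.2} = 0 := by
    have hmeas : MeasurableSet {p : α × α | Y p.1 = Y p.2} :=
      measurableSet_eq_fun (hY.comp measurable_fst) (hY.comp measurable_snd)
    have hsection (x : α) : Prod.mk x ⁻¹' {p : α × α | Y p.1 = Y p.2} = Y ⁻¹' {Y x} := by
      ext y
      simp [eq_comm]
    simp [Measure.prod_apply hmeas, hsection, hν]
  have hlim := tendsto_measure_iInter_atTop (μ := ν.prod ν) (fun N => (hS N).nullMeasurableSet)
    hanti ⟨0, measure_ne_top _ _⟩
  rw [hinter, hdiag] at hlim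
  exact hlim.congr fun N => prod_setOf_eq ν ((measurable_take N).comp hY)

theorem ae_liminf_eq_zero {μ : Measure α} {e : ℕ → α → ℝ≥0∞} (he : ∀ n, Measurable (e n))
    (h : Tendsto (fun n => ∫⁻ x, e n x ∂μ) atTop (𝓝 0)) :
    ∀ᵐ x ∂μ, liminf (fun n => e n x) atTop = 0 := by
  have hFatou := lintegral_liminf_le (μ := μ) (u := atTop) he
  rw [h.liminf_eq] at hFatou
  exact (lintegral_eq_zero_iff (Measurable.liminf he)).1 (le_antisymm hFatou zero_le)

theorem measure_preimage_singleton_sq_le (ν : Measure α) {ι Z : Type*} [Fintype ι] {φ : α → ι}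
    {Y : α → Z} {B : ι → Set Z} (h : ∀ b, φ ⁻¹' {b} =ᵐ[ν] Y ⁻¹' B b) (y : Z) :
    ν (Y ⁻¹' {y}) ^ 2 ≤ ∑ b, ν (φ ⁻¹' {b}) ^ 2 := by
  by_cases hy : ∃ b, y ∈ B b
  · obtain ⟨b, hb⟩ := hy
    calc ν (Y ⁻¹' {y}) ^ 2 ≤ ν (φ ⁻¹' {b}) ^ 2 := by
          rw [measure_congr (h b)]
          gcongr
          exact singleton_subset_iff.2 hb
      _ ≤ ∑ b, ν (φ ⁻¹' {b}) ^ 2 :=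
          Finset.single_le_sum (f := fun b => ν (φ ⁻¹' {b}) ^ 2) (fun _ _ => zero_le)
            (Finset.mem_univ b)
  · have hnull : ν (Y ⁻¹' {y}) = 0 := by
      refine measure_eq_zero_iff_ae_notMem.2 ?_
      filter_upwards [ae_all_iff.2 fun b => (h b).le] with x hx hxy
      exact hy ⟨φ x, (show Y x = y from hxy) ▸ hx (φ x) rfl⟩
    simp [hnull]

end

namespace SubSigmaField

section

variable {Ω : Type*} [mΩ : MeasurableSpace Ω] {P : Measure Ω}

instance : OrderTop (SubSigmaField P) where
  top := { toMS := mΩ, le := le_rfl, null_mem := fun _ hs _ => hs }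
  le_top E := E.le

theorem isGenerator_mapNatBool [StandardBorelSpace Ω] :
    (⊤ : SubSigmaField P).IsGenerator (MeasurableSpace.mapNatBool Ω) where
  measurable := MeasurableSpace.measurable_mapNatBool Ω
  exists_ae_eq_preimage A hA := by
    have hinj := MeasurableSpace.injective_mapNatBool Ω
    have hemb := (MeasurableSpace.measurable_mapNatBool Ω).measurableEmbedding hinj
    exact ⟨_, hemb.measurableSet_image.2 hA, .of_eq (preimage_image_eq _ hinj).symm⟩

theorem relNonatomic_of_tendsto_energy [IsFiniteMeasure P] {E F : SubSigmaField P}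
    {Y : Ω → ℕ → Bool} (hY : Measurable[F.toMS] Y)
    (h : Tendsto (fun N => ENNReal.ofReal (E.energy (take N ∘ Y))) atTop (𝓝 0)) :
    RelNonatomic E F := by
  intro ε hε
  obtain ⟨N, hN⟩ := (h.eventually_lt_const (ENNReal.ofReal_pos.2 hε)).exists
  exact ⟨N, take N ∘ Y, (measurable_take N).comp hY, (ENNReal.ofReal_lt_ofReal_iff hε).1 hN⟩

theorem IsNonatomic.measure_preimage_singleton_eq_zero {F : SubSigmaField P} (hF : F.IsNonatomic)
    {Z : Type*} [MeasurableSpace Z] [MeasurableSingletonClass Z] {Y : Ω → Z}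
    (hY : F.IsGenerator Y) (y : Z) : P (Y ⁻¹' {y}) = 0 := by
  by_contra h
  obtain ⟨t, hty, ht, hpos, hlt⟩ :=
    hF _ (hY.measurable (measurableSet_singleton y)) (pos_iff_ne_zero.2 h)
  obtain ⟨B, -, htB⟩ := hY.exists_ae_eq_preimage t ht
  have hinter : t =ᵐ[P] (Y ⁻¹' B ∩ Y ⁻¹' {y} : Set Ω) := by
    simpa only [inter_eq_self_of_subset_left hty] using
      htB.inter (EventuallyEq.refl (ae P) (Y ⁻¹' {y}))
  by_cases hy : y ∈ B
  · rw [inter_eq_self_of_subset_right (preimage_mono (singleton_subset_iff.2 hy))] at hinter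
    exact hlt.ne (measure_congr hinter)
  · rw [← preimage_inter, inter_singleton_eq_empty.2 hy, preimage_empty] at hinter
    rw [measure_congr hinter, measure_empty] at hpos
    exact lt_irrefl _ hpos

variable [IsProbabilityMeasure P]

theorem norm_proj_indLp_sq_of_indep {E F : SubSigmaField P} (h : Indep E.toMS F.toMS P)
    {A : Set Ω} (hA : MeasurableSet[F.toMS] A) : ‖E.proj (indLp P A)‖ ^ 2 = P.real A ^ 2 := by
  have hconst : E.proj (indLp P A) =ᵐ[P] fun _ => P.real A := by
    refine (E.proj_indLp_ae_eq (F.le _ hA)).trans ?_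
    refine (condExp_indep_eq F.le E.le (stronglyMeasurable_const.indicator hA) h.symm).trans
      (.of_forall fun _ => ?_)
    exact integral_indicator_one (F.le _ hA)
  rw [norm_sq_eq_integral, integral_congr_ae (hconst.mono fun _ h => congrArg (· ^ 2) h)]
  simp

theorem IsNonatomic.relNonatomic [MeasurableSpace.CountablyGenerated Ω] {E F : SubSigmaField P}
    (hF : F.IsNonatomic) (h : Indep E.toMS F.toMS P) : RelNonatomic E F := by
  obtain ⟨Y, hY⟩ := F.exists_isGenerator
  refine relNonatomic_of_tendsto_energy hY.measurable ?_
  refine (tendsto_sum_take_sq P (hY.measurable.mono F.le le_rfl)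
    (hF.measure_preimage_singleton_eq_zero hY)).congr fun N => ?_
  rw [energy, ENNReal.ofReal_sum_of_nonneg fun _ _ => sq_nonneg _]
  refine Finset.sum_congr rfl fun b _ => ?_
  rw [norm_proj_indLp_sq_of_indep h
    (((measurable_take N).comp hY.measurable) (measurableSet_singleton b)),
    ENNReal.ofReal_pow measureReal_nonneg, ofReal_measureReal]

end

variable {Ω : Type*} [mΩ : MeasurableSpace Ω] {P : Measure Ω} [StandardBorelSpace Ω]
  [IsFiniteMeasure P]

theorem ofReal_norm_proj_sq (E : SubSigmaField P) {A : Set Ω} (hA : MeasurableSet A) :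
    ENNReal.ofReal (‖E.proj (indLp P A)‖ ^ 2) =
      ∫⁻ ω, condExpKernel P E.toMS ω A ^ 2 ∂P := by
  have hkernel : E.proj (indLp P A) =ᵐ[P] fun ω => (condExpKernel P E.toMS ω).real A :=
    (E.proj_indLp_ae_eq hA).trans (condExpKernel_ae_eq_condExp E.le hA).symm
  rw [norm_sq_eq_integral, ofReal_integral_eq_lintegral_ofReal (Lp.memLp _).integrable_sq
    (.of_forall fun ω => sq_nonneg _)]
  refine lintegral_congr_ae ?_
  filter_upwards [hkernel] with ω hω
  rw [hω, ENNReal.ofReal_pow measureReal_nonneg, ofReal_measureReal]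

theorem measurable_condExpKernel_sq (E : SubSigmaField P) {A : Set Ω} (hA : MeasurableSet A) :
    Measurable fun ω => condExpKernel P E.toMS ω A ^ 2 :=
  ((measurable_condExpKernel hA).mono E.le le_rfl).pow_const 2

theorem lintegral_sum_condExpKernel_sq (E : SubSigmaField P) {ι : Type*} [Fintype ι]
    [MeasurableSpace ι] [MeasurableSingletonClass ι] {φ : Ω → ι} (hφ : Measurable φ) :
    ∫⁻ ω, ∑ b, condExpKernel P E.toMS ω (φ ⁻¹' {b}) ^ 2 ∂P = ENNReal.ofReal (E.energy φ) := by
  have hb (b : ι) : MeasurableSet (φ ⁻¹' {b}) := hφ (measurableSet_singleton b)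
  rw [lintegral_finsetSum _ fun b _ => E.measurable_condExpKernel_sq (hb b), energy,
    ENNReal.ofReal_sum_of_nonneg fun _ _ => sq_nonneg _]
  exact Finset.sum_congr rfl fun b _ => (E.ofReal_norm_proj_sq (hb b)).symm

theorem ae_ae_condExpKernel (E : SubSigmaField P) {p : Ω → Prop} (h : ∀ᵐ x ∂P, p x) :
    ∀ᵐ ω ∂P, ∀ᵐ x ∂condExpKernel P E.toMS ω, p x :=
  ae_of_ae_trim E.le (Measure.ae_ae_of_ae_comp (by rwa [condExpKernel_comp_trim E.le]))

theorem RelNonatomic.ae_preimage_singleton {E F : SubSigmaField P} (h : RelNonatomic E F)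
    {Z : Type*} [MeasurableSpace Z] {Y : Ω → Z} (hY : F.IsGenerator Y) :
    ∀ᵐ ω ∂P, ∀ y, condExpKernel P E.toMS ω (Y ⁻¹' {y}) = 0 := by
  choose N φ hφ henergy using fun k : ℕ => h (1 / (k + 1)) (by positivity)
  have hφm (k : ℕ) : Measurable (φ k) := (hφ k).mono F.le le_rfl
  choose B _ hφB using fun k b =>
    hY.exists_ae_eq_preimage _ (hφ k (measurableSet_singleton b))
  have hlim : Tendsto (fun k => ∫⁻ ω, ∑ b, condExpKernel P E.toMS ω (φ k ⁻¹' {b}) ^ 2 ∂P) atTop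
      (𝓝 0) := by
    have hbound := ENNReal.tendsto_ofReal (tendsto_one_div_add_atTop_nhds_zero_nat (𝕜 := ℝ))
    rw [ENNReal.ofReal_zero] at hbound
    refine tendsto_of_tendsto_of_tendsto_of_le_of_le tendsto_const_nhds hbound
      (fun _ => zero_le) fun k => ?_
    rw [E.lintegral_sum_condExpKernel_sq (hφm k)]
    exact ENNReal.ofReal_le_ofReal (henergy k).le
  have hcells : ∀ᵐ ω ∂P, ∀ k b, φ k ⁻¹' {b} =ᵐ[condExpKernel P E.toMS ω] Y ⁻¹' B k b :=
    ae_all_iff.2 fun k => ae_all_iff.2 fun b => E.ae_ae_condExpKernel (hφB k b)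
  filter_upwards [hcells, ae_liminf_eq_zero (fun k => Finset.measurable_fun_sum _ fun b _ =>
    E.measurable_condExpKernel_sq (hφm k (measurableSet_singleton b))) hlim] with ω hω hliminf y
  have hle : condExpKernel P E.toMS ω (Y ⁻¹' {y}) ^ 2 ≤ 0 := by
    rw [← hliminf]
    exact le_liminf_of_le (by isBoundedDefault)
      (.of_forall fun k => measure_preimage_singleton_sq_le _ (hω k) y)
  exact (pow_eq_zero_iff two_ne_zero).1 (le_antisymm hle zero_le)

theorem relNonatomic_of_ae_preimage_singleton {E F : SubSigmaField P} {Y : Ω → ℕ → Bool}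
    (hY : Measurable[F.toMS] Y)
    (h : ∀ᵐ ω ∂P, ∀ y, condExpKernel P E.toMS ω (Y ⁻¹' {y}) = 0) : RelNonatomic E F := by
  have hYm : Measurable Y := hY.mono F.le le_rfl
  have hm (N : ℕ) : Measurable (take N ∘ Y) := (measurable_take N).comp hYm
  have hle (N : ℕ) (ω : Ω) : ∑ b, condExpKernel P E.toMS ω ((take N ∘ Y) ⁻¹' {b}) ^ 2 ≤ 1 := by
    have hsum := sum_measure_preimage_singleton (μ := condExpKernel P E.toMS ω) (f := take N ∘ Y)
      Finset.univ fun b _ => hm N (measurableSet_singleton b)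
    rw [Finset.coe_univ, preimage_univ, measure_univ] at hsum
    refine (Finset.sum_le_sum fun b _ => ?_).trans hsum.le
    rw [sq]
    exact mul_le_of_le_one_left zero_le prob_le_one
  refine relNonatomic_of_tendsto_energy hY ?_
  simp_rw [← E.lintegral_sum_condExpKernel_sq (hm _)]
  rw [← lintegral_zero (μ := P)]
  refine tendsto_lintegral_of_dominated_convergence (fun _ => 1)
    (fun N => Finset.measurable_fun_sum _ fun b _ =>
      E.measurable_condExpKernel_sq (hm N (measurableSet_singleton b)))
    (fun N => .of_forall (hle N)) (by simp) ?_
  filter_upwards [h] with ω hω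
  exact tendsto_sum_take_sq _ hYm hω

theorem mem_condNonatomic_iff {E : SubSigmaField P} :
    E ∈ condNonatomic P ↔ RelNonatomic E ⊤ := by
  have hinj := MeasurableSpace.injective_mapNatBool Ω
  refine ⟨fun h => relNonatomic_of_ae_preimage_singleton isGenerator_mapNatBool.measurable ?_,
    fun h => ?_⟩
  · filter_upwards [h] with ω hω y
    exact (subsingleton_singleton.preimage hinj).measure_zero _
  · change ∀ᵐ ω ∂P, NullSingletonClass (condExpKernel P E.toMS ω)
    filter_upwards [h.ae_preimage_singleton isGenerator_mapNatBool] with ω hω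
    refine ⟨fun x => ?_⟩
    simpa only [← image_singleton, preimage_image_eq _ hinj] using
      hω (MeasurableSpace.mapNatBool Ω x)

end SubSigmaField

/-! ### The conditional probability integral transform -/

theorem measure_setOf_lt_and_real_Iic_le (ν : Measure ℝ) [IsFiniteMeasure ν] (y : ℝ) :
    ν {z | y < z ∧ ν.real (Iic z) ≤ ν.real (Iic y)} = 0 := by
  have hconn : OrdConnected {z | y < z ∧ ν.real (Iic z) ≤ ν.real (Iic y)} :=
    ⟨fun _ ha _ hb _ hc => ⟨ha.1.trans_le hc.1,
      (measureReal_mono (Iic_subset_Iic.2 hc.2)).trans hb.2⟩⟩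
  simp only [hconn.measurableSet.measure_eq_iSup_isCompact, ENNReal.iSup_eq_zero]
  intro K hK hKc
  rcases K.eq_empty_or_nonempty with rfl | hne
  · exact measure_empty
  obtain ⟨z, hzK, hz⟩ := hKc.exists_isGreatest hne
  obtain ⟨hyz, hle⟩ := hK hzK
  have hKsub : K ⊆ Iic z \ Iic y := fun w hw => ⟨hz hw, not_le.2 (hK hw).1⟩
  refine measure_mono_null hKsub ((measureReal_eq_zero_iff (measure_ne_top _ _)).1 ?_)
  refine le_antisymm ?_ measureReal_nonneg
  rw [measureReal_sdiff (Iic_subset_Iic.2 hyz.le) measurableSet_Iic]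
  exact sub_nonpos.2 hle

theorem measure_setOf_real_Iic_le_real_Iic (ν : Measure ℝ) [IsFiniteMeasure ν] (y : ℝ) :
    ν {z | ν.real (Iic z) ≤ ν.real (Iic y)} = ν (Iic y) := by
  have hunion : {z | ν.real (Iic z) ≤ ν.real (Iic y)} =
      Iic y ∪ {z | y < z ∧ ν.real (Iic z) ≤ ν.real (Iic y)} := by
    ext z
    refine ⟨fun h => (le_or_gt z y).imp id fun hyz => ⟨hyz, h⟩, ?_⟩
    rintro (h | h)
    · exact measureReal_mono (Iic_subset_Iic.2 h)
    · exact h.2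
  rw [hunion, measure_congr (union_ae_eq_left_of_ae_eq_empty
    (ae_eq_empty.2 (measure_setOf_lt_and_real_Iic_le ν y)))]

theorem continuous_cdf (ν : Measure ℝ) [IsProbabilityMeasure ν] (hν : ∀ y, ν {y} = 0) :
    Continuous (cdf ν) := by
  refine continuous_iff_continuousAt.2 fun a => ?_
  rw [(monotone_cdf ν).continuousAt_iff_leftLim_eq_rightLim, StieltjesFunction.rightLim_eq]
  have hjump := (cdf ν).measure_singleton a
  rw [measure_cdf, hν, eq_comm, ENNReal.ofReal_eq_zero] at hjump
  linarith [(monotone_cdf ν).leftLim_le (le_refl a)]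

theorem measure_setOf_real_Iic_le (ν : Measure ℝ) [IsProbabilityMeasure ν] (hν : ∀ y, ν {y} = 0)
    {u : ℝ} (hu : u ∈ Icc (0 : ℝ) 1) : ν {y | ν.real (Iic y) ≤ u} = ENNReal.ofReal u := by
  have hinterior (v : ℝ) (hv : v ∈ Ioo (0 : ℝ) 1) :
      ν {y | ν.real (Iic y) ≤ v} = ENNReal.ofReal v := by
    obtain ⟨a, ha⟩ := ((tendsto_cdf_atBot ν).eventually_le_const hv.1).exists
    obtain ⟨b, hb⟩ := ((tendsto_cdf_atTop ν).eventually_const_le hv.2).exists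
    obtain ⟨y, rfl⟩ := mem_range_of_exists_le_of_exists_ge (continuous_cdf ν hν) ⟨a, ha⟩ ⟨b, hb⟩
    rw [cdf_eq_real, measure_setOf_real_Iic_le_real_Iic, ofReal_measureReal]
  rcases hu.1.eq_or_lt with rfl | hpos
  · rw [ENNReal.ofReal_zero, ← nonpos_iff_eq_zero]
    have hlim : Tendsto ENNReal.ofReal (𝓝[>] 0) (𝓝 0) := by
      simpa using (ENNReal.continuous_ofReal.tendsto 0).mono_left nhdsWithin_le_nhds
    refine ge_of_tendsto hlim ?_
    filter_upwards [Ioo_mem_nhdsGT one_pos] with v hv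
    rw [← hinterior v hv]
    exact measure_mono fun y (hy : _ ≤ (0 : ℝ)) => hy.trans hv.1.le
  rcases hu.2.eq_or_lt with rfl | hlt
  · simp [measureReal_le_one]
  · exact hinterior u ⟨hpos, hlt⟩

theorem measurable_kernel_real_Iic {α : Type*} [MeasurableSpace α] (κ : Kernel α ℝ)
    [IsSFiniteKernel κ] : Measurable fun p : α × ℝ => (κ p.1).real (Iic p.2) :=
  (Kernel.measurable_kernel_prodMk_left (κ := κ.prodMkRight ℝ)
    (t := {q : (α × ℝ) × ℝ | q.2 ≤ q.1.2})
    (measurableSet_le measurable_snd (measurable_snd.comp measurable_fst))).ennreal_toReal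

section Transform

variable {Ω α : Type*} [MeasurableSpace Ω] {P : Measure Ω} [IsFiniteMeasure P]
  [MeasurableSpace α] {X : Ω → α} {Y : Ω → ℝ} {κ : Kernel α ℝ}

theorem measure_inter_kernel_real_Iic_le [IsMarkovKernel κ] (hX : Measurable X) (hY : Measurable Y)
    (hlaw : P.map (fun ω => (X ω, Y ω)) = P.map X ⊗ₘ κ)
    (hκ : ∀ᵐ ω ∂P, ∀ y, κ (X ω) {y} = 0) {C : Set α} (hC : MeasurableSet C) {u : ℝ}
    (hu : u ∈ Icc (0 : ℝ) 1) :
    P (X ⁻¹' C ∩ {ω | (κ (X ω)).real (Iic (Y ω)) ≤ u}) = P (X ⁻¹' C) * ENNReal.ofReal u := by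
  let S : Set (α × ℝ) := {p | p.1 ∈ C ∧ (κ p.1).real (Iic p.2) ≤ u}
  have hS : MeasurableSet S :=
    (measurable_fst hC).inter (measurableSet_le (measurable_kernel_real_Iic κ) measurable_const)
  have hsection : ∀ᵐ ω ∂P, κ (X ω) (Prod.mk (X ω) ⁻¹' S) =
      (X ⁻¹' C).indicator (fun _ => ENNReal.ofReal u) ω := by
    filter_upwards [hκ] with ω hω
    by_cases hC : X ω ∈ C
    · rw [indicator_of_mem (by exact hC), ← measure_setOf_real_Iic_le (κ (X ω)) hω hu]
      congr 1
      ext y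
      simp [S, hC]
    · rw [indicator_of_notMem (by exact hC)]
      simp [S, hC]
  calc P (X ⁻¹' C ∩ {ω | (κ (X ω)).real (Iic (Y ω)) ≤ u})
      = P.map (fun ω => (X ω, Y ω)) S := by
        rw [Measure.map_apply (hX.prodMk hY) hS]
        rfl
    _ = ∫⁻ ω, κ (X ω) (Prod.mk (X ω) ⁻¹' S) ∂P := by
        rw [hlaw, Measure.compProd_apply hS,
          lintegral_map (Kernel.measurable_kernel_prodMk_left hS) hX]
    _ = P (X ⁻¹' C) * ENNReal.ofReal u := by
        rw [lintegral_congr_ae hsection, lintegral_indicator (hX hC), setLIntegral_const,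
          mul_comm]

theorem ae_eq_setOf_kernel_real_Iic_le [IsFiniteKernel κ] (hX : Measurable X) (hY : Measurable Y)
    (hlaw : P.map (fun ω => (X ω, Y ω)) = P.map X ⊗ₘ κ) (y : ℝ) :
    {ω | Y ω ≤ y} =ᵐ[P]
      {ω | (κ (X ω)).real (Iic (Y ω)) ≤ (κ (X ω)).real (Iic y)} := by
  let S : Set (α × ℝ) := {p | y < p.2 ∧ (κ p.1).real (Iic p.2) ≤ (κ p.1).real (Iic y)}
  have hS : MeasurableSet S :=
    (measurableSet_lt measurable_const measurable_snd).inter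
      (measurableSet_le (measurable_kernel_real_Iic κ)
        ((measurable_kernel_real_Iic κ).comp (measurable_fst.prodMk measurable_const)))
  have hnull : P ((fun ω => (X ω, Y ω)) ⁻¹' S) = 0 := by
    rw [← Measure.map_apply (hX.prodMk hY) hS, hlaw, Measure.compProd_apply hS,
      lintegral_eq_zero_iff (Kernel.measurable_kernel_prodMk_left hS)]
    exact .of_forall fun a => measure_setOf_lt_and_real_Iic_le (κ a) y
  filter_upwards [measure_eq_zero_iff_ae_notMem.1 hnull] with ω hω
  refine propext ⟨fun h => measureReal_mono (Iic_subset_Iic.2 h), fun h => ?_⟩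
  by_contra hlt
  exact hω ⟨not_le.1 hlt, h⟩

end Transform

namespace SubSigmaField

/-- The sub-σ-field of the measurable sets that are almost equal to a set of a given σ-field. -/
def completion {Ω : Type*} (m : MeasurableSpace Ω) {mΩ : MeasurableSpace Ω} (P : Measure Ω) :
    SubSigmaField P where
  toMS :=
    { MeasurableSet' := fun s => MeasurableSet[mΩ] s ∧ ∃ t, MeasurableSet[m] t ∧ s =ᵐ[P] t
      measurableSet_empty := ⟨@MeasurableSet.empty _ mΩ, ∅, @MeasurableSet.empty _ m, .rfl⟩
      measurableSet_compl := by
        rintro s ⟨hs, t, ht, hst⟩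
        exact ⟨hs.compl, tᶜ, ht.compl, hst.compl⟩
      measurableSet_iUnion := fun f hf => by
        choose hf t ht hft using hf
        exact ⟨.iUnion hf, ⋃ n, t n, .iUnion ht, .countable_iUnion hft⟩ }
  le := fun _ hs => hs.1
  null_mem := fun _ hs hnull => ⟨hs, ∅, @MeasurableSet.empty _ m, ae_eq_empty.2 hnull⟩

theorem le_completion {Ω : Type*} {m mΩ : MeasurableSpace Ω} {P : Measure Ω} (hm : m ≤ mΩ) :
    m ≤ (completion m P).toMS :=
  fun s hs => ⟨hm s hs, s, hs, .rfl⟩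

section Lattice

variable {Ω : Type*} {m m' : MeasurableSpace Ω} [mΩ : MeasurableSpace Ω] {P : Measure Ω}

theorem completion_le {E : SubSigmaField P} (h : m ≤ E.toMS) : completion m P ≤ E := by
  rintro s ⟨hs, t, ht, hst⟩
  exact E.measurableSet_congr (h t ht) hs hst.symm

theorem completion_toMS (E : SubSigmaField P) : completion E.toMS P = E :=
  le_antisymm (completion_le le_rfl) (le_completion E.le)

theorem completion_mono (h : m ≤ m') : completion m P ≤ completion m' P := by
  rintro s ⟨hs, t, ht, hst⟩
  exact ⟨hs, t, h t ht, hst⟩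

theorem indep_completion (h : Indep m m' P) :
    Indep (completion m P).toMS (completion m' P).toMS P := by
  rw [Indep_iff] at h ⊢
  rintro s t ⟨_, s', hs, hss⟩ ⟨_, t', ht, htt⟩
  rw [measure_congr hss, measure_congr htt, ← h s' t' hs ht]
  exact measure_congr (hss.inter htt)

instance : SemilatticeSup (SubSigmaField P) where
  sup E F :=
    { toMS := E.toMS ⊔ F.toMS
      le := sup_le E.le F.le
      null_mem := fun s hs hnull => le_sup_left (a := E.toMS) (b := F.toMS) s
        (E.null_mem s hs hnull) }
  le_sup_left E F := le_sup_left (a := E.toMS) (b := F.toMS)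
  le_sup_right E F := le_sup_right (a := E.toMS) (b := F.toMS)
  sup_le _ _ _ := sup_le (α := MeasurableSpace Ω)

theorem completion_sup (h : m ≤ mΩ) (h' : m' ≤ mΩ) :
    completion (m ⊔ m') P = completion m P ⊔ completion m' P :=
  le_antisymm (completion_le (sup_le_sup (le_completion h) (le_completion h')))
    (sup_le (completion_mono le_sup_left) (completion_mono le_sup_right))

end Lattice

/- Halve the part of `P` on the given set by the distribution function of `U`. -/
theorem isNonatomic_of_measure_preimage_singleton {Ω : Type*} [MeasurableSpace Ω] {P : Measure Ω}
    [IsFiniteMeasure P] {F : SubSigmaField P} {U : Ω → ℝ} (hU : Measurable[F.toMS] U)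
    (h : ∀ x, P (U ⁻¹' {x}) = 0) : F.IsNonatomic := by
  intro s hs hpos
  have hUm : Measurable U := hU.mono F.le le_rfl
  have : IsProbabilityMeasure P[|s] := cond_isProbabilityMeasure hpos.ne'
  set ν : Measure ℝ := P[|s].map U with hν
  have : IsProbabilityMeasure ν := Measure.isProbabilityMeasure_map hUm.aemeasurable
  have hνsingleton (y : ℝ) : ν {y} = 0 := by
    rw [hν, Measure.map_apply hUm (measurableSet_singleton y)]
    exact cond_absolutelyContinuous (h y)
  have hhalf := measure_setOf_real_Iic_le ν hνsingleton (u := 1 / 2) ⟨by norm_num, by norm_num⟩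
  set A : Set ℝ := {y | ν.real (Iic y) ≤ 1 / 2}
  have hA : MeasurableSet A := OrdConnected.measurableSet
    ⟨fun _ _ _ hb _ hc => (measureReal_mono (Iic_subset_Iic.2 hc.2)).trans hb⟩
  rw [hν, Measure.map_apply hUm hA, cond_apply (F.le s hs)] at hhalf
  have hmul : P (s ∩ U ⁻¹' A) = P s * ENNReal.ofReal (1 / 2) := by
    rw [← hhalf, ← mul_assoc, ENNReal.mul_inv_cancel hpos.ne' (measure_ne_top _ _), one_mul]
  refine ⟨s ∩ U ⁻¹' A, inter_subset_left, hs.inter (hU hA), ?_, ?_⟩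
  · rw [hmul]
    exact ENNReal.mul_pos hpos.ne' (by simp)
  · calc P (s ∩ U ⁻¹' A) = P s * ENNReal.ofReal (1 / 2) := hmul
      _ < P s * 1 := by
        refine ENNReal.mul_lt_mul_right hpos.ne' (measure_ne_top _ _) ?_
        rw [ENNReal.ofReal_lt_one]
        norm_num
      _ = P s := mul_one _

end SubSigmaField

/-! ### Independent complements -/

theorem map_prodMk_eq_compProd_condExpKernel {Ω β : Type*} {m mΩ : MeasurableSpace Ω}
    [StandardBorelSpace Ω] {P : Measure Ω} [IsFiniteMeasure P] [MeasurableSpace β] (hm : m ≤ mΩ)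
    {Y : Ω → β} (hY : Measurable[mΩ] Y) :
    @Measure.map Ω (Ω × β) mΩ (m.prod inferInstance) (fun ω => (id ω, Y ω)) P =
      @Measure.map Ω Ω mΩ m id P ⊗ₘ (condExpKernel P m).map Y := by
  rw [← trim_eq_map hm, Measure.compProd_map hY, compProd_trim_condExpKernel hm,
    @Measure.map_map Ω (Ω × Ω) (Ω × β) mΩ (m.prod mΩ) (m.prod inferInstance)]
  · rfl
  · exact Measurable.prodMap (@measurable_id _ m) hY
  · exact Measurable.prodMk (measurable_id'' hm) (@measurable_id _ mΩ)

namespace SubSigmaField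

variable {Ω : Type*} [MeasurableSpace Ω] {P : Measure Ω}

theorem IsGenerator.measurableEmbedding_comp {F : SubSigmaField P} {Z Z' : Type*}
    [MeasurableSpace Z] [MeasurableSpace Z'] {Y : Ω → Z} (hY : F.IsGenerator Y) {e : Z → Z'}
    (he : MeasurableEmbedding e) : F.IsGenerator (e ∘ Y) where
  measurable := he.measurable.comp hY.measurable
  exists_ae_eq_preimage A hA := by
    obtain ⟨B, hB, hAB⟩ := hY.exists_ae_eq_preimage A hA
    refine ⟨e '' B, he.measurableSet_image.2 hB, ?_⟩
    rwa [preimage_comp, preimage_image_eq _ he.injective]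

theorem isNonatomic_completion_comap [IsFiniteMeasure P] {U : Ω → unitInterval}
    (hU : Measurable U) (hlaw : P.map U = volume) :
    (completion (.comap U inferInstance) P).IsNonatomic := by
  refine isNonatomic_of_measure_preimage_singleton (U := fun ω => (U ω : ℝ))
    (measurable_subtype_coe.comp ((comap_measurable U).mono (le_completion hU.comap_le) le_rfl))
    fun x => ?_
  have hx : MeasurableSet (Subtype.val ⁻¹' {x} : Set unitInterval) :=
    measurable_subtype_coe (measurableSet_singleton x)
  change P (U ⁻¹' (Subtype.val ⁻¹' {x})) = 0
  rw [← Measure.map_apply hU hx, hlaw]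
  exact (subsingleton_singleton.preimage Subtype.val_injective).measure_zero _

variable [StandardBorelSpace Ω] {E F : SubSigmaField P} {Y : Ω → ℝ}

section

variable [IsFiniteMeasure P]

/-- The conditional probability integral transform of `Y` given `E`: the conditional distribution
function of `Y` given `E`, evaluated at `Y`. -/
noncomputable def condTransform (E : SubSigmaField P) (Y : Ω → ℝ) (ω : Ω) : unitInterval :=
  ⟨(condExpKernel P E.toMS ω).real (Y ⁻¹' Iic (Y ω)), measureReal_nonneg, measureReal_le_one⟩

theorem kernel_map_real_Iic (hY : Measurable Y) (ω : Ω) (y : ℝ) :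
    ((condExpKernel P E.toMS).map Y ω).real (Iic y) =
      (condExpKernel P E.toMS ω).real (Y ⁻¹' Iic y) :=
  congrArg ENNReal.toReal (Kernel.map_apply' _ hY _ measurableSet_Iic)

theorem measurable_condTransform (hEF : E ≤ F) (hY : Measurable[F.toMS] Y) :
    Measurable[F.toMS] (E.condTransform Y) := by
  have hYm : Measurable Y := hY.mono F.le le_rfl
  have : IsMarkovKernel ((condExpKernel P E.toMS).map Y) := Kernel.IsMarkovKernel.map _ hYm
  have hpair : @Measurable Ω (Ω × ℝ) F.toMS (E.toMS.prod inferInstance) fun ω => (ω, Y ω) :=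
    Measurable.prodMk (measurable_id'' hEF) hY
  have hcomp := (@measurable_kernel_real_Iic Ω E.toMS ((condExpKernel P E.toMS).map Y)
    inferInstance).comp hpair
  have hcongr := funext fun ω => kernel_map_real_Iic (E := E) hYm ω (Y ω)
  exact @Measurable.subtype_mk _ _ F.toMS _ _ _ (hcongr ▸ hcomp) _

theorem measure_inter_condTransform_le (hY : Measurable Y)
    (hna : ∀ᵐ ω ∂P, ∀ y, condExpKernel P E.toMS ω (Y ⁻¹' {y}) = 0) {C : Set Ω}
    (hC : MeasurableSet[E.toMS] C) (u : unitInterval) :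
    P (C ∩ E.condTransform Y ⁻¹' Iic u) = P C * ENNReal.ofReal u := by
  have hκ : IsMarkovKernel ((condExpKernel P E.toMS).map Y) := Kernel.IsMarkovKernel.map _ hY
  have hκna : ∀ᵐ ω ∂P, ∀ y, (condExpKernel P E.toMS).map Y (id ω) {y} = 0 := by
    filter_upwards [hna] with ω hω y
    exact (Kernel.map_apply' _ hY _ (measurableSet_singleton y)).trans (hω y)
  have h := @measure_inter_kernel_real_Iic_le Ω Ω _ P _ E.toMS id Y _ hκ (measurable_id'' E.le) hY
    (map_prodMk_eq_compProd_condExpKernel E.le hY) hκna C hC u u.2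
  simp only [id, kernel_map_real_Iic hY] at h
  exact h

theorem ae_eq_setOf_condTransform_le (hY : Measurable Y) (y : ℝ) :
    Y ⁻¹' Iic y =ᵐ[P]
      {ω | (E.condTransform Y ω : ℝ) ≤ (condExpKernel P E.toMS ω).real (Y ⁻¹' Iic y)} := by
  have : IsMarkovKernel ((condExpKernel P E.toMS).map Y) := Kernel.IsMarkovKernel.map _ hY
  have h := @ae_eq_setOf_kernel_real_Iic_le Ω Ω _ P _ E.toMS id Y _ inferInstance
    (measurable_id'' E.le) hY (map_prodMk_eq_compProd_condExpKernel E.le hY) y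
  simp only [id, kernel_map_real_Iic hY] at h
  exact h

/- Up to null sets, `{Y ≤ y}` says that the transform is at most the conditional distribution
function at `y`, which is `E`-measurable. -/
theorem IsGenerator.eq_sup_completion_condTransform (hEF : E ≤ F) (hY : F.IsGenerator Y) :
    F = E ⊔ completion (.comap (E.condTransform Y) inferInstance) P := by
  have hYm : Measurable Y := hY.measurable.mono F.le le_rfl
  have hU := measurable_condTransform hEF hY.measurable
  refine le_antisymm ?_ (sup_le hEF (completion_le hU.comap_le))
  set G := E ⊔ completion (.comap (E.condTransform Y) inferInstance) P
  have hUG : Measurable[G.toMS] fun ω => (E.condTransform Y ω : ℝ) :=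
    measurable_subtype_coe.comp ((comap_measurable _).mono
      ((le_completion (hU.mono F.le le_rfl).comap_le).trans (le_sup_right (a := E.toMS))) le_rfl)
  have hκG (y : ℝ) :
      Measurable[G.toMS] fun ω => (condExpKernel P E.toMS ω).real (Y ⁻¹' Iic y) :=
    (Kernel.measurable_coe _ (hYm measurableSet_Iic)).ennreal_toReal.mono
      (le_sup_left (a := E.toMS)) le_rfl
  have hYG : Measurable[G.toMS] Y :=
    @measurable_of_Iic _ _ _ _ _ G.toMS _ _ _ _ fun y =>
      G.measurableSet_congr (@measurableSet_le _ _ _ _ _ _ _ _ _ _ _ hUG (hκG y))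
        (hYm measurableSet_Iic) (ae_eq_setOf_condTransform_le hYm y).symm
  intro A hA
  obtain ⟨B, hB, hAB⟩ := hY.exists_ae_eq_preimage A hA
  exact G.measurableSet_congr (hYG hB) (F.le A hA) hAB.symm

end

variable [IsProbabilityMeasure P]

theorem map_condTransform (hY : Measurable Y)
    (hna : ∀ᵐ ω ∂P, ∀ y, condExpKernel P E.toMS ω (Y ⁻¹' {y}) = 0)
    (hU : Measurable (E.condTransform Y)) : P.map (E.condTransform Y) = volume := by
  have : IsProbabilityMeasure (P.map (E.condTransform Y)) :=
    Measure.isProbabilityMeasure_map hU.aemeasurable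
  refine Measure.ext_of_Iic _ _ fun u => ?_
  have h := measure_inter_condTransform_le hY hna (@MeasurableSet.univ _ E.toMS) u
  rwa [univ_inter, measure_univ, one_mul, ← unitInterval.volume_Iic,
    ← Measure.map_apply hU measurableSet_Iic] at h

theorem indep_condTransform (hY : Measurable Y)
    (hna : ∀ᵐ ω ∂P, ∀ y, condExpKernel P E.toMS ω (Y ⁻¹' {y}) = 0)
    (hU : Measurable (E.condTransform Y)) :
    Indep E.toMS (.comap (E.condTransform Y) inferInstance) P := by
  refine IndepSets.indep E.le hU.comap_le (@MeasurableSpace.isPiSystem_measurableSet _ E.toMS)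
    (p2 := preimage (E.condTransform Y) '' range Iic) ?_
    (@MeasurableSpace.generateFrom_measurableSet _ E.toMS).symm ?_ ?_
  · rintro _ ⟨_, ⟨a, rfl⟩, rfl⟩ _ ⟨_, ⟨b, rfl⟩, rfl⟩ _
    exact ⟨Iic (a ⊓ b), ⟨_, rfl⟩, by rw [← preimage_inter, Iic_inter_Iic]⟩
  · rw [← MeasurableSpace.comap_generateFrom, ← borel_eq_generateFrom_Iic,
      BorelSpace.measurable_eq (α := unitInterval)]
  · rw [IndepSets_iff]
    rintro C _ hC ⟨_, ⟨u, rfl⟩, rfl⟩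
    rw [measure_inter_condTransform_le hY hna hC u, ← Measure.map_apply hU measurableSet_Iic,
      map_condTransform hY hna hU, unitInterval.volume_Iic]

theorem RelNonatomic.exists_uniform (hEF : E ≤ F) (h : RelNonatomic E F) :
    ∃ U : Ω → unitInterval, Measurable[F.toMS] U ∧ P.map U = volume ∧
      Indep E.toMS (.comap U inferInstance) P ∧
      F = E ⊔ completion (.comap U inferInstance) P := by
  obtain ⟨Z, hZ⟩ := F.exists_isGenerator
  have hY := hZ.measurableEmbedding_comp (measurableEmbedding_embeddingReal (ℕ → Bool))
  set Y : Ω → ℝ := embeddingReal (ℕ → Bool) ∘ Z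
  have hYm : Measurable Y := hY.measurable.mono F.le le_rfl
  have hna := h.ae_preimage_singleton hY
  have hU := measurable_condTransform hEF hY.measurable
  have hUm : Measurable (E.condTransform Y) := hU.mono F.le le_rfl
  exact ⟨E.condTransform Y, hU, map_condTransform hYm hna hUm, indep_condTransform hYm hna hUm,
    hY.eq_sup_completion_condTransform hEF⟩

theorem isNonatomicOver_iff : F.IsNonatomicOver E ↔ E ≤ F ∧ RelNonatomic E F := by
  constructor
  · rintro ⟨G, hG, hindep, hF⟩
    have hEF : E.toMS ≤ F.toMS := hF ▸ le_sup_left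
    have hGF : G.toMS ≤ F.toMS := hF ▸ le_sup_right
    exact ⟨hEF, (hG.relNonatomic hindep).mono le_rfl hGF⟩
  · rintro ⟨hEF, h⟩
    obtain ⟨U, hU, hlaw, hindep, hsup⟩ := h.exists_uniform hEF
    refine ⟨completion (.comap U inferInstance) P,
      isNonatomic_completion_comap (hU.mono F.le le_rfl) hlaw, ?_, congrArg toMS hsup.symm⟩
    simpa only [completion_toMS] using indep_completion hindep

end SubSigmaField

/-! ### Products of independent random variables -/

theorem sup_eq_generateFrom_image2_inter {Ω : Type*} {m m' : MeasurableSpace Ω}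
    {C C' : Set (Set Ω)} (hC : m = .generateFrom C) (hC' : m' = .generateFrom C')
    (huniv : univ ∈ C) (huniv' : univ ∈ C') :
    m ⊔ m' = .generateFrom (image2 (· ∩ ·) C C') := by
  refine le_antisymm (sup_le ?_ ?_) (MeasurableSpace.generateFrom_le ?_)
  · rw [hC]
    exact MeasurableSpace.generateFrom_mono fun s hs => ⟨s, hs, univ, huniv', inter_univ s⟩
  · rw [hC']
    exact MeasurableSpace.generateFrom_mono fun s hs => ⟨univ, huniv, s, hs, univ_inter s⟩
  · rintro _ ⟨s, hs, t, ht, rfl⟩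
    exact (le_sup_left (a := m) s (hC ▸ MeasurableSpace.measurableSet_generateFrom hs)).inter
      (le_sup_right (a := m) t (hC' ▸ MeasurableSpace.measurableSet_generateFrom ht))

theorem isPiSystem_image2_inter {Ω : Type*} {C C' : Set (Set Ω)} (hC : IsPiSystem C)
    (hC' : IsPiSystem C') : IsPiSystem (image2 (· ∩ ·) C C') := by
  rintro _ ⟨s, hs, t, ht, rfl⟩ _ ⟨s', hs', t', ht', rfl⟩ hne
  rw [inter_inter_inter_comm] at hne ⊢
  exact ⟨s ∩ s', hC s hs s' hs' hne.left, t ∩ t', hC' t ht t' ht' hne.right, rfl⟩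

namespace SubSigmaField

variable {Ω : Type*} [mΩ : MeasurableSpace Ω] {P : Measure Ω}

open Classical in
/-- The product of two random variables, with the value `0` if it is not square integrable. -/
noncomputable def tensor (f g : Lp ℝ 2 P) : Lp ℝ 2 P :=
  if h : MemLp (fun ω => f ω * g ω) 2 P then h.toLp _ else 0

theorem tensor_indLp [IsFiniteMeasure P] {s t : Set Ω} (hs : MeasurableSet s)
    (ht : MeasurableSet t) : tensor (indLp P s) (indLp P t) = indLp P (s ∩ t) := by
  have hmul : (fun ω => indLp P s ω * indLp P t ω) =ᵐ[P] indLp P (s ∩ t) := by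
    filter_upwards [coeFn_indLp (P := P) hs, coeFn_indLp (P := P) ht,
      coeFn_indLp (P := P) (hs.inter ht)] with ω hωs hωt hωst
    rw [hωs, hωt, hωst]
    by_cases h : ω ∈ s <;> by_cases h' : ω ∈ t <;> simp [h, h']
  have hmem : MemLp (fun ω => indLp P s ω * indLp P t ω) 2 P :=
    (memLp_congr_ae hmul).2 (Lp.memLp _)
  rw [tensor, dif_pos hmem]
  exact Lp.ext (hmem.coeFn_toLp.trans hmul)

variable {M N : SubSigmaField P}

theorem indepFun_of_indep (hMN : Indep M.toMS N.toMS P) {f g : Ω → ℝ} (hf : Measurable f)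
    (hg : Measurable g) (hfM : AEStronglyMeasurable[M.toMS] f P)
    (hgN : AEStronglyMeasurable[N.toMS] g P) : IndepFun f g P :=
  indep_of_indep_of_le_left (indep_of_indep_of_le_right hMN
    (N.measurable_of_aestronglyMeasurable hg hgN).comap_le)
    (M.measurable_of_aestronglyMeasurable hf hfM).comap_le

variable {f f' g g' : Lp ℝ 2 P}

theorem coeFn_tensor (hMN : Indep M.toMS N.toMS P) (hf : AEStronglyMeasurable[M.toMS] f P)
    (hg : AEStronglyMeasurable[N.toMS] g P) : tensor f g =ᵐ[P] fun ω => f ω * g ω := by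
  have hmem : MemLp (fun ω => f ω * g ω) 2 P := by
    have hindep : IndepFun f g P := indepFun_of_indep hMN (Lp.stronglyMeasurable f).measurable
      (Lp.stronglyMeasurable g).measurable hf hg
    have hsq := (hindep.comp (φ := (· ^ 2)) (ψ := (· ^ 2)) (by fun_prop)
      (by fun_prop)).integrable_mul (Lp.memLp f).integrable_sq (Lp.memLp g).integrable_sq
    refine (memLp_two_iff_integrable_sq
      ((Lp.aestronglyMeasurable f).mul (Lp.aestronglyMeasurable g))).2 (hsq.congr ?_)
    exact .of_forall fun ω => (mul_pow _ _ _).symm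
  rw [tensor, dif_pos hmem]
  exact hmem.coeFn_toLp

theorem inner_tensor (hMN : Indep M.toMS N.toMS P) (hf : AEStronglyMeasurable[M.toMS] f P)
    (hg : AEStronglyMeasurable[N.toMS] g P) (hf' : AEStronglyMeasurable[M.toMS] f' P)
    (hg' : AEStronglyMeasurable[N.toMS] g' P) :
    inner ℝ (tensor f g) (tensor f' g') = inner ℝ f f' * inner ℝ g g' := by
  have hmeas (u v : Lp ℝ 2 P) : Measurable (u * v : Ω → ℝ) :=
    (Lp.stronglyMeasurable u).measurable.mul (Lp.stronglyMeasurable v).measurable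
  have hindep : IndepFun (f' * f : Ω → ℝ) (g' * g : Ω → ℝ) P :=
    indepFun_of_indep hMN (hmeas f' f) (hmeas g' g) (hf'.mul hf) (hg'.mul hg)
  simp only [L2.inner_def, RCLike.inner_apply, conj_trivial]
  calc ∫ ω, tensor f' g' ω * tensor f g ω ∂P
      = ∫ ω, (f' * f : Ω → ℝ) ω * (g' * g : Ω → ℝ) ω ∂P := by
        refine integral_congr_ae ?_
        filter_upwards [coeFn_tensor hMN hf hg, coeFn_tensor hMN hf' hg'] with ω hω hω'
        rw [hω, hω']
        exact mul_mul_mul_comm _ _ _ _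
    _ = (∫ ω, f' ω * f ω ∂P) * ∫ ω, g' ω * g ω ∂P :=
        hindep.integral_fun_mul_eq_mul_integral (hmeas f' f).aestronglyMeasurable
          (hmeas g' g).aestronglyMeasurable

theorem norm_tensor (hMN : Indep M.toMS N.toMS P) (hf : AEStronglyMeasurable[M.toMS] f P)
    (hg : AEStronglyMeasurable[N.toMS] g P) : ‖tensor f g‖ = ‖f‖ * ‖g‖ := by
  have h := inner_tensor hMN hf hg hf hg
  simp only [real_inner_self_eq_norm_sq, ← mul_pow] at h
  exact (pow_left_inj₀ (norm_nonneg _) (by positivity) two_ne_zero).1 h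

theorem tensor_sub_tensor (hMN : Indep M.toMS N.toMS P) (hf : AEStronglyMeasurable[M.toMS] f P)
    (hg : AEStronglyMeasurable[N.toMS] g P) (hf' : AEStronglyMeasurable[M.toMS] f' P)
    (hg' : AEStronglyMeasurable[N.toMS] g' P) :
    tensor f g - tensor f' g' = tensor (f - f') g + tensor f' (g - g') := by
  have hff' : AEStronglyMeasurable[M.toMS] (f - f' : Lp ℝ 2 P) P :=
    (hf.sub hf').congr (Lp.coeFn_sub f f').symm
  have hgg' : AEStronglyMeasurable[N.toMS] (g - g' : Lp ℝ 2 P) P :=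
    (hg.sub hg').congr (Lp.coeFn_sub g g').symm
  refine Lp.ext ?_
  filter_upwards [coeFn_tensor hMN hf hg, coeFn_tensor hMN hf' hg', coeFn_tensor hMN hff' hg,
    coeFn_tensor hMN hf' hgg', Lp.coeFn_sub f f', Lp.coeFn_sub g g',
    Lp.coeFn_sub (tensor f g) (tensor f' g'),
    Lp.coeFn_add (tensor (f - f') g) (tensor f' (g - g'))]
    with ω htensor htensor' hleft hright hsub_f hsub_g hsub hadd
  simp only [hsub, hadd, Pi.sub_apply, Pi.add_apply, htensor, htensor', hleft, hright, hsub_f,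
    hsub_g]
  ring

theorem norm_tensor_sub_tensor_le (hMN : Indep M.toMS N.toMS P)
    (hf : AEStronglyMeasurable[M.toMS] f P) (hg : AEStronglyMeasurable[N.toMS] g P)
    (hf' : AEStronglyMeasurable[M.toMS] f' P) (hg' : AEStronglyMeasurable[N.toMS] g' P) :
    ‖tensor f g - tensor f' g'‖ ≤ ‖f - f'‖ * ‖g‖ + ‖f'‖ * ‖g - g'‖ := by
  rw [tensor_sub_tensor hMN hf hg hf' hg']
  refine (norm_add_le _ _).trans (le_of_eq ?_)
  rw [norm_tensor hMN _ hg, norm_tensor hMN hf']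
  · exact (hg.sub hg').congr (Lp.coeFn_sub g g').symm
  · exact (hf.sub hf').congr (Lp.coeFn_sub f f').symm

variable [IsFiniteMeasure P]

/- Both sides have the same inner products with the indicators of `s ∩ t` for `s ∈ E`, `t ∈ D`. -/
theorem proj_sup_tensor (hMN : Indep M.toMS N.toMS P) {E D : SubSigmaField P} (hE : E ≤ M)
    (hD : D ≤ N) (hf : AEStronglyMeasurable[M.toMS] f P) (hg : AEStronglyMeasurable[N.toMS] g P) :
    (E ⊔ D).proj (tensor f g) = tensor (E.proj f) (D.proj g) := by
  have hEf := E.aestronglyMeasurable_proj f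
  have hDg := D.aestronglyMeasurable_proj g
  refine proj_eq_of_inner_eq_zero _ ?_ fun w hw => ?_
  · refine AEStronglyMeasurable.congr ?_ (coeFn_tensor hMN (hEf.mono hE) (hDg.mono hD)).symm
    exact (hEf.mono (le_sup_left (a := E))).mul (hDg.mono (le_sup_right (a := E)))
  let V : Submodule ℝ (Lp ℝ 2 P) :=
    LinearMap.ker (innerSL ℝ (tensor f g - tensor (E.proj f) (D.proj g))).toLinearMap
  have hV : IsClosed (V : Set (Lp ℝ 2 P)) :=
    (innerSL ℝ (tensor f g - tensor (E.proj f) (D.proj g))).isClosed_ker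
  have hinter {s t : Set Ω} (hs : MeasurableSet[E.toMS] s) (ht : MeasurableSet[D.toMS] t) :
      indLp P (s ∩ t) ∈ V := by
    have hEs := E.aestronglyMeasurable_indLp hs
    have hDt := D.aestronglyMeasurable_indLp ht
    change inner ℝ (tensor f g - tensor (E.proj f) (D.proj g)) (indLp P (s ∩ t)) = 0
    rw [inner_sub_left, ← tensor_indLp (E.le s hs) (D.le t ht),
      inner_tensor hMN hf hg (hEs.mono hE) (hDt.mono hD),
      inner_tensor hMN (hEf.mono hE) (hDg.mono hD) (hEs.mono hE) (hDt.mono hD),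
      inner_proj_left, inner_proj_left, E.proj_eq_self_iff.2 hEs, D.proj_eq_self_iff.2 hDt,
      sub_self]
  refine mem_of_aestronglyMeasurable hV (E ⊔ D).le
    (sup_eq_generateFrom_image2_inter (@MeasurableSpace.generateFrom_measurableSet _ E.toMS).symm
      (@MeasurableSpace.generateFrom_measurableSet _ D.toMS).symm
      (@MeasurableSet.univ _ E.toMS) (@MeasurableSet.univ _ D.toMS))
    (isPiSystem_image2_inter (@MeasurableSpace.isPiSystem_measurableSet _ E.toMS)
      (@MeasurableSpace.isPiSystem_measurableSet _ D.toMS)) ?_ ?_ hw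
  · rw [← inter_univ univ]
    exact hinter (@MeasurableSet.univ _ E.toMS) (@MeasurableSet.univ _ D.toMS)
  · rintro _ ⟨s, hs, t, ht, rfl⟩
    exact hinter hs ht

section Asymptotics

variable {α : Type*} {l : Filter α} {E E' D D' : α → SubSigmaField P}

theorem tendsto_proj_sup_sub_tensor (hMN : Indep M.toMS N.toMS P) (hE : ∀ a, E a ≤ M)
    (hE' : ∀ a, E' a ≤ M) (hD : ∀ a, D a ≤ N) (hD' : ∀ a, D' a ≤ N)
    (hf : AEStronglyMeasurable[M.toMS] f P) (hg : AEStronglyMeasurable[N.toMS] g P)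
    (hEE' : Tendsto (fun a => (E a).proj f - (E' a).proj f) l (𝓝 0))
    (hDD' : Tendsto (fun a => (D a).proj g - (D' a).proj g) l (𝓝 0)) :
    Tendsto (fun a => (E a ⊔ D a).proj (tensor f g) - (E' a ⊔ D' a).proj (tensor f g)) l
      (𝓝 0) := by
  have hbound := ((tendsto_zero_iff_norm_tendsto_zero.1 hEE').mul_const ‖g‖).add
    ((tendsto_zero_iff_norm_tendsto_zero.1 hDD').const_mul ‖f‖)
  rw [zero_mul, mul_zero, add_zero] at hbound
  refine squeeze_zero_norm (fun a => ?_) hbound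
  rw [proj_sup_tensor hMN (hE a) (hD a) hf hg, proj_sup_tensor hMN (hE' a) (hD' a) hf hg]
  refine (norm_tensor_sub_tensor_le hMN ((aestronglyMeasurable_proj _ _).mono (hE a))
    ((aestronglyMeasurable_proj _ _).mono (hD a)) ((aestronglyMeasurable_proj _ _).mono (hE' a))
    ((aestronglyMeasurable_proj _ _).mono (hD' a))).trans ?_
  gcongr
  · exact norm_proj_le _ _
  · exact norm_proj_le _ _

theorem tendsto_proj_sup_sub (hMN : Indep M.toMS N.toMS P) (hE : ∀ a, E a ≤ M)
    (hE' : ∀ a, E' a ≤ M) (hD : ∀ a, D a ≤ N) (hD' : ∀ a, D' a ≤ N)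
    (hEE' : ∀ A, MeasurableSet[M.toMS] A →
      Tendsto (fun a => (E a).proj (indLp P A) - (E' a).proj (indLp P A)) l (𝓝 0))
    {C : Set (Set Ω)} (hC : IsPiSystem C) (huniv : univ ∈ C) (hCm : ∀ B ∈ C, MeasurableSet B)
    (hN : N = completion (.generateFrom C) P)
    (hDD' : ∀ B ∈ C, Tendsto (fun a => (D a).proj (indLp P B) - (D' a).proj (indLp P B)) l (𝓝 0))
    (f : Lp ℝ 2 P) :
    Tendsto (fun a => (E a ⊔ D a).proj f - (E' a ⊔ D' a).proj f) l (𝓝 0) := by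
  let V : Submodule ℝ (Lp ℝ 2 P) :=
    asymptoticallyEqual l (fun a => (E a ⊔ D a).proj) fun a => (E' a ⊔ D' a).proj
  have hV : IsClosed (V : Set (Lp ℝ 2 P)) :=
    isClosed_asymptoticallyEqual (fun _ => lipschitzWith_proj _) fun _ => lipschitzWith_proj _
  have hCle : .generateFrom C ≤ mΩ := MeasurableSpace.generateFrom_le hCm
  have hinter {A B : Set Ω} (hA : MeasurableSet[M.toMS] A) (hB : B ∈ C) :
      indLp P (A ∩ B) ∈ V := by
    have hBN : MeasurableSet[N.toMS] B :=
      hN ▸ le_completion hCle B (MeasurableSpace.measurableSet_generateFrom hB)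
    rw [← tensor_indLp (M.le A hA) (hCm B hB)]
    exact tendsto_proj_sup_sub_tensor hMN hE hE' hD hD' (M.aestronglyMeasurable_indLp hA)
      (N.aestronglyMeasurable_indLp hBN) (hEE' A hA) (hDD' B hB)
  have hsup : M ⊔ N = completion (M.toMS ⊔ .generateFrom C) P := by
    rw [completion_sup M.le hCle, completion_toMS, ← hN]
  have hmem {A : Set Ω} (hA : MeasurableSet[(M ⊔ N).toMS] A) : indLp P A ∈ V := by
    rw [hsup] at hA
    obtain ⟨hAm, B, hB, hAB⟩ := hA
    rw [indLp_congr hAm (sup_le M.le hCle B hB) hAB]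
    refine indLp_mem_of_isPiSystem hV (sup_le M.le hCle)
      (sup_eq_generateFrom_image2_inter
        (@MeasurableSpace.generateFrom_measurableSet _ M.toMS).symm rfl
        (@MeasurableSet.univ _ M.toMS) huniv)
      (isPiSystem_image2_inter (@MeasurableSpace.isPiSystem_measurableSet _ M.toMS) hC) ?_ ?_ hB
    · rw [← inter_univ univ]
      exact hinter (@MeasurableSet.univ _ M.toMS) huniv
    · rintro _ ⟨s, hs, t, ht, rfl⟩
      exact hinter hs ht
  have hproj : (M ⊔ N).proj f ∈ V :=
    mem_of_aestronglyMeasurable hV (M ⊔ N).le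
      (@MeasurableSpace.generateFrom_measurableSet _ (M ⊔ N).toMS).symm
      (@MeasurableSpace.isPiSystem_measurableSet _ (M ⊔ N).toMS)
      (hmem (@MeasurableSet.univ _ (M ⊔ N).toMS)) (fun _ => hmem) (aestronglyMeasurable_proj _ f)
  refine hproj.congr fun a => ?_
  rw [proj_proj_of_le (sup_le_sup (hE a) (hD a)), proj_proj_of_le (sup_le_sup (hE' a) (hD' a))]

end Asymptotics

end SubSigmaField

/-! ### Truncated noise -/

open unitInterval

namespace SubSigmaField

section Completion

variable {Ω : Type*} {m : MeasurableSpace Ω} [mΩ : MeasurableSpace Ω] {P : Measure Ω}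
  [IsFiniteMeasure P]

theorem aestronglyMeasurable_of_completion (hm : m ≤ mΩ) {f : Lp ℝ 2 P}
    (hf : AEStronglyMeasurable[(completion m P).toMS] f P) : AEStronglyMeasurable[m] f P := by
  have : Fact (m ≤ mΩ) := ⟨hm⟩
  have hV : IsClosed (lpMeas ℝ ℝ m 2 P : Set (Lp ℝ 2 P)) := isClosed_aestronglyMeasurable hm
  have hind (s : Set Ω) (hs : MeasurableSet[(completion m P).toMS] s) :
      indLp P s ∈ lpMeas ℝ ℝ m 2 P := by
    obtain ⟨hs, t, ht, hst⟩ := hs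
    rw [mem_lpMeas_iff_aestronglyMeasurable, indLp_congr hs (hm t ht) hst]
    exact ((@stronglyMeasurable_const _ _ m _ (1 : ℝ)).indicator ht).aestronglyMeasurable.congr
      (coeFn_indLp (hm t ht)).symm
  exact mem_lpMeas_iff_aestronglyMeasurable.1
    (mem_of_aestronglyMeasurable hV (completion m P).le
      (@MeasurableSpace.generateFrom_measurableSet _ (completion m P).toMS).symm
      (@MeasurableSpace.isPiSystem_measurableSet _ (completion m P).toMS)
      (hind _ (@MeasurableSet.univ _ (completion m P).toMS)) hind hf)

theorem proj_completion_eq_of_inner_indLp (hm : m ≤ mΩ) {f g : Lp ℝ 2 P}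
    (hg : AEStronglyMeasurable[m] g P)
    (h : ∀ s, MeasurableSet[m] s → inner ℝ f (indLp P s) = inner ℝ g (indLp P s)) :
    (completion m P).proj f = g := by
  refine proj_eq_of_inner_eq_zero _ (hg.mono (le_completion hm)) fun w hw => ?_
  let V : Submodule ℝ (Lp ℝ 2 P) := LinearMap.ker (innerSL ℝ (f - g)).toLinearMap
  have hV : IsClosed (V : Set (Lp ℝ 2 P)) := (innerSL ℝ (f - g)).isClosed_ker
  have hind (s : Set Ω) (hs : MeasurableSet[m] s) : indLp P s ∈ V := by
    change inner ℝ (f - g) (indLp P s) = 0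
    rw [inner_sub_left, h s hs, sub_self]
  exact mem_of_aestronglyMeasurable hV hm
    (@MeasurableSpace.generateFrom_measurableSet _ m).symm
    (@MeasurableSpace.isPiSystem_measurableSet _ m) (hind _ (@MeasurableSet.univ _ m)) hind
    (aestronglyMeasurable_of_completion hm hw)

theorem proj_completion_indLp_of_subset_atom (hm : m ≤ mΩ) {G s : Set Ω}
    (hG : MeasurableSet[m] G) (hatom : ∀ t, MeasurableSet[m] t → G ⊆ t ∨ G ∩ t = ∅)
    (hPG : P.real G ≠ 0) (hs : MeasurableSet s) (hsG : s ⊆ G) :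
    (completion m P).proj (indLp P s) = (P.real s / P.real G) • indLp P G := by
  refine proj_completion_eq_of_inner_indLp hm ?_ fun t ht => ?_
  · have hGm : AEStronglyMeasurable[m] (indLp P G) P :=
      ((@stronglyMeasurable_const _ _ m _ (1 : ℝ)).indicator hG).aestronglyMeasurable.congr
        (coeFn_indLp (hm G hG)).symm
    exact (hGm.const_smul _).congr (Lp.coeFn_smul _ _).symm
  · rw [real_inner_smul_left, inner_indLp hs (hm t ht), inner_indLp (hm G hG) (hm t ht)]
    obtain hGt | hGt := hatom t ht
    · rw [inter_eq_left.2 (hsG.trans hGt), inter_eq_left.2 hGt, div_mul_cancel₀ _ hPG]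
    · have hst : s ∩ t = ∅ := subset_eq_empty (inter_subset_inter_left t hsG) hGt
      rw [hGt, hst, measureReal_empty, mul_zero]

theorem ae_proj_indLp_mem_Icc (E : SubSigmaField P) {A : Set Ω} (hA : MeasurableSet A) :
    ∀ᵐ ω ∂P, E.proj (indLp P A) ω ∈ Icc (0 : ℝ) 1 := by
  have hnonneg : 0 ≤ᵐ[P] P⟦A | E.toMS⟧ :=
    condExp_nonneg (.of_forall (indicator_nonneg fun _ _ => zero_le_one))
  have hle : P⟦A | E.toMS⟧ ≤ᵐ[P] P[fun _ => (1 : ℝ) | E.toMS] :=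
    condExp_mono ((integrable_const 1).indicator hA) (integrable_const 1)
      (.of_forall (indicator_le_self' fun _ _ => zero_le_one))
  rw [condExp_const E.le] at hle
  filter_upwards [proj_indLp_ae_eq E hA, hnonneg, hle] with ω hω h0 h1
  rw [hω]
  exact ⟨h0, h1⟩

section Comap

variable {α β : Type*} [MeasurableSpace α] [MeasurableSpace β] {X : Ω → α} {Z : Ω → β}

theorem exists_measurable_proj_indLp_ae_eq (hX : Measurable X) {A : Set Ω}
    (hA : MeasurableSet A) :
    ∃ φ : α → ℝ, Measurable φ ∧ (∀ x, φ x ∈ Icc (0 : ℝ) 1) ∧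
      (completion (.comap X inferInstance) P).proj (indLp P A) =ᵐ[P] φ ∘ X := by
  obtain ⟨g, hg, hEg⟩ := aestronglyMeasurable_of_completion hX.comap_le
    (aestronglyMeasurable_proj (completion (.comap X inferInstance) P) (indLp P A))
  obtain ⟨φ, hφ, rfl⟩ := hg.exists_eq_measurable_comp
  refine ⟨fun x => max 0 (min 1 (φ x)),
    measurable_const.max (measurable_const.min hφ.measurable),
    fun x => ⟨le_max_left _ _, max_le zero_le_one (min_le_left _ _)⟩, ?_⟩
  filter_upwards [hEg, ae_proj_indLp_mem_Icc (completion (.comap X inferInstance) P) hA]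
    with ω hω hmem
  rw [hω] at hmem ⊢
  exact (by rw [min_eq_right hmem.2, max_eq_right hmem.1] :
    max 0 (min 1 ((φ ∘ X) ω)) = (φ ∘ X) ω).symm

/- If `X = ψ ∘ Z` off `B`, then a version `φ ∘ X` of the conditional probability given `X` is
approximated by `φ ∘ ψ ∘ Z`. -/
theorem norm_proj_comap_sub_proj_comap_sq_le (hX : Measurable X) (hZ : Measurable Z)
    (hZX : completion (.comap Z inferInstance) P ≤ completion (.comap X inferInstance) P)
    {ψ : β → α} (hψ : Measurable ψ) {B : Set Ω} (hB : MeasurableSet B)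
    (hψB : ∀ ω ∉ B, X ω = ψ (Z ω)) {A : Set Ω} (hA : MeasurableSet A) :
    ‖(completion (.comap X inferInstance) P).proj (indLp P A) -
      (completion (.comap Z inferInstance) P).proj (indLp P A)‖ ^ 2 ≤ P.real B := by
  obtain ⟨φ, hφ, hφI, hEφ⟩ := exists_measurable_proj_indLp_ae_eq (P := P) hX hA
  set g := (completion (.comap X inferInstance) P).proj (indLp P A) with hg
  let w : Ω → ℝ := fun ω => φ (ψ (Z ω))
  have hwm : Measurable[.comap Z inferInstance] w := (hφ.comp hψ).comp (comap_measurable Z)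
  have hw : MemLp w 2 P := MemLp.of_bound (hwm.mono hZ.comap_le le_rfl).aestronglyMeasurable 1
    (.of_forall fun ω => by
      rw [Real.norm_eq_abs, abs_of_nonneg (hφI _).1]
      exact (hφI _).2)
  have hwZ : (completion (.comap Z inferInstance) P).proj (hw.toLp w) = hw.toLp w := by
    refine (proj_eq_self_iff _).2 (AEStronglyMeasurable.congr ?_ hw.coeFn_toLp.symm)
    exact hwm.stronglyMeasurable.aestronglyMeasurable.mono (le_completion hZ.comap_le)
  have hle := norm_sub_proj_le _ (f := g) hwZ
  rw [hg, proj_proj_of_le hZX, ← hg] at hle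
  refine (pow_le_pow_left₀ (norm_nonneg _) hle 2).trans ?_
  rw [norm_sq_eq_integral, ← integral_indicator_one hB]
  refine integral_mono_ae (Lp.memLp _).integrable_sq ((integrable_const 1).indicator hB) ?_
  filter_upwards [Lp.coeFn_sub g (hw.toLp w), hw.coeFn_toLp, hEφ] with ω hsub hwω hgω
  rw [hsub, Pi.sub_apply, hwω, hgω]
  by_cases hω : ω ∈ B
  · rw [indicator_of_mem hω, Pi.one_apply, sq_le_one_iff_abs_le_one, Function.comp_apply]
    exact (abs_sub_le_of_le_of_le (hφI _).1 (hφI _).2 (hφI _).1 (hφI _).2).trans_eq (sub_zero 1)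
  · rw [indicator_of_notMem hω, Function.comp_apply, hψB ω hω, sub_self, zero_pow two_ne_zero]

end Comap

end Completion

section Noise

variable {Ω : Type*} {U : ℕ → Ω → I}

theorem comap_min_le_comap_min (X : Ω → I) {a b : I} (hab : a ≤ b) :
    MeasurableSpace.comap (fun ω => min (X ω) a) inferInstance ≤
      .comap (fun ω => min (X ω) b) inferInstance := by
  have h : (fun ω => min (X ω) a) = (fun x => min x a) ∘ fun ω => min (X ω) b := by
    ext ω
    simp [min_assoc, min_eq_right hab]
  rw [h, ← MeasurableSpace.comap_comp]
  exact MeasurableSpace.comap_mono (measurable_id.min measurable_const).comap_le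

variable [mΩ : MeasurableSpace Ω] {P : Measure Ω}

/-- The sub-σ-field generated by the random variables `U k ⊓ a`, `k ∈ S`. For independent uniform
`U k` it grows continuously with `a`, from the trivial sub-σ-field at `a = 0`. -/
def noise (P : Measure Ω) (U : ℕ → Ω → I) (S : Set ℕ) (a : I) : SubSigmaField P :=
  completion (⨆ k ∈ S, .comap (fun ω => min (U k ω) a) inferInstance) P

theorem noise_singleton (k : ℕ) (a : I) :
    noise P U {k} a = completion (.comap (fun ω => min (U k ω) a) inferInstance) P := by
  rw [noise, iSup_singleton]

theorem noise_mono {S S' : Set ℕ} (hS : S ⊆ S') {a b : I} (hab : a ≤ b) :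
    noise P U S a ≤ noise P U S' b :=
  completion_mono (iSup₂_le fun k hk => (comap_min_le_comap_min (U k) hab).trans
    (le_iSup₂ (f := fun k (_ : k ∈ S') =>
      MeasurableSpace.comap (fun ω => min (U k ω) b) inferInstance) k (hS hk)))

theorem noise_le_one (S : Set ℕ) (a : I) : noise P U S a ≤ noise P U S 1 :=
  noise_mono subset_rfl le_one'

theorem noise_le_univ (S : Set ℕ) (a : I) : noise P U S a ≤ noise P U univ 1 :=
  noise_mono (subset_univ S) le_one'

theorem noise_zero_le (S : Set ℕ) (E : SubSigmaField P) : noise P U S 0 ≤ E := by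
  refine completion_le (iSup₂_le fun k _ => ?_)
  have h : (fun ω => min (U k ω) 0) = fun _ => 0 := by
    ext ω
    simp
  rw [h, MeasurableSpace.comap_const]
  exact bot_le

theorem noise_empty_le (a : I) (E : SubSigmaField P) : noise P U ∅ a ≤ E := by
  refine completion_le ?_
  simp

theorem iSup_comap_min_le (hU : ∀ k, Measurable (U k)) (S : Set ℕ) (a : I) :
    ⨆ k ∈ S, MeasurableSpace.comap (fun ω => min (U k ω) a) inferInstance ≤ mΩ :=
  iSup₂_le fun k _ => ((hU k).min measurable_const).comap_le

theorem noise_union (hU : ∀ k, Measurable (U k)) (S S' : Set ℕ) (a : I) :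
    noise P U (S ∪ S') a = noise P U S a ⊔ noise P U S' a := by
  rw [noise, iSup_union, completion_sup (iSup_comap_min_le hU S a) (iSup_comap_min_le hU S' a)]
  rfl

theorem indep_noise (hU : ∀ k, Measurable (U k)) (hi : iIndepFun U P) {S S' : Set ℕ}
    (hS : Disjoint S S') (a b : I) :
    Indep (noise P U S a).toMS (noise P U S' b).toMS P := by
  have hle (c : I) (k : ℕ) : MeasurableSpace.comap (fun ω => min (U k ω) c) inferInstance ≤
      .comap (U k) inferInstance :=
    ((comap_measurable (U k)).min (@measurable_const _ _ _ (_) c)).comap_le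
  exact indep_completion (indep_of_indep_of_le_left (indep_of_indep_of_le_right
    (indep_iSup_of_disjoint (fun k => (hU k).comap_le) hi hS)
    (iSup₂_mono fun k _ => hle b k)) (iSup₂_mono fun k _ => hle a k))

variable [IsFiniteMeasure P]

/- Off `{c ≤ U k < d}`, the value of `U k ⊓ d` is determined by that of `U k ⊓ c`. -/
theorem norm_proj_noise_singleton_sub_sq_le (hU : ∀ k, Measurable (U k)) (k : ℕ) {c d : I}
    (hcd : c ≤ d) {A : Set Ω} (hA : MeasurableSet A) :
    ‖(noise P U {k} d).proj (indLp P A) - (noise P U {k} c).proj (indLp P A)‖ ^ 2 ≤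
      P.real (U k ⁻¹' Ico c d) := by
  have hle : noise P U {k} c ≤ noise P U {k} d := noise_mono subset_rfl hcd
  rw [noise_singleton, noise_singleton] at hle ⊢
  let ψ : I → I := fun x => if x < c then x else d
  have hψ : Measurable ψ := Measurable.ite measurableSet_Iio measurable_id measurable_const
  refine norm_proj_comap_sub_proj_comap_sq_le ((hU k).min measurable_const)
    ((hU k).min measurable_const) hle hψ (hU k measurableSet_Ico) (fun ω hω => ?_) hA
  obtain h | h := lt_or_ge (U k ω) c
  · simp only [ψ]
    rw [min_eq_left h.le, if_pos h, min_eq_left (h.le.trans hcd)]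
  · simp only [ψ]
    rw [min_eq_right h, if_neg (lt_irrefl c), min_eq_right (not_lt.1 fun hd => hω ⟨h, hd⟩)]

theorem continuous_proj_noise_singleton_indLp (hU : ∀ k, Measurable (U k))
    (hlaw : ∀ k, P.map (U k) = volume) (k : ℕ) {A : Set Ω} (hA : MeasurableSet A) :
    Continuous fun b => (noise P U {k} b).proj (indLp P A) := by
  have hIco (c d : I) : P.real (U k ⁻¹' Ico c d) ≤ |(d : ℝ) - c| := by
    rw [← map_measureReal_apply (hU k) measurableSet_Ico, hlaw k, Measure.real,
      volume_Ico, ENNReal.toReal_ofReal']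
    exact max_le (le_abs_self _) (abs_nonneg _)
  refine continuous_iff_continuousAt.2 fun a => tendsto_sub_nhds_zero_iff.1 ?_
  have hsqrt : Tendsto (fun b : I => √|(b : ℝ) - a|) (𝓝 a) (𝓝 0) := by
    have hcont : Continuous fun b : I => √|(b : ℝ) - a| := by fun_prop
    simpa using hcont.tendsto a
  refine squeeze_zero_norm (fun b => Real.le_sqrt_of_sq_le ?_) hsqrt
  obtain h | h := le_total a b
  · exact (norm_proj_noise_singleton_sub_sq_le hU k h hA).trans (hIco a b)
  · rw [norm_sub_rev, abs_sub_comm]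
    exact (norm_proj_noise_singleton_sub_sq_le hU k h hA).trans (hIco b a)

theorem continuous_noise_finset (hU : ∀ k, Measurable (U k)) (hi : iIndepFun U P)
    (hlaw : ∀ k, P.map (U k) = volume) (J : Finset ℕ) : Continuous (noise P U J) := by
  rw [continuous_iff_proj]
  intro f
  induction J using Finset.induction_on generalizing f with
  | empty =>
    have hconst (b : I) : noise P U (∅ : Finset ℕ) b = noise P U ∅ 0 := by
      rw [Finset.coe_empty]
      exact le_antisymm (noise_empty_le _ _) (noise_empty_le _ _)
    simp only [hconst, continuous_const]
  | insert k J hk ih =>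
    have hd : Disjoint ({k} : Set ℕ) J := by simpa using hk
    refine continuous_iff_continuousAt.2 fun a => tendsto_sub_nhds_zero_iff.1 ?_
    rw [Finset.coe_insert, Set.insert_eq]
    simp only [noise_union hU]
    exact tendsto_proj_sup_sub (indep_noise hU hi hd 1 1) (noise_le_one {k})
      (fun _ => noise_le_one {k} a) (noise_le_one J) (fun _ => noise_le_one J a)
      (fun A hA => tendsto_sub_nhds_zero_iff.2
        ((continuous_proj_noise_singleton_indLp hU hlaw k
          ((noise P U {k} 1).le A hA)).tendsto a))
      (@MeasurableSpace.isPiSystem_measurableSet _ (noise P U J 1).toMS)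
      (@MeasurableSet.univ _ (noise P U J 1).toMS) (noise P U J 1).le
      (by rw [@MeasurableSpace.generateFrom_measurableSet _ (noise P U J 1).toMS,
        completion_toMS])
      (fun B _ => tendsto_sub_nhds_zero_iff.2 ((ih (indLp P B)).tendsto a)) f

theorem proj_sup_indLp_of_indep {M N E D : SubSigmaField P} (hMN : Indep M.toMS N.toMS P)
    (hE : E ≤ M) (hD : D ≤ N) {A : Set Ω} (hA : MeasurableSet[M.toMS] A) :
    (E ⊔ D).proj (indLp P A) = E.proj (indLp P A) := by
  have huniv : AEStronglyMeasurable[D.toMS] (indLp P univ) P :=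
    D.aestronglyMeasurable_indLp (@MeasurableSet.univ _ D.toMS)
  have hsup := proj_sup_tensor hMN hE hD (M.aestronglyMeasurable_indLp hA) (huniv.mono hD)
  rw [tensor_indLp (M.le A hA) .univ, inter_univ, D.proj_eq_self_iff.2 huniv] at hsup
  rw [hsup]
  refine Lp.ext ?_
  filter_upwards [coeFn_tensor hMN ((E.aestronglyMeasurable_proj (indLp P A)).mono hE)
    (huniv.mono hD), coeFn_indLp (P := P) MeasurableSet.univ] with ω hω hω_univ
  rw [hω, hω_univ, indicator_univ, mul_one]

theorem proj_noise_indLp_inter (hU : ∀ k, Measurable (U k)) (hi : iIndepFun U P) (S J : Set ℕ)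
    (a : I) {A : Set Ω} (hA : MeasurableSet[(noise P U J 1).toMS] A) :
    (noise P U S a).proj (indLp P A) = (noise P U (S ∩ J) a).proj (indLp P A) := by
  conv_lhs => rw [← Set.inter_union_sdiff S J, noise_union hU]
  exact proj_sup_indLp_of_indep (indep_noise hU hi (disjoint_sdiff_right (s := J) (t := S)) 1 1)
    (noise_mono inter_subset_right le_one') (noise_le_one _ _) hA

end Noise

section Cylinders

variable {Ω : Type*} [mΩ : MeasurableSpace Ω] {P : Measure Ω} {U : ℕ → Ω → I}

/-- The events depending, up to null sets, on finitely many of the random variables `U k`. -/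
def noiseCylinders (P : Measure Ω) (U : ℕ → Ω → I) : Set (Set Ω) :=
  {A | ∃ m : ℕ, MeasurableSet[(noise P U (Iio m) 1).toMS] A}

theorem measurableSet_of_mem_noiseCylinders {A : Set Ω} (hA : A ∈ noiseCylinders P U) :
    MeasurableSet A :=
  let ⟨_, h⟩ := hA
  SubSigmaField.le _ A h

theorem univ_mem_noiseCylinders : univ ∈ noiseCylinders P U :=
  ⟨0, @MeasurableSet.univ _ (noise P U (Iio 0) 1).toMS⟩

theorem isPiSystem_noiseCylinders : IsPiSystem (noiseCylinders P U) := by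
  rintro A ⟨m, hA⟩ B ⟨n, hB⟩ _
  refine ⟨max m n, MeasurableSet.inter ?_ ?_⟩
  · exact noise_mono (Iio_subset_Iio (le_max_left m n)) le_rfl A hA
  · exact noise_mono (Iio_subset_Iio (le_max_right m n)) le_rfl B hB

theorem noise_univ_eq_completion (hU : ∀ k, Measurable (U k)) :
    noise P U univ 1 = completion (.generateFrom (noiseCylinders P U)) P := by
  refine le_antisymm (completion_mono (iSup₂_le fun k _ A hA => ?_)) (completion_le ?_)
  · have hle : MeasurableSpace.comap (fun ω => min (U k ω) 1) inferInstance ≤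
        ⨆ j ∈ Iio (k + 1), .comap (fun ω => min (U j ω) 1) inferInstance :=
      le_iSup₂_of_le k (mem_Iio.2 k.lt_succ_self) le_rfl
    exact MeasurableSpace.measurableSet_generateFrom
      ⟨k + 1, le_completion (iSup_comap_min_le hU _ 1) A (hle A hA)⟩
  · refine MeasurableSpace.generateFrom_le ?_
    rintro A ⟨m, hA⟩
    exact noise_mono (subset_univ _) le_rfl A hA

variable [IsFiniteMeasure P] {M : SubSigmaField P}

theorem continuous_proj_noise_indLp (hU : ∀ k, Measurable (U k)) (hi : iIndepFun U P)
    (hlaw : ∀ k, P.map (U k) = volume) (S : Set ℕ) {A : Set Ω} (hA : A ∈ noiseCylinders P U) :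
    Continuous fun b => (noise P U S b).proj (indLp P A) := by
  obtain ⟨m, hA⟩ := hA
  have hfin : (S ∩ Iio m).Finite := (finite_Iio m).inter_of_right S
  simp only [proj_noise_indLp_inter hU hi S (Iio m) _ hA]
  have hcont := continuous_noise_finset hU hi hlaw hfin.toFinset
  rw [hfin.coe_toFinset] at hcont
  exact continuous_iff_proj.1 hcont (indLp P A)

variable {α : Type*} {l : Filter α} {E : α → SubSigmaField P}

theorem tendsto_sup_noise (hU : ∀ k, Measurable (U k)) (hi : iIndepFun U P)
    (hlaw : ∀ k, P.map (U k) = volume) (hM : Indep M.toMS (noise P U univ 1).toMS P)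
    {E₀ : SubSigmaField P} (hE : ∀ x, E x ≤ M) (hE₀ : E₀ ≤ M) (h : Tendsto E l (𝓝 E₀))
    (S : Set ℕ) {c : α → I} {c₀ : I} (hc : Tendsto c l (𝓝 c₀)) :
    Tendsto (fun x => E x ⊔ noise P U S (c x)) l (𝓝 (E₀ ⊔ noise P U S c₀)) := by
  rw [tendsto_iff_proj]
  intro f
  rw [← tendsto_sub_nhds_zero_iff]
  refine tendsto_proj_sup_sub hM hE (fun _ => hE₀) (fun x => noise_le_univ S (c x))
    (fun _ => noise_le_univ S c₀) (fun A _ => ?_) isPiSystem_noiseCylinders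
    univ_mem_noiseCylinders (fun B => measurableSet_of_mem_noiseCylinders)
    (noise_univ_eq_completion hU) (fun B hB => ?_) f
  · exact tendsto_sub_nhds_zero_iff.2 (tendsto_iff_proj.1 h _)
  · exact tendsto_sub_nhds_zero_iff.2
      (((continuous_proj_noise_indLp hU hi hlaw S hB).tendsto c₀).comp hc)

theorem tendsto_proj_sup_noise_Ici (hU : ∀ k, Measurable (U k)) (hi : iIndepFun U P)
    (hM : Indep M.toMS (noise P U univ 1).toMS P) (hE : ∀ x, E x ≤ M) {n : α → ℕ}
    (hn : Tendsto n l atTop) (c : α → I) (f : Lp ℝ 2 P) :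
    Tendsto (fun x => (E x ⊔ noise P U (Ici (n x)) (c x)).proj f - (E x).proj f) l (𝓝 0) := by
  have hempty (x : α) : E x ⊔ noise P U ∅ 0 = E x := sup_eq_left.2 (noise_empty_le _ _)
  have h := tendsto_proj_sup_sub hM (l := l) hE hE
    (fun x => noise_le_univ (Ici (n x)) (c x)) (fun _ => noise_le_univ ∅ 0)
    (fun A _ => by simp only [sub_self, tendsto_const_nhds]) isPiSystem_noiseCylinders
    univ_mem_noiseCylinders (fun B => measurableSet_of_mem_noiseCylinders)
    (noise_univ_eq_completion hU) (fun B hB => ?_) f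
  · simpa only [hempty] using h
  · obtain ⟨m, hB⟩ := hB
    refine tendsto_const_nhds.congr' ?_
    filter_upwards [hn.eventually_ge_atTop m] with x hx
    have hdisj : Ici (n x) ∩ Iio m = ∅ := by
      ext k
      simp only [mem_inter_iff, mem_Ici, mem_Iio, mem_empty_iff_false, iff_false]
      lia
    rw [proj_noise_indLp_inter hU hi _ _ _ hB, hdisj,
      le_antisymm (noise_empty_le (c x) (noise P U ∅ 0)) (noise_empty_le 0 (noise P U ∅ (c x))),
      sub_self]

end Cylinders

end SubSigmaField

/-! ### The energy of noise -/

namespace SubSigmaField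

variable {Ω : Type*} [mΩ : MeasurableSpace Ω] {P : Measure Ω}

theorem energy_equiv_comp [IsFiniteMeasure P] (E : SubSigmaField P) {ι κ : Type*} [Fintype ι]
    [Fintype κ] (e : ι ≃ κ) (φ : Ω → ι) : E.energy (e ∘ φ) = E.energy φ := by
  refine (Equiv.sum_comp e _).symm.trans (Finset.sum_congr rfl fun b _ => ?_)
  rw [preimage_comp, ← image_singleton, e.preimage_image]

section Product

variable [IsFiniteMeasure P] {M N E D : SubSigmaField P} {ι κ : Type*} [Fintype ι] [Fintype κ]
  [MeasurableSpace ι] [MeasurableSpace κ] [MeasurableSingletonClass ι]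
  [MeasurableSingletonClass κ] {φ : Ω → ι} {ψ : Ω → κ}

theorem energy_prodMk (hMN : Indep M.toMS N.toMS P) (hE : E ≤ M) (hD : D ≤ N)
    (hφ : Measurable[M.toMS] φ) (hψ : Measurable[N.toMS] ψ) :
    (E ⊔ D).energy (fun ω => (φ ω, ψ ω)) = E.energy φ * D.energy ψ := by
  rw [energy, energy, energy, Fintype.sum_prod_type, Finset.sum_mul_sum]
  refine Finset.sum_congr rfl fun b _ => Finset.sum_congr rfl fun c _ => ?_
  have hb : MeasurableSet[M.toMS] (φ ⁻¹' {b}) := hφ (measurableSet_singleton b)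
  have hc : MeasurableSet[N.toMS] (ψ ⁻¹' {c}) := hψ (measurableSet_singleton c)
  rw [← singleton_prod_singleton, mk_preimage_prod, ← tensor_indLp (M.le _ hb) (N.le _ hc),
    proj_sup_tensor hMN hE hD (M.aestronglyMeasurable_indLp hb) (N.aestronglyMeasurable_indLp hc),
    norm_tensor hMN ((E.aestronglyMeasurable_proj _).mono hE)
      ((D.aestronglyMeasurable_proj _).mono hD), mul_pow]

theorem energy_sup_of_indep (hMN : Indep M.toMS N.toMS P) (hE : E ≤ M) (hD : D ≤ N)
    (hφ : Measurable[M.toMS] φ) : (E ⊔ D).energy φ = E.energy φ :=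
  Finset.sum_congr rfl fun b _ => by
    rw [proj_sup_indLp_of_indep hMN hE hD (hφ (measurableSet_singleton b))]

theorem energy_noise_inter {U : ℕ → Ω → I} (hU : ∀ k, Measurable (U k)) (hi : iIndepFun U P)
    (S J : Set ℕ) (a : I) (hφ : Measurable[(noise P U J 1).toMS] φ) :
    (noise P U S a).energy φ = (noise P U (S ∩ J) a).energy φ :=
  Finset.sum_congr rfl fun b _ => by
    rw [proj_noise_indLp_inter hU hi S J a (hφ (measurableSet_singleton b))]

end Product

open Classical in
/-- The random binary word recording which of `U n, …, U (n + N - 1)` belong to `[a, b)`. -/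
noncomputable def noisePattern (U : ℕ → Ω → I) (a b : I) (n N : ℕ) : Ω → Fin N → Bool :=
  fun ω i => decide (U (n + i) ω ∈ Ico a b)

variable {U : ℕ → Ω → I}

theorem measurableSet_noise_preimage_Ico (hU : ∀ k, Measurable (U k)) {S : Set ℕ} {k : ℕ}
    (hk : k ∈ S) {a b c : I} (hab : a ≤ b) (hbc : b ≤ c) :
    MeasurableSet[(noise P U S c).toMS] (U k ⁻¹' Ico a b) := by
  refine le_completion (iSup_comap_min_le hU S c) _ ?_
  refine (le_iSup₂_of_le k hk (comap_min_le_comap_min (U k) hbc) :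
    _ ≤ ⨆ j ∈ S, MeasurableSpace.comap (fun ω => min (U j ω) c) inferInstance) _
    ⟨Ico a b, measurableSet_Ico, ?_⟩
  ext ω
  simp [hab]

theorem measurable_noisePattern (hU : ∀ k, Measurable (U k)) {a b c : I} (hab : a ≤ b)
    (hbc : b ≤ c) {n N : ℕ} {S : Set ℕ} (hS : Ico n (n + N) ⊆ S) :
    Measurable[(noise P U S c).toMS] (noisePattern U a b n N) := by
  refine @measurable_pi_lambda _ _ _ (_) _ _ fun i => @measurable_to_bool _ (_) _ ?_
  have hi : (fun ω => noisePattern U a b n N ω i) ⁻¹' {true} = U (n + i) ⁻¹' Ico a b := by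
    ext ω
    simp [noisePattern]
  rw [hi]
  exact measurableSet_noise_preimage_Ico hU (hS (by simp)) hab hbc

section Law

variable [IsProbabilityMeasure P]

open Classical in
theorem energy_decide_mem (E : SubSigmaField P) {A : Set Ω} (hA : MeasurableSet A) :
    E.energy (fun ω => decide (ω ∈ A)) =
      1 - 2 * P.real A + 2 * ‖E.proj (indLp P A)‖ ^ 2 := by
  have htrue : (fun ω => decide (ω ∈ A)) ⁻¹' {true} = A := by
    ext ω
    simp
  have hfalse : (fun ω => decide (ω ∈ A)) ⁻¹' {false} = Aᶜ := by
    ext ω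
    simp
  have huniv : E.proj (indLp P univ) = indLp P univ :=
    E.proj_eq_self_iff.2 (E.aestronglyMeasurable_indLp (@MeasurableSet.univ _ E.toMS))
  have hinner : inner ℝ (indLp P univ) (E.proj (indLp P A)) = P.real A := by
    rw [← inner_proj_left, huniv, inner_indLp .univ hA, univ_inter]
  rw [energy, Fintype.sum_bool, htrue, hfalse, indLp_compl hA, map_sub, norm_sub_sq_real, huniv,
    hinner, norm_indLp_sq .univ, probReal_univ]
  ring

/- Given `U k ⊓ a`, the event `U k ∈ [a, b)` is contained in the atom `{a ≤ U k}`. -/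
theorem norm_proj_noise_indLp_Ico_sq {k : ℕ} (hU : Measurable (U k))
    (hlaw : P.map (U k) = volume) {a b : I} (hab : a ≤ b) (ha : a < 1) :
    ‖(noise P U {k} a).proj (indLp P (U k ⁻¹' Ico a b))‖ ^ 2 = ((b : ℝ) - a) ^ 2 / (1 - a) := by
  have ha' : (0 : ℝ) < 1 - a := sub_pos.2 ha
  have hIco : P.real (U k ⁻¹' Ico a b) = b - a := by
    rw [← map_measureReal_apply hU measurableSet_Ico, hlaw, Measure.real, volume_Ico,
      ENNReal.toReal_ofReal (sub_nonneg.2 hab)]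
  have hIci : P.real (U k ⁻¹' Ici a) = 1 - a := by
    rw [← map_measureReal_apply hU measurableSet_Ici, hlaw, Measure.real, volume_Ici,
      ENNReal.toReal_ofReal ha'.le]
  have hatom : U k ⁻¹' Ici a = (fun ω => min (U k ω) a) ⁻¹' {a} := by
    ext ω
    simp
  rw [noise_singleton, proj_completion_indLp_of_subset_atom (hU.min measurable_const).comap_le
    (G := U k ⁻¹' Ici a) ⟨{a}, measurableSet_singleton a, hatom.symm⟩ ?_ (hIci ▸ ha'.ne')
    (hU measurableSet_Ico) (preimage_mono Ico_subset_Ici_self), norm_smul, mul_pow,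
    norm_indLp_sq (hU measurableSet_Ici), hIci, hIco, Real.norm_eq_abs, sq_abs]
  · field_simp
  · rintro _ ⟨B, -, rfl⟩
    rw [hatom, ← preimage_inter]
    by_cases haB : a ∈ B
    · exact .inl (preimage_mono (singleton_subset_iff.2 haB))
    · rw [singleton_inter_eq_empty.2 haB, preimage_empty]
      exact .inr rfl

theorem energy_noisePattern (hU : ∀ k, Measurable (U k)) (hi : iIndepFun U P)
    (hlaw : ∀ k, P.map (U k) = volume) {a b : I} (hab : a ≤ b) (ha : a < 1) (n N : ℕ) :
    (noise P U (Ico n (n + N)) a).energy (noisePattern U a b n N) =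
      (1 - 2 * ((b : ℝ) - a) + 2 * (((b : ℝ) - a) ^ 2 / (1 - a))) ^ N := by
  classical
  induction N with
  | zero =>
    have huniv (c : Fin 0 → Bool) : noisePattern U a b n 0 ⁻¹' {c} = univ :=
      eq_univ_of_forall fun ω => Subsingleton.elim _ _
    rw [energy, Fintype.sum_unique, huniv,
      (proj_eq_self_iff _).2 (aestronglyMeasurable_indLp _ (@MeasurableSet.univ _ (_))),
      norm_indLp_sq .univ, probReal_univ, pow_zero]
  | succ N ih =>
    let last : Ω → Bool := fun ω => decide (ω ∈ U (n + N) ⁻¹' Ico a b)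
    have hpattern : noisePattern U a b n (N + 1) =
        Fin.snocEquiv (fun _ => Bool) ∘ fun ω => (last ω, noisePattern U a b n N ω) := by
      ext ω i
      refine Fin.lastCases ?_ (fun i => ?_) i <;> simp [noisePattern, last, Fin.snocEquiv]
    have hIco : Ico n (n + (N + 1)) = {n + N} ∪ Ico n (n + N) := by
      ext k
      simp only [mem_Ico, mem_union, mem_singleton_iff]
      lia
    have htrue : last ⁻¹' {true} = U (n + N) ⁻¹' Ico a b := by
      ext ω
      simp [last]
    have hlast : Measurable[(noise P U {n + N} 1).toMS] last :=
      @measurable_to_bool _ (_) _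
        (htrue ▸ measurableSet_noise_preimage_Ico hU (mem_singleton _) hab le_one')
    rw [hpattern, energy_equiv_comp, hIco, noise_union hU,
      energy_prodMk (indep_noise hU hi (by simp) 1 1) (noise_le_one _ a) (noise_le_one _ a) hlast
        (measurable_noisePattern hU hab le_one' subset_rfl),
      ih, energy_decide_mem _ (hU _ measurableSet_Ico),
      norm_proj_noise_indLp_Ico_sq (hU _) (hlaw _) hab ha,
      ← map_measureReal_apply (hU _) measurableSet_Ico, hlaw, Measure.real, volume_Ico,
      ENNReal.toReal_ofReal (sub_nonneg.2 hab), pow_succ' _ N]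

variable {M : SubSigmaField P}

theorem relNonatomic_noise (hU : ∀ k, Measurable (U k)) (hi : iIndepFun U P)
    (hlaw : ∀ k, P.map (U k) = volume) (hM : Indep M.toMS (noise P U univ 1).toMS P)
    {a b : I} (hab : a < b) (hb : b < 1) (n : ℕ) :
    RelNonatomic (M ⊔ noise P U univ a) (noise P U (Ici n) b) := by
  intro ε hε
  have hb_pos : (0 : ℝ) < 1 - b := sub_pos.2 hb
  have hab_pos : (0 : ℝ) < b - a := sub_pos.2 hab
  have ha_pos : (0 : ℝ) < 1 - a := by linarith
  have hlt : 1 - 2 * ((b : ℝ) - a) + 2 * (((b : ℝ) - a) ^ 2 / (1 - a)) < 1 := by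
    have hsq : ((b : ℝ) - a) ^ 2 / (1 - a) < b - a := by
      rw [div_lt_iff₀ ha_pos, sq]
      exact mul_lt_mul_of_pos_left (by linarith) hab_pos
    linarith
  obtain ⟨N, hN⟩ := exists_pow_lt_of_lt_one hε hlt
  have hφ {S : Set ℕ} {c : I} (hS : Ico n (n + N) ⊆ S) (hc : b ≤ c) :
      Measurable[(noise P U S c).toMS] (noisePattern U a b n N) :=
    measurable_noisePattern hU hab.le hc hS
  refine ⟨N, noisePattern U a b n N, hφ Ico_subset_Ici_self le_rfl, ?_⟩
  rwa [sup_comm, energy_sup_of_indep hM.symm (noise_le_one univ a) le_rfl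
    (hφ (subset_univ _) le_one'), energy_noise_inter hU hi univ _ a (hφ subset_rfl le_one'),
    univ_inter, energy_noisePattern hU hi hlaw hab.le (hab.trans hb)]

/- A single uniform random variable yields a whole sequence, since `I ^ ℕ` with the product of
Lebesgue measures is the image of `I` with Lebesgue measure. -/
theorem RelNonatomic.exists_noise [StandardBorelSpace Ω] (h : RelNonatomic M ⊤) :
    ∃ U : ℕ → Ω → I, (∀ k, Measurable (U k)) ∧ iIndepFun U P ∧ (∀ k, P.map (U k) = volume) ∧
      Indep M.toMS (noise P U univ 1).toMS P := by
  obtain ⟨V, hV, hlaw, hi, -⟩ := h.exists_uniform M.le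
  have hV : Measurable V := hV
  obtain ⟨f, hf, hmap⟩ := Measure.exists_measurable_map_eq
    (Measure.infinitePi fun _ : ℕ => (volume : Measure I))
  have hfk (k : ℕ) : Measurable fun x => f x k := (measurable_pi_apply k).comp hf
  have hfV (k : ℕ) : Measurable fun ω => f (V ω) k := (hfk k).comp hV
  have hjoint : P.map (fun ω => f (V ω)) =
      Measure.infinitePi fun _ : ℕ => (volume : Measure I) := by
    rw [← hmap, ← hlaw, Measure.map_map hf hV]
    rfl
  have hmarginal (k : ℕ) : P.map (fun ω => f (V ω) k) = volume := by
    rw [← Measure.infinitePi_map_eval (fun _ : ℕ => (volume : Measure I)) k, ← hjoint,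
      Measure.map_map (g := fun x : ℕ → I => x k) (f := fun ω => f (V ω))
        (measurable_pi_apply k) (hf.comp hV)]
    rfl
  refine ⟨fun k ω => f (V ω) k, hfV, ?_, hmarginal, ?_⟩
  · rw [iIndepFun_iff_map_fun_eq_infinitePi_map hfV]
    simp_rw [hmarginal]
    exact hjoint
  · have hindep := indep_completion hi
    rw [completion_toMS] at hindep
    refine indep_of_indep_of_le_right hindep (completion_mono (iSup₂_le fun k _ => ?_))
    exact (((hfk k).min measurable_const).comp (comap_measurable V)).comap_le

end Law

end SubSigmaField

/-! ### Density of conditionally nonatomic filtrations -/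

theorem tendsto_continuousMap_of_tendsto_prod {α X Y : Type*} [TopologicalSpace X]
    [TopologicalSpace Y] {l : Filter α} {f : α → C(X, Y)} {g : C(X, Y)}
    (h : ∀ x, Tendsto (fun p : α × X => f p.1 p.2) (l ×ˢ 𝓝 x) (𝓝 (g x))) :
    Tendsto f l (𝓝 g) := by
  rw [ContinuousMap.tendsto_nhds_compactOpen]
  intro K hK V hV hgV
  have hmem : {p : α × X | f p.1 p.2 ∈ V} ∈ l ×ˢ 𝓝ˢ K :=
    hK.mem_prod_nhdsSet_of_forall fun x hx => h x (hV.mem_nhds (hgV hx))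
  obtain ⟨s, hs, t, ht, hst⟩ := mem_prod_iff.1 hmem
  filter_upwards [hs] with a ha x hx
  exact @hst (a, x) ⟨ha, subset_of_mem_nhdsSet ht hx⟩

theorem exists_continuous_strictMono_lt_one {T : Set ℝ≥0∞} {t₀ : T} (ht₀ : IsBot t₀) :
    ∃ h : T → I, Continuous h ∧ StrictMono h ∧ h t₀ = 0 ∧ ∀ t, h t < 1 := by
  let e : T → ℝ := fun t => ENNReal.orderIsoUnitIntervalBirational t
  have he : Continuous e := by
    have := ENNReal.orderIsoUnitIntervalBirational.continuous
    fun_prop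
  have he_mono : StrictMono e := fun s t hst =>
    ENNReal.orderIsoUnitIntervalBirational.strictMono hst
  have he_least (t : T) : e t₀ ≤ e t := he_mono.monotone (ht₀ t)
  have he_lt (t : T) : (e t - e t₀) / 2 < 1 := by
    have : e t ≤ 1 := le_one _
    have : 0 ≤ e t₀ := nonneg _
    linarith
  refine ⟨fun t => ⟨(e t - e t₀) / 2, div_nonneg (sub_nonneg.2 (he_least t)) two_pos.le,
    (he_lt t).le⟩, Continuous.subtype_mk (by fun_prop) _, fun s t hst => ?_, ?_, he_lt⟩
  · have : e s < e t := he_mono hst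
    exact Subtype.mk_lt_mk.2 (by linarith)
  · exact Subtype.ext (by simp)

section Density

open SubSigmaField

variable {Ω : Type*} [mΩ : MeasurableSpace Ω] {P : Measure Ω} [IsProbabilityMeasure P]
  {U : ℕ → Ω → I} {M : SubSigmaField P}

theorem relNonatomic_sup_noise (hU : ∀ k, Measurable (U k)) (hi : iIndepFun U P)
    (hlaw : ∀ k, P.map (U k) = volume) (hM : Indep M.toMS (noise P U univ 1).toMS P)
    {E : SubSigmaField P} (hE : E ≤ M) {a b : I} (hab : a < b) (hb : b < 1) (n : ℕ) :
    RelNonatomic (E ⊔ noise P U (Ici n) a) (noise P U (Ici n) b) :=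
  (relNonatomic_noise hU hi hlaw hM hab hb n).mono
    (sup_le_sup hE (noise_mono (subset_univ _) le_rfl)) le_rfl

variable [StandardBorelSpace Ω] {T : Set ℝ≥0∞}

theorem mem_cnaFiltrations_iff {F : filtrationSpace P T} :
    F ∈ cnaFiltrations P T ↔ ∀ s t : T, s < t → RelNonatomic (F.1 s : SubSigmaField P) (F.1 t) :=
  forall₃_congr fun s t hst => isNonatomicOver_iff.trans (and_iff_right (F.2.1 s t hst.le))

theorem sup_noise_mem_condNonatomic (hU : ∀ k, Measurable (U k)) (hi : iIndepFun U P)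
    (hlaw : ∀ k, P.map (U k) = volume) (hM : Indep M.toMS (noise P U univ 1).toMS P)
    {E : SubSigmaField P} (hE : E ≤ M) {a : I} (ha : a < 1) (n : ℕ) :
    E ⊔ noise P U (Ici n) a ∈ condNonatomic P := by
  obtain ⟨b, hab, hb⟩ := exists_between ha
  exact mem_condNonatomic_iff.2
    ((relNonatomic_sup_noise hU hi hlaw hM hE hab hb n).mono le_rfl le_top)

variable {F : filtrationSpace P T} {h : T → I}

theorem exists_mem_cnaFiltrations_eq_sup_noise (hU : ∀ k, Measurable (U k)) (hi : iIndepFun U P)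
    (hlaw : ∀ k, P.map (U k) = volume) (hM : Indep M.toMS (noise P U univ 1).toMS P)
    (hF : ∀ t, (F.1 t : SubSigmaField P) ≤ M) (hc : Continuous h) (hmono : StrictMono h)
    (hzero : ∀ t : T, IsLeast T t → h t = 0) (hlt : ∀ t, h t < 1) (n : ℕ) :
    ∃ G ∈ cnaFiltrations P T, ∀ t,
      (G.1 t : SubSigmaField P) = (F.1 t : SubSigmaField P) ⊔ noise P U (Ici n) (h t) := by
  let H : C(T, condNonatomic P) :=
    { toFun := fun t => ⟨_, sup_noise_mem_condNonatomic hU hi hlaw hM (hF t) (hlt t) n⟩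
      continuous_toFun := Continuous.subtype_mk (continuous_iff_continuousAt.2 fun t =>
        tendsto_sup_noise hU hi hlaw hM hF (hF t)
          ((continuous_subtype_val.comp F.1.continuous).tendsto t) (Ici n) (hc.tendsto t)) _ }
  have hH_mono (s t : T) (hst : s ≤ t) : (H s : SubSigmaField P) ≤ H t :=
    sup_le_sup (F.2.1 s t hst) (noise_mono subset_rfl (hmono.monotone hst))
  have hH_trivial (t : T) (ht : IsLeast T t) : (H t : SubSigmaField P).IsTrivial := by
    have hle : (H t : SubSigmaField P) ≤ F.1 t := by
      change (F.1 t : SubSigmaField P) ⊔ noise P U (Ici n) (h t) ≤ F.1 t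
      rw [hzero t ht]
      exact sup_le le_rfl (noise_zero_le _ _)
    exact fun s hs => F.2.2 t ht s (hle s hs)
  refine ⟨⟨H, hH_mono, hH_trivial⟩, mem_cnaFiltrations_iff.2 fun s t hst => ?_, fun t => rfl⟩
  exact (relNonatomic_sup_noise hU hi hlaw hM (hF s) (hmono hst) (hlt t) n).mono le_rfl le_sup_right

theorem tendsto_of_eq_sup_noise (hU : ∀ k, Measurable (U k)) (hi : iIndepFun U P)
    (hM : Indep M.toMS (noise P U univ 1).toMS P) (hF : ∀ t, (F.1 t : SubSigmaField P) ≤ M)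
    {G : ℕ → filtrationSpace P T}
    (hG : ∀ n t,
      ((G n).1 t : SubSigmaField P) = (F.1 t : SubSigmaField P) ⊔ noise P U (Ici n) (h t)) :
    Tendsto G atTop (𝓝 F) := by
  rw [tendsto_subtype_rng]
  refine tendsto_continuousMap_of_tendsto_prod fun t => ?_
  rw [tendsto_subtype_rng, tendsto_iff_proj]
  intro f
  have hnoise := tendsto_proj_sup_noise_Ici hU hi hM (l := atTop ×ˢ 𝓝 t)
    (fun p : ℕ × T => hF p.2) tendsto_fst (fun p => h p.2) f
  have hproj : Tendsto (fun p : ℕ × T => (F.1 p.2 : SubSigmaField P).proj f) (atTop ×ˢ 𝓝 t)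
      (𝓝 ((F.1 t : SubSigmaField P).proj f)) :=
    (((continuous_proj f).comp (continuous_subtype_val.comp F.1.continuous)).tendsto t).comp
      tendsto_snd
  simpa only [sub_add_cancel, zero_add, ← hG] using hnoise.add hproj

theorem dense_cnaFiltrations (hT : IsCompact T) : Dense (cnaFiltrations P T) := by
  intro F
  rcases T.eq_empty_or_nonempty with rfl | hne
  · exact subset_closure fun s => s.2.elim
  obtain ⟨t₀, ht₀⟩ := hT.exists_isLeast hne
  obtain ⟨t₁, ht₁⟩ := hT.exists_isGreatest hne
  let M : SubSigmaField P := F.1 ⟨t₁, ht₁.1⟩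
  have hF (t : T) : (F.1 t : SubSigmaField P) ≤ M := F.2.1 t ⟨t₁, ht₁.1⟩ (ht₁.2 t.2)
  have hM : RelNonatomic M ⊤ := mem_condNonatomic_iff.1 (F.1 ⟨t₁, ht₁.1⟩).2
  obtain ⟨U, hU, hi, hlaw, hMU⟩ := hM.exists_noise
  obtain ⟨h, hc, hmono, hzero, hlt⟩ :=
    exists_continuous_strictMono_lt_one (t₀ := ⟨t₀, ht₀.1⟩) fun t => ht₀.2 t.2
  have hleast (t : T) (ht : IsLeast T t) : h t = 0 := by
    rw [← hzero]
    exact congrArg h (Subtype.ext (ht.unique ht₀))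
  choose G hG hGF using
    exists_mem_cnaFiltrations_eq_sup_noise hU hi hlaw hMU hF hc hmono hleast hlt
  exact mem_closure_of_tendsto (tendsto_of_eq_sup_noise hU hi hMU hF hGF) (.of_forall hG)

end Density

/-! ### Spaces of filtrations are Polish -/

theorem isOpen_setOf_forall_mem_of_isCompact {X Y : Type*} [TopologicalSpace X]
    [TopologicalSpace Y] {K : Set Y} (hK : IsCompact K) {V : Set (X × Y)} (hV : IsOpen V) :
    IsOpen {x | ∀ y ∈ K, (x, y) ∈ V} :=
  isOpen_iff_eventually.2 fun _ hx =>
    hK.eventually_forall_of_forall_eventually fun y hy => hV.mem_nhds (hx y hy)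

namespace SubSigmaField

section Order

variable {Ω : Type*} [mΩ : MeasurableSpace Ω] {P : Measure Ω}

theorem le_iff_proj_proj_eq [IsFiniteMeasure P] {E F : SubSigmaField P} :
    E ≤ F ↔ ∀ f, F.proj (E.proj f) = E.proj f := by
  refine ⟨fun h f => F.proj_eq_self_iff.2 ((E.aestronglyMeasurable_proj f).mono h),
    fun h s hs => ?_⟩
  rw [← F.proj_indLp_eq_self_iff (E.le s hs), ← (E.proj_indLp_eq_self_iff (E.le s hs)).2 hs, h]

instance [IsFiniteMeasure P] : OrderClosedTopology (SubSigmaField P) where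
  isClosed_le' := by
    simp only [le_iff_proj_proj_eq, ofPred_forall]
    refine isClosed_iInter fun f => ?_
    have hproj : Continuous fun p : SubSigmaField P × SubSigmaField P => p.1.proj f :=
      (continuous_proj f).comp continuous_fst
    exact isClosed_eq
      (Continuous.comp continuous_proj_uncurry (continuous_snd.prodMk hproj) :) hproj

theorem isTrivial_iff_le_completion_bot [IsProbabilityMeasure P] {E : SubSigmaField P} :
    E.IsTrivial ↔ E ≤ completion ⊥ P := by
  refine ⟨fun h s hs => ⟨E.le s hs, ?_⟩, fun h s hs => ?_⟩
  · rcases h s hs with hzero | hone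
    · exact ⟨∅, @MeasurableSet.empty _ ⊥, ae_eq_empty.2 hzero⟩
    · exact ⟨univ, @MeasurableSet.univ _ ⊥,
        eventuallyEq_univ.2 ((prob_compl_eq_zero_iff (E.le s hs)).2 hone)⟩
  · obtain ⟨-, t, ht, hst⟩ := h s hs
    rw [measure_congr hst]
    rcases MeasurableSpace.measurableSet_bot_iff.1 ht with rfl | rfl
    · exact .inl measure_empty
    · exact .inr measure_univ

end Order

section StandardBorel

variable {Ω : Type*} [mΩ : MeasurableSpace Ω] [StandardBorelSpace Ω] {P : Measure Ω}
  [IsFiniteMeasure P] {E F : SubSigmaField P}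

theorem isGδ_condNonatomic : IsGδ (condNonatomic P) := by
  have hinter : condNonatomic P =
      ⋂ n : ℕ, (fun E => (E, (⊤ : SubSigmaField P))) ⁻¹' nearlyRelNonatomic P (1 / (n + 1)) := by
    ext E
    rw [mem_condNonatomic_iff, relNonatomic_iff, mem_iInter]
    rfl
  rw [hinter]
  exact .iInter fun n => ((isOpen_nearlyRelNonatomic _).preimage (by fun_prop)).isGδ

instance : PolishSpace (condNonatomic P) := polishSpace_of_isGδ isGδ_condNonatomic

theorem energy_smul (g : Aut P) (E : SubSigmaField P) {ι : Type*} [Fintype ι] [MeasurableSpace ι]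
    [MeasurableSingletonClass ι] {φ : Ω → ι} (hφ : Measurable φ) :
    (g • E).energy (φ ∘ g.pointMap) = E.energy φ :=
  Finset.sum_congr rfl fun b _ => by
    rw [preimage_comp,
      ← Aut.koopman_indLp g (Aut.mapsSet_pointMap g (hφ (measurableSet_singleton b))),
      proj_smul_koopman, LinearIsometry.norm_map]

theorem RelNonatomic.smul (g : Aut P) (h : RelNonatomic E F) : RelNonatomic (g • E) (g • F) := by
  intro ε hε
  obtain ⟨N, φ, hφ, henergy⟩ := h ε hε
  refine ⟨N, φ ∘ g.pointMap, hφ.comp (measurable_pointMap_smul g F), ?_⟩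
  rwa [energy_smul g E (hφ.mono F.le le_rfl)]

theorem smul_mem_condNonatomic (g : Aut P) (hE : E ∈ condNonatomic P) :
    g • E ∈ condNonatomic P :=
  mem_condNonatomic_iff.2 (((mem_condNonatomic_iff.1 hE).smul g).mono le_rfl le_top)

end StandardBorel

end SubSigmaField

section Filtrations

open SubSigmaField

variable {Ω : Type*} [mΩ : MeasurableSpace Ω] [StandardBorelSpace Ω] {P : Measure Ω}
  [IsProbabilityMeasure P] {T : Set ℝ≥0∞}

theorem isClosed_filtrationSpace : IsClosed (filtrationSpace P T) := by
  have heval (t : T) : Continuous fun F : C(T, condNonatomic P) => (F t : SubSigmaField P) :=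
    continuous_subtype_val.comp (continuous_eval_const t)
  simp only [filtrationSpace, isTrivial_iff_le_completion_bot, ofPred_and, ofPred_forall]
  exact (isClosed_iInter fun s => isClosed_iInter fun t => isClosed_iInter fun _ =>
    isClosed_le (heval s) (heval t)).inter
    (isClosed_iInter fun t => isClosed_iInter fun _ => isClosed_le (heval t) continuous_const)

theorem polishSpace_filtrationSpace [CompactSpace T] : PolishSpace (filtrationSpace P T) :=
  have : PolishSpace C(T, condNonatomic P) := polishSpace_continuousMap
  isClosed_filtrationSpace.polishSpace

theorem continuous_filtration_eval [CompactSpace T] {X : Type*} [TopologicalSpace X]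
    {F : X → filtrationSpace P T} {t : X → T} (hF : Continuous F) (ht : Continuous t) :
    Continuous fun x => ((F x).1 (t x) : SubSigmaField P) :=
  continuous_subtype_val.comp ((continuous_subtype_val.comp hF).eval ht)

theorem isOpen_setOf_forall_mem_nearlyRelNonatomic [CompactSpace T] (q q' : ℝ≥0∞) (ε : ℝ) :
    IsOpen {F : filtrationSpace P T | ∀ p ∈ {p : T × T | (p.1 : ℝ≥0∞) ≤ q ∧ q' ≤ p.2},
      ((F.1 p.1 : SubSigmaField P), (F.1 p.2 : SubSigmaField P)) ∈ nearlyRelNonatomic P ε} := by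
  have hcompact : IsCompact {p : T × T | (p.1 : ℝ≥0∞) ≤ q ∧ q' ≤ p.2} :=
    ((isClosed_le (continuous_subtype_val.comp continuous_fst) continuous_const).inter
      (isClosed_le continuous_const (continuous_subtype_val.comp continuous_snd))).isCompact
  exact isOpen_setOf_forall_mem_of_isCompact hcompact ((isOpen_nearlyRelNonatomic ε).preimage
    ((continuous_filtration_eval continuous_fst continuous_snd.fst).prodMk
      (continuous_filtration_eval continuous_fst continuous_snd.snd)))

/- The condition `s < t` is not closed, so the pairs `(s, t)` are exhausted by the compact sets
`s ≤ q < q' ≤ t` with `q` and `q'` in a countable dense set. -/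
theorem isGδ_cnaFiltrations (hT : IsCompact T) : IsGδ (cnaFiltrations P T) := by
  have : CompactSpace T := isCompact_iff_compactSpace.1 hT
  obtain ⟨D, hDc, hD⟩ := TopologicalSpace.exists_countable_dense ℝ≥0∞
  have hinter : cnaFiltrations P T = ⋂ q ∈ D, ⋂ q' ∈ D, ⋂ (_ : q < q'), ⋂ n : ℕ,
      {F | ∀ p ∈ {p : T × T | (p.1 : ℝ≥0∞) ≤ q ∧ q' ≤ p.2},
        ((F.1 p.1 : SubSigmaField P), (F.1 p.2 : SubSigmaField P)) ∈
          nearlyRelNonatomic P (1 / (n + 1))} := by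
    ext F
    rw [mem_cnaFiltrations_iff]
    simp only [mem_iInter]
    refine ⟨fun h q _ q' _ hqq n p hp => ?_, fun h s t hst => ?_⟩
    · exact relNonatomic_iff.1 (h p.1 p.2 (hp.1.trans_lt (hqq.trans_le hp.2))) n
    · obtain ⟨q, hq, hsq, hqt⟩ := hD.exists_between hst
      obtain ⟨q', hq', hqq, hqt'⟩ := hD.exists_between hqt
      exact relNonatomic_iff.2 fun n => h q hq q' hq' hqq n (s, t) ⟨hsq.le, hqt'.le⟩
  rw [hinter]
  exact .biInter hDc fun q _ => .biInter hDc fun q' _ => .iInter fun _ => .iInter fun n =>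
    (isOpen_setOf_forall_mem_nearlyRelNonatomic q q' _).isGδ

/-! ### The action on filtrations -/

theorem cnaFiltrations_ext {x y : cnaFiltrations P T}
    (h : ∀ t, (x.1.1 t : SubSigmaField P) = y.1.1 t) : x = y :=
  Subtype.ext (Subtype.ext (ContinuousMap.ext fun t => Subtype.ext (h t)))

/-- The image of a conditionally nonatomic filtration under an automorphism. -/
noncomputable def cnaSMul (g : Aut P) (x : cnaFiltrations P T) : cnaFiltrations P T :=
  ⟨⟨⟨fun t => ⟨g • (x.1.1 t : SubSigmaField P), smul_mem_condNonatomic g (x.1.1 t).2⟩,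
      ((continuous_const_smul g).comp
        (continuous_subtype_val.comp x.1.1.continuous)).subtype_mk _⟩,
    fun s t hst => smul_mono g (x.1.2.1 s t hst), fun t ht => (x.1.2.2 t ht).smul g⟩,
    mem_cnaFiltrations_iff.2 fun s t hst => (mem_cnaFiltrations_iff.1 x.2 s t hst).smul g⟩

theorem cnaSMul_apply (g : Aut P) (x : cnaFiltrations P T) (t : T) :
    ((cnaSMul g x).1.1 t : SubSigmaField P) = g • (x.1.1 t : SubSigmaField P) := rfl

/-- The action of `Aut P` on conditionally nonatomic filtrations. -/
noncomputable abbrev cnaMulAction (P : Measure Ω) [IsProbabilityMeasure P] (T : Set ℝ≥0∞) :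
    MulAction (Aut P) (cnaFiltrations P T) where
  smul := cnaSMul
  one_smul x := cnaFiltrations_ext fun t => (cnaSMul_apply 1 x t).trans (one_smul _ _)
  mul_smul g h x := cnaFiltrations_ext fun t => (cnaSMul_apply (g * h) x t).trans (mul_smul _ _ _)

theorem continuous_cnaSMul [CompactSpace T] :
    Continuous fun p : Aut P × cnaFiltrations P T => cnaSMul p.1 p.2 := by
  rw [IsInducing.subtypeVal.continuous_iff, IsInducing.subtypeVal.continuous_iff]
  refine ContinuousMap.continuous_of_continuous_uncurry _ ?_
  rw [IsInducing.subtypeVal.continuous_iff]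
  exact continuous_fst.fst.smul (continuous_filtration_eval
    (continuous_subtype_val.comp continuous_fst.snd) continuous_snd)

theorem isPolishGSpace_cnaFiltrations (hT : IsCompact T) :
    letI := cnaMulAction P T
    IsPolishGSpace (Aut P) (cnaFiltrations P T) :=
  letI := cnaMulAction P T
  have : CompactSpace T := isCompact_iff_compactSpace.1 hT
  have : PolishSpace (filtrationSpace P T) := polishSpace_filtrationSpace
  { isTopologicalGroup := inferInstance
    polishSpace_group := inferInstance
    polishSpace := polishSpace_of_isGδ (isGδ_cnaFiltrations hT)
    continuous_smul := continuous_cnaSMul }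

end Filtrations

end SigmaFields

theorem theorem4 {Ω : Type*} [MeasurableSpace Ω] [StandardBorelSpace Ω]
    (P : Measure Ω) [IsProbabilityMeasure P] [NullSingletonClass P]
    (T : Set ℝ≥0∞) (hT : IsCompact T) :
    IsGδ (SigmaFields.cnaFiltrations P T) ∧
    Dense (SigmaFields.cnaFiltrations P T) ∧
    SigmaFields.cnaFiltrations P T ∈ residual (SigmaFields.filtrationSpace P T) ∧
    ∃ _ : MulAction (SigmaFields.Aut P) (SigmaFields.cnaFiltrations P T),
      (∀ (g : SigmaFields.Aut P) (x : SigmaFields.cnaFiltrations P T) (t : T),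
        ((g • x).1.1 t : SigmaFields.SubSigmaField P) =
          g • (x.1.1 t : SigmaFields.SubSigmaField P)) ∧
      SigmaFields.IsPolishGSpace (SigmaFields.Aut P) (SigmaFields.cnaFiltrations P T) :=
  ⟨SigmaFields.isGδ_cnaFiltrations hT, SigmaFields.dense_cnaFiltrations hT,
    residual_of_dense_Gδ (SigmaFields.isGδ_cnaFiltrations hT) (SigmaFields.dense_cnaFiltrations hT),
    SigmaFields.cnaMulAction P T, SigmaFields.cnaSMul_apply,
    SigmaFields.isPolishGSpace_cnaFiltrations hT⟩
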